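/- Let $K$ be a number field with ring of integers $R$, let $A\neq 0$ be a finite dimensional semisimple $K$-algebra, and let $\mathcal O$ be an $R$-order in $A$, i.e. a subring containing $R$ that is a finitely generated $R$-module with $K\mathcal O=A$. Put $A_{\mathbb R}=\mathbb R\otimes_{\mathbb Q}A$ and $K_{\mathbb R}=\mathbb R\otimes_{\mathbb Q}K$. Let $\operatorname{tr}_{A_{\mathbb R}|K_{\mathbb R}}$ be the $\mathbb R$-linear extension of the reduced trace $\operatorname{tr}_{A|K}$, put $\operatorname{tr}_{A_{\mathbb R}|\mathbb R}=\operatorname{tr}_{K_{\mathbb R}|\mathbb R}\circ\operatorname{tr}_{A_{\mathbb R}|K_{\mathbb R}}$, and let $N_{A_{\mathbb R}|\mathbb R}(x)=\det_{\mathbb R}(y\mapsto yx)$. Fix a positive involution $*$ on $A_{\mathbb R}$, i.e. an $\mathbb R$-linear anti-automorphism with $x^{**}=x$ such that $(x,y)\mapsto\operatorname{tr}_{A_{\mathbb R}|\mathbb R}(xy^*)$ is symmetric and positive definite. Arithmetic vector bundles. An arithmetic vector bundle $\overline E=(E,h)$ on $\operatorname{Spec}\mathcal O$ consists of a left $\mathcal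 O$-module $E$, finitely generated and torsion free over $R$, such that $A\otimes_{\mathcal O}E$ is a free $A$-module, and a map $h:E_{\mathbb R}\times E_{\mathbb R}\to A_{\mathbb R}$ on $E_{\mathbb R}=A_{\mathbb R}\otimes_{\mathcal O}E=\mathbb R\otimes_{\mathbb Z}E$ that is additive in each argument, $A_{\mathbb R}$-linear in the first argument, satisfies $h(x,y)=h(y,x)^*$, and is such that $\operatorname{tr}_{A_{\mathbb R}|\mathbb R}\circ h$ is positive definite. Isomorphisms are $\mathcal O$-linear isomorphisms inducing isometries. A short exact sequence $0\to\overline E'\to\overline E\to\overline E''\to0$ is an exact sequence of $\mathcal O$-modules such that $E'_{\mathbb R}$ is mapped isometrically onto its image in $E_{\mathbb R}$ and the orthogonal complement of that image is mapped isometrically onto $E''_{\mathbb R}$. The Grothendieck group $\widehat K_0(\mathcal O)$ is the free abelian group on the isomorphism classes $\{\overline E\}$ modulo the elements $\{\overline E'\}+\{\overline E''\}-\{\overline E\}$ for all short exact sequences. The group $\widehat K_0(R)$ is defined in the same way for the order $R$ in $K$, with the canonical involution of $K_{\mathbb R}$ (complex conjugation at all archimedean places). Complete ideals. A full left $\mathcal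 O$-ideal is a left $\mathcal O$-submodule $\mathfrak a\subset A$ that is finitely generated over $R$ and satisfies $K\mathfrak a=A$; a complete $\mathcal O$-ideal is a pair $\overline{\mathfrak a}=(\mathfrak a,\mathfrak a_\infty)$ of such an $\mathfrak a$ and a unit $\mathfrak a_\infty\in A_{\mathbb R}^\times$; put $\overline{\mathcal O}=(\mathcal O,1)$. It defines the arithmetic vector bundle $L(\overline{\mathfrak a})=(\mathfrak a,h_{\overline{\mathfrak a}})$ with $h_{\overline{\mathfrak a}}(x,y)=x\,\mathfrak a_\infty\mathfrak a_\infty^*\,y^*$ on $\mathfrak a_{\mathbb R}=A_{\mathbb R}$; write $[\overline{\mathcal O}]=[L(\overline{\mathcal O})]$. Let $\mathfrak p$ run through the prime ideals of $\mathcal O$, i.e. the proper two-sided ideals with $K\mathfrak p=A$ such that $a\mathcal Ob\not\subset\mathfrak p$ for all $a,b\notin\mathfrak p$. Put $\mathfrak N(\mathfrak p)=\#(\mathcal O/\mathfrak p)$, and let the capacity $\kappa_{\mathfrak p}$ be determined by $\mathcal O/\mathfrak p\cong M_{\kappa_{\mathfrak p}}(S)$ with a skew field $S$. For an $\mathcal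 O$-module $M$ of finite length let $\operatorname{ord}_{\mathfrak p}(M)$ be the number of its composition factors with annihilator $\mathfrak p$, and put $\operatorname{ord}_{\mathfrak p}(\mathfrak a)=\operatorname{ord}_{\mathfrak p}(\mathcal O/\mathfrak ar)-\operatorname{ord}_{\mathfrak p}(\mathcal O/\mathcal Or)$ for any nonzero $r\in R$ with $\mathfrak ar\subset\mathcal O$. Then $\widehat{\operatorname{div}}(\overline{\mathfrak a})=\big(\sum_{\mathfrak p}-\operatorname{ord}_{\mathfrak p}(\mathfrak a)\,\mathfrak p,\ \mathfrak a_\infty\big)$, and $\deg\big(\sum_{\mathfrak p}v_{\mathfrak p}\mathfrak p,\,D_\infty\big)=\sum_{\mathfrak p}\frac{v_{\mathfrak p}}{\kappa_{\mathfrak p}}\log\mathfrak N(\mathfrak p)-\log|N_{A_{\mathbb R}|\mathbb R}(D_\infty)|$. Theorem. (i) There are well-defined homomorphisms $\operatorname{rk}:\widehat K_0(\mathcal O)\to\mathbb Z$ with $\operatorname{rk}[\overline E]=\operatorname{rk}_A(A\otimes_{\mathcal O}E)$; $i_*:\widehat K_0(\mathcal O)\to\widehat K_0(R)$ with $i_*[(E,h)]=[(E,\operatorname{tr}_{A_{\mathbb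 R}|K_{\mathbb R}}\circ h)]$; and the arithmetic degree $\widehat{\deg}_K:\widehat K_0(R)\to\mathbb R$ over $K$, given by $$\widehat{\deg}_K[(E,h)]=\log\#\big(E/(Rx_1+\dots+Rx_r)\big)-\tfrac12\log\big|N_{K_{\mathbb R}|\mathbb R}\big(\det(h(x_i,x_j))_{i,j}\big)\big|$$ for any maximal $R$-linearly independent family $x_1,\dots,x_r$ in $E$. (ii) There is a unique homomorphism $\widehat{\deg}_{\mathcal O}:\widehat K_0(\mathcal O)\to\mathbb R$ with $\widehat{\deg}_{\mathcal O}([L(\overline{\mathfrak a})])=\deg(\widehat{\operatorname{div}}(\overline{\mathfrak a}))$ for every complete $\mathcal O$-ideal $\overline{\mathfrak a}$. It is given on all of $\widehat K_0(\mathcal O)$ by $$\widehat{\deg}_{\mathcal O}([\overline E])=\widehat{\deg}_K(i_*[\overline E])-\operatorname{rk}([\overline E])\,\widehat{\deg}_K(i_*[\overline{\mathcal O}]).$$ (iii) If $K=\mathbb Q$, then $\widehat{\deg}_K(i_*[\overline{\mathcal O}])=\chi(\overline{\mathcal O})$, where $\chi(\overline{\mathcal O})=-\log\operatorname{vol}(\mathcal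 O)$ and $\operatorname{vol}(\mathcal O)$ is the volume of a fundamental domain of the lattice $\mathcal O\subset A_{\mathbb R}$ with respect to the Haar measure on $A_{\mathbb R}$ given by the trace form $(x,y)\mapsto\operatorname{tr}_{A_{\mathbb R}|\mathbb R}(xy)$ (the parallelepiped spanned by a basis $v_1,\dots,v_n$ of $A_{\mathbb R}$ has volume $|\det(\operatorname{tr}_{A_{\mathbb R}|\mathbb R}(v_iv_j))|^{1/2}$). -/

import Mathlib

open scoped TensorProduct NumberField
open NumberField

universe u v w x

set_option linter.unusedSectionVars false

noncomputable section

namespace NCArith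

/-! ### The real algebra `A_ℝ = ℝ ⊗_ℚ A`, reduced traces and norms -/

/-- The real algebra `A_ℝ = ℝ ⊗_ℚ A`. -/
abbrev RealAlg (A : Type u) [Ring A] [Algebra ℚ A] : Type u := ℝ ⊗[ℚ] A

/-- The embedding `j : A → A_ℝ`, `a ↦ 1 ⊗ a`. -/
abbrev toReal {A : Type u} [Ring A] [Algebra ℚ A] (a : A) : RealAlg A := (1 : ℝ) ⊗ₜ[ℚ] a

/-- `t : A → K` is the reduced trace of the `K`-algebra `A`: over an algebraic closure `K̄` of `K`,
the algebra `K̄ ⊗_K A` is isomorphic to a product of matrix algebras over `K̄`, and `t x` is the sum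
of the matrix traces of the components of `1 ⊗ x`. -/
def IsReducedTrace (K : Type w) [Field K] (A : Type u) [Ring A] [Algebra K A]
    (t : A →ₗ[K] K) : Prop :=
  ∃ (n : ℕ) (d : Fin n → ℕ)
    (φ : AlgebraicClosure K ⊗[K] A ≃ₐ[AlgebraicClosure K]
      ((i : Fin n) → Matrix (Fin (d i)) (Fin (d i)) (AlgebraicClosure K))),
    ∀ x : A, algebraMap K (AlgebraicClosure K) (t x) =
      ∑ i, Matrix.trace (φ ((1 : AlgebraicClosure K) ⊗ₜ[K] x) i)

open Classical in
/-- The reduced trace `tr_{A|K}` of a finite dimensional (separable) semisimple `K`-algebra `A`. -/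
def reducedTrace (K : Type w) [Field K] (A : Type u) [Ring A] [Algebra K A] : A →ₗ[K] K :=
  if h : ∃ t : A →ₗ[K] K, IsReducedTrace K A t then h.choose else 0

section Traces

variable (K : Type w) [Field K] [NumberField K] (A : Type u) [Ring A] [Algebra K A] [Algebra ℚ A]

/-- The reduced trace `tr_{A_ℝ|K_ℝ} : A_ℝ → K_ℝ`, the scalar extension of `tr_{A|K}`. -/
def trRealAlg : RealAlg A →ₗ[ℝ] RealAlg K :=
  ((reducedTrace K A).restrictScalars ℚ).baseChange ℝ

/-- The reduced trace `tr_{A_ℝ|ℝ} : A_ℝ → ℝ`, the scalar extension of the reduced trace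
`tr_{A|ℚ} = tr_{K|ℚ} ∘ tr_{A|K}`. -/
def trReal : RealAlg A →ₗ[ℝ] ℝ :=
  (TensorProduct.AlgebraTensorModule.rid ℚ ℝ ℝ).toLinearMap ∘ₗ
    ((Algebra.trace ℚ K) ∘ₗ ((reducedTrace K A).restrictScalars ℚ)).baseChange ℝ

/-- The norm `N_{A_ℝ|ℝ}(x) = det_ℝ (y ↦ y x)`. -/
def normReal {A : Type u} [Ring A] [Algebra ℚ A] (x : RealAlg A) : ℝ :=
  LinearMap.det (LinearMap.mulRight ℝ x)

/-- A positive involution on the semisimple real algebra `A_ℝ`: an `ℝ`-linear anti-automorphism of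
order at most two whose twisted trace form `(x, y) ↦ tr_{A_ℝ|ℝ}(x y^*)` is symmetric and positive
definite. (Such an involution fixes every central idempotent, so it maps each simple component
to itself; and it is positive on `A_ℝ` if and only if it restricts to a positive involution on each
simple component.) -/
structure IsPositiveInvolution {A : Type u} [Ring A] [Algebra K A] [Algebra ℚ A]
    (σ : RealAlg A →ₗ[ℝ] RealAlg A) : Prop where
  map_mul : ∀ x y, σ (x * y) = σ y * σ x
  invol : ∀ x, σ (σ x) = x
  symm : ∀ x y, trReal K A (x * σ y) = trReal K A (y * σ x)
  pos : ∀ x, x ≠ 0 → 0 < trReal K A (x * σ x)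

end Traces

/-! ### The canonical involution of `K_ℝ` -/

section Conj

variable (K : Type w) [Field K] [NumberField K]

/-- The homomorphism `K_ℝ → ℝ^r × ℂ^s` induced by the archimedean places of `K`. -/
def minkowskiHom : RealAlg K →ₐ[ℝ] mixedEmbedding.mixedSpace K :=
  Algebra.TensorProduct.lift (Algebra.ofId ℝ (mixedEmbedding.mixedSpace K))
    ((mixedEmbedding K).toRatAlgHom) (fun _ _ => Commute.all _ _)

theorem minkowskiHom_bijective : Function.Bijective (minkowskiHom K) := by
  let e : RealAlg K ≃ₗ[ℝ] mixedEmbedding.mixedSpace K :=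
    ((integralBasis K).baseChange ℝ).equiv (mixedEmbedding.latticeBasis K) (Equiv.refl _)
  have : (minkowskiHom K).toLinearMap = e.toLinearMap := by
    apply ((integralBasis K).baseChange ℝ).ext
    intro i
    rw [LinearEquiv.coe_coe, Module.Basis.equiv_apply, Module.Basis.baseChange_apply,
      Equiv.refl_apply, mixedEmbedding.latticeBasis_apply]
    simp only [minkowskiHom, integralBasis_apply, AlgHom.toLinearMap_apply,
      Algebra.TensorProduct.lift_tmul, map_one]
    exact one_mul _
  have h2 : ⇑(minkowskiHom K) = ⇑e := funext fun x => LinearMap.congr_fun this x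
  rw [h2]
  exact e.bijective

/-- The isomorphism of `K_ℝ = ℝ ⊗_ℚ K` with the Minkowski space `ℝ^r × ℂ^s` of `K`. -/
def minkowskiEquiv : RealAlg K ≃ₐ[ℝ] mixedEmbedding.mixedSpace K :=
  AlgEquiv.ofBijective (minkowskiHom K) (minkowskiHom_bijective K)

/-- Componentwise complex conjugation on `ℝ^r × ℂ^s`. -/
def mixedConj : mixedEmbedding.mixedSpace K ≃ₐ[ℝ] mixedEmbedding.mixedSpace K :=
  AlgEquiv.ofRingEquiv (f := starRingAut (R := mixedEmbedding.mixedSpace K)) (by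
    intro r
    ext i <;> simp)

/-- The canonical involution of `K_ℝ` : complex conjugation at every archimedean place. -/
def conjAlgEquiv : RealAlg K ≃ₐ[ℝ] RealAlg K :=
  ((minkowskiEquiv K).trans (mixedConj K)).trans (minkowskiEquiv K).symm

/-- The canonical involution of `K_ℝ`, as a linear map. -/
def conjReal : RealAlg K →ₗ[ℝ] RealAlg K := (conjAlgEquiv K).toLinearMap

end Conj

/-! ### Auxiliary facts: the reduced trace and a positive involution over `K_ℝ` -/

section Aux

theorem isReducedTrace_self (K : Type w) [Field K] : IsReducedTrace K K LinearMap.id := by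
  let F := AlgebraicClosure K
  let e₁ : F ⊗[K] K ≃ₐ[F] F := Algebra.TensorProduct.rid K F F
  let e₂ : F ≃ₐ[F] ((i : Fin 1) → Matrix (Fin 1) (Fin 1) F) :=
    AlgEquiv.ofBijective (Algebra.ofId F _) (by
      refine ⟨(algebraMap F _).injective, fun M => ⟨M 0 0 0, ?_⟩⟩
      ext i j k
      fin_cases i; fin_cases j; fin_cases k
      simp [Algebra.ofId_apply, Pi.algebraMap_apply, Matrix.algebraMap_matrix_apply])
  refine ⟨1, fun _ => 1, e₁.trans e₂, fun x => ?_⟩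
  change _ = ∑ i : Fin 1, Matrix.trace (algebraMap F
    ((i : Fin 1) → Matrix (Fin 1) (Fin 1) F) (x • (1 : F)) i)
  simp [F, Matrix.trace, Algebra.algebraMap_eq_smul_one]

theorem IsReducedTrace.self_eq {K : Type w} [Field K] {t : K →ₗ[K] K} (ht : IsReducedTrace K K t) :
    t = LinearMap.id := by
  obtain ⟨n, d, φ, h⟩ := ht
  let F := AlgebraicClosure K
  have hdim : ∑ i, d i * d i = 1 := by
    have h1 := φ.toLinearEquiv.finrank_eq
    rw [Module.finrank_baseChange, Module.finrank_self, Module.finrank_pi_fintype] at h1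
    simpa [Module.finrank_matrix] using h1.symm
  have hsum : ∑ i, d i = 1 := by
    have hle : ∑ i, d i ≤ ∑ i, d i * d i := Finset.sum_le_sum fun i _ => Nat.le_mul_self _
    have hne : ∑ i, d i ≠ 0 := by
      intro h0
      rw [Finset.sum_eq_zero_iff] at h0
      rw [Finset.sum_eq_zero fun i hi => by rw [h0 i hi, mul_zero]] at hdim
      exact zero_ne_one hdim
    omega
  ext
  apply (algebraMap K F).injective
  rw [h]
  have h1 : ((1 : F) ⊗ₜ[K] (1 : K)) = 1 := rfl
  rw [h1, map_one]
  simp only [Pi.one_apply, Matrix.trace_one, Fintype.card_fin, LinearMap.id_apply, map_one]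
  rw [← Nat.cast_sum, hsum, Nat.cast_one]

theorem reducedTrace_self (K : Type w) [Field K] : reducedTrace K K = LinearMap.id := by
  have h : ∃ t : K →ₗ[K] K, IsReducedTrace K K t := ⟨_, isReducedTrace_self K⟩
  rw [reducedTrace, dif_pos h]
  exact h.choose_spec.self_eq

variable {K : Type w} [Field K] [NumberField K] {A : Type u} [Ring A] [Algebra K A] [Algebra ℚ A]

theorem trReal_self_trRealAlg (x : RealAlg A) : trReal K K (trRealAlg K A x) = trReal K A x := by
  rw [trReal, trReal, reducedTrace_self]
  induction x using TensorProduct.induction_on with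
  | zero => simp
  | tmul r a => simp [trRealAlg]
  | add x y hx hy => rw [map_add, map_add, map_add, hx, hy]

variable (K A) in
/-- The structure map `K_ℝ → A_ℝ`. -/
def scalarHom : RealAlg K →ₐ[ℝ] RealAlg A :=
  Algebra.TensorProduct.map (AlgHom.id ℝ ℝ) ((Algebra.ofId K A).restrictScalars ℚ)

theorem scalarHom_commute (k : RealAlg K) (x : RealAlg A) :
    scalarHom K A k * x = x * scalarHom K A k := by
  induction k using TensorProduct.induction_on with
  | zero => simp
  | add a b ha hb => rw [map_add, add_mul, mul_add, ha, hb]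
  | tmul r c =>
    induction x using TensorProduct.induction_on with
    | zero => simp
    | add a b ha hb => rw [mul_add, add_mul, ha, hb]
    | tmul s a =>
      simp [scalarHom, Algebra.ofId_apply, mul_comm r s, Algebra.commutes c a]

theorem trRealAlg_scalar_mul (k : RealAlg K) (x : RealAlg A) :
    trRealAlg K A (scalarHom K A k * x) = k * trRealAlg K A x := by
  induction k using TensorProduct.induction_on with
  | zero => simp
  | add a b ha hb => rw [map_add, add_mul, map_add, ha, hb, add_mul]
  | tmul r c =>
    induction x using TensorProduct.induction_on with
    | zero => simp
    | add a b ha hb => rw [mul_add, map_add, ha, hb, map_add, mul_add]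
    | tmul s a =>
      simp [scalarHom, Algebra.ofId_apply, trRealAlg, ← Algebra.smul_def]

theorem trReal_self_eq (x : RealAlg K) : trReal K K x = Algebra.trace ℝ (RealAlg K) x := by
  rw [trReal, reducedTrace_self]
  induction x using TensorProduct.induction_on with
  | zero => simp
  | add a b ha hb => rw [map_add, map_add, ha, hb]
  | tmul r c =>
    have : r ⊗ₜ[ℚ] c = r • ((1 : ℝ) ⊗ₜ[ℚ] c) := by simp [TensorProduct.smul_tmul']
    rw [this, map_smul, map_smul]
    congr 1
    have h2 : Algebra.lmul ℝ (RealAlg K) ((1 : ℝ) ⊗ₜ[ℚ] c) =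
        (Algebra.lmul ℚ K c).baseChange ℝ := by
      ext; simp
    rw [Algebra.trace_apply]
    change _ = LinearMap.trace ℝ (RealAlg K) (Algebra.lmul ℝ (RealAlg K) ((1 : ℝ) ⊗ₜ[ℚ] c))
    rw [h2, LinearMap.trace_baseChange]
    simp [Algebra.trace_apply, Algebra.smul_def]

theorem trReal_conj (x : RealAlg K) : trReal K K (conjReal K x) = trReal K K x := by
  rw [trReal_self_eq, trReal_self_eq]
  exact Algebra.trace_eq_of_algEquiv (conjAlgEquiv K) x

theorem conj_conj (x : RealAlg K) : conjReal K (conjReal K x) = x := by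
  have h : ∀ y, mixedConj K (mixedConj K y) = y := fun y => star_star y
  simp [conjReal, conjAlgEquiv, h]

theorem trReal_nondeg (y : RealAlg K) (h : ∀ c : K, trReal K K (toReal c * y) = 0) : y = 0 := by
  let b := Module.finBasis ℚ K
  let B := (b.baseChange ℝ)
  let b' := (Algebra.traceForm ℚ K).dualBasis (traceForm_nondegenerate ℚ K) b
  have key : ∀ i, B.repr y i = trReal K K (toReal (b' i) * y) := by
    intro i
    have hlin : B.coord i = (trReal K K) ∘ₗ (LinearMap.mulLeft ℝ (toReal (b' i))) := by
      apply B.ext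
      intro j
      have h1 : Algebra.trace ℚ K (b' i * b j) = if j = i then 1 else 0 :=
        LinearMap.BilinForm.apply_dualBasis_left (B := Algebra.traceForm ℚ K)
          (traceForm_nondegenerate ℚ K) b i j
      simp only [B, Module.Basis.coord_apply, LinearMap.comp_apply,
        LinearMap.mulLeft_apply, Module.Basis.baseChange_apply,
        Algebra.TensorProduct.tmul_mul_tmul, trReal, reducedTrace_self]
      simp [h1, Finsupp.single_apply]
    exact LinearMap.congr_fun hlin y
  apply B.repr.injective
  ext i
  rw [key, h, map_zero, Finsupp.zero_apply]

theorem IsPositiveInvolution.eq_zero {σ : RealAlg A →ₗ[ℝ] RealAlg A}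
    (hσ : IsPositiveInvolution K σ) {x : RealAlg A} (h : x * σ x = 0) : x = 0 := by
  by_contra hx
  have := hσ.pos x hx
  rw [h, map_zero] at this
  exact lt_irrefl _ this

theorem involution_idem {σ : RealAlg A →ₗ[ℝ] RealAlg A} (hσ : IsPositiveInvolution K σ)
    {p : RealAlg K} (hp : p * p = p) : σ (scalarHom K A p) = scalarHom K A p := by
  set a := scalarHom K A p with ha
  have haa : a * a = a := by rw [ha, ← map_mul, hp]
  have hbb : σ a * σ a = σ a := by rw [← hσ.map_mul, haa]
  have hab : a * σ a = σ a * a := scalarHom_commute p _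
  have h3 : σ (a * σ a) = a * σ a := by rw [hσ.map_mul, hσ.invol]
  have hz : (a - a * σ a) * σ (a - a * σ a) = 0 := by
    rw [map_sub, h3, sub_mul, mul_sub, mul_sub]
    have e1 : a * (a * σ a) = a * σ a := by rw [← mul_assoc, haa]
    have e2 : a * σ a * σ a = a * σ a := by rw [mul_assoc, hbb]
    have e3 : a * σ a * (a * σ a) = a * σ a := by rw [← mul_assoc, mul_assoc a, ← hab, e1, e2]
    rw [e1, e2, e3]
    simp
  have h1 : a = a * σ a := sub_eq_zero.mp (hσ.eq_zero hz)
  calc σ a = σ (a * σ a) := by rw [← h1]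
    _ = a := by rw [h3, ← h1]

theorem involution_imag {σ : RealAlg A →ₗ[ℝ] RealAlg A} (hσ : IsPositiveInvolution K σ)
    {p q : RealAlg K} (hp : p * p = p) (hpq : p * q = q) (hq : q * q = -p) :
    σ (scalarHom K A q) = -scalarHom K A q := by
  have he := involution_idem hσ hp
  set e := scalarHom K A p with hedef
  set a := scalarHom K A q with ha
  have hee : e * e = e := by rw [hedef, ← map_mul, hp]
  have haa : a * a = -e := by rw [ha, ← map_mul, hq, map_neg]
  have hbb : σ a * σ a = -e := by rw [← hσ.map_mul, haa, map_neg, he]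
  have hab : a * σ a = σ a * a := scalarHom_commute q _
  have hd : σ (a + σ a) = a + σ a := by rw [map_add, hσ.invol, add_comm]
  have e1 : a * σ a * (a * σ a) = e := by
    rw [← mul_assoc, mul_assoc a, ← hab, ← mul_assoc, haa, mul_assoc, hbb, neg_mul_neg, hee]
  have hdd : (a + σ a) * (a + σ a) = (a * σ a + a * σ a) - (e + e) := by
    rw [add_mul, mul_add, mul_add, haa, hbb, ← hab]; abel
  have hyy : ((a + σ a) * a) * σ ((a + σ a) * a) = -((a + σ a) * (a + σ a)) := by
    have h1 : (a + σ a) * a = a * σ a - e := by rw [add_mul, haa, ← hab]; abel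
    have h2 : σ (a * σ a - e) = a * σ a - e := by
      rw [map_sub, hσ.map_mul, hσ.invol, he]
    have e2 : e * (a * σ a) = a * σ a := by rw [← mul_assoc, hedef, ha, ← map_mul, hpq]
    have e3 : a * σ a * e = a * σ a := (scalarHom_commute p _).symm.trans e2
    rw [h1, h2, hdd, sub_mul, mul_sub, mul_sub, e1, e2, e3, hee]
    abel
  have hzero : (a + σ a) * (a + σ a) = 0 := by
    by_contra hne
    have hd0 : a + σ a ≠ 0 := fun h => hne (by rw [h, zero_mul])
    have hy0 : (a + σ a) * a ≠ 0 := fun h => hne (by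
      rw [h, zero_mul] at hyy
      rw [← neg_eq_zero, ← hyy])
    have p1 := hσ.pos _ hd0
    have p2 := hσ.pos _ hy0
    rw [hd] at p1
    rw [hyy, map_neg] at p2
    linarith
  have h0 : a + σ a = 0 := hσ.eq_zero (by rw [hd, hzero])
  rw [eq_neg_iff_add_eq_zero, add_comm, h0]

theorem involution_scalar {σ : RealAlg A →ₗ[ℝ] RealAlg A} (hσ : IsPositiveInvolution K σ)
    (k : RealAlg K) : σ (scalarHom K A k) = scalarHom K A (conjReal K k) := by
  classical
  let S : mixedEmbedding.mixedSpace K →ₐ[ℝ] RealAlg K := (minkowskiEquiv K).symm.toAlgHom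
  have hreal : ∀ z : mixedEmbedding.mixedSpace K, z * z = z →
      σ (scalarHom K A (S z)) = scalarHom K A (S z) := fun z hz =>
    involution_idem hσ (by rw [← map_mul, hz])
  have himag : ∀ y z : mixedEmbedding.mixedSpace K, y * y = y → y * z = z → z * z = -y →
      σ (scalarHom K A (S z)) = -scalarHom K A (S z) := fun y z hy hyz hz =>
    involution_imag hσ (p := S y) (by rw [← map_mul, hy]) (by rw [← map_mul, hyz])
      (by rw [← map_mul, hz, map_neg])
  have key : σ ∘ₗ (scalarHom K A).toLinearMap ∘ₗ S.toLinearMap =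
      (scalarHom K A).toLinearMap ∘ₗ S.toLinearMap ∘ₗ (mixedConj K).toLinearMap := by
    apply LinearMap.prod_ext
    · apply LinearMap.pi_ext'
      intro i
      ext
      have hst : mixedConj K (Pi.single i 1, 0) = (Pi.single i 1, 0) := by
        change star _ = _
        ext j <;> simp
      change σ (scalarHom K A (S (Pi.single i 1, 0))) =
        scalarHom K A (S (mixedConj K (Pi.single i 1, 0)))
      rw [hst]
      apply hreal
      ext j <;> simp [Pi.single_apply]
    · apply LinearMap.pi_ext'
      intro i
      have hidem : ((0, Pi.single i 1) : mixedEmbedding.mixedSpace K) * (0, Pi.single i 1) =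
          (0, Pi.single i 1) := by
        ext j <;> simp [Pi.single_apply]
      apply Complex.basisOneI.ext
      intro j
      fin_cases j
      · have hst : mixedConj K (0, Pi.single i 1) = (0, Pi.single i 1) := by
          change star _ = _
          ext j
          · simp
          · by_cases h : j = i <;> simp [h]
        simp only [Fin.zero_eta, Complex.coe_basisOneI, Matrix.cons_val_zero]
        change σ (scalarHom K A (S (0, Pi.single i 1))) =
          scalarHom K A (S (mixedConj K (0, Pi.single i 1)))
        rw [hst]
        exact hreal _ hidem
      · have hst : mixedConj K (0, Pi.single i Complex.I) = -(0, Pi.single i Complex.I) := by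
          change star _ = _
          ext j
          · simp
          · by_cases h : j = i <;> simp [h]
        simp only [Fin.mk_one, Complex.coe_basisOneI, Matrix.cons_val_one]
        change σ (scalarHom K A (S (0, Pi.single i Complex.I))) =
          scalarHom K A (S (mixedConj K (0, Pi.single i Complex.I)))
        rw [hst, map_neg, map_neg]
        refine himag (0, Pi.single i 1) _ hidem ?_ ?_
        · ext j
          · simp
          · by_cases h : j = i <;> simp [h]
        · ext j
          · simp
          · by_cases h : j = i <;> simp [h]
  have h := LinearMap.congr_fun key (minkowskiEquiv K k)
  have hk : S (minkowskiEquiv K k) = k := (minkowskiEquiv K).symm_apply_apply k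
  change σ (scalarHom K A (S (minkowskiEquiv K k))) =
    scalarHom K A (S (mixedConj K (minkowskiEquiv K k))) at h
  rw [hk] at h
  exact h

theorem trRealAlg_involution {σ : RealAlg A →ₗ[ℝ] RealAlg A} (hσ : IsPositiveInvolution K σ)
    (x : RealAlg A) : trRealAlg K A (σ x) = conjReal K (trRealAlg K A x) := by
  have h1 : σ 1 = 1 := by
    have := hσ.map_mul 1 (σ 1)
    rwa [one_mul, hσ.invol, one_mul, eq_comm] at this
  have htr : ∀ x, trReal K A (σ x) = trReal K A x := fun x => by
    have := hσ.symm 1 x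
    rwa [one_mul, h1, mul_one] at this
  have hc : ∀ k l : RealAlg K, conjReal K (k * l) = conjReal K k * conjReal K l :=
    fun k l => map_mul (conjAlgEquiv K) k l
  rw [← sub_eq_zero]
  apply trReal_nondeg
  intro c
  have hs : toReal c = conjReal K (conjReal K (toReal c)) := (conj_conj _).symm
  rw [mul_sub, map_sub, sub_eq_zero]
  calc trReal K K (toReal c * trRealAlg K A (σ x))
      = trReal K A (scalarHom K A (toReal c) * σ x) := by
        rw [← trRealAlg_scalar_mul, trReal_self_trRealAlg]
    _ = trReal K A (σ (x * scalarHom K A (conjReal K (toReal c)))) := by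
        rw [hσ.map_mul, involution_scalar hσ, ← hs]
    _ = trReal K K (conjReal K (toReal c) * trRealAlg K A x) := by
        rw [htr, ← scalarHom_commute, ← trRealAlg_scalar_mul, trReal_self_trRealAlg]
    _ = trReal K K (toReal c * conjReal K (trRealAlg K A x)) := by
        rw [← trReal_conj, hc, conj_conj]

end Aux

/-! ### Orders and arithmetic vector bundles -/

/-- A subring `O ⊇ R` of `A` (with `R` the ring of integers of `K`) is an `R`-order if it is a full
`R`-lattice in `A`, i.e. finitely generated over `R` with `K O = A`. -/
structure IsOrder {K : Type w} [Field K] {A : Type u} [Ring A] [Algebra K A]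
    (O : Subalgebra (𝓞 K) A) : Prop where
  fg : (Subalgebra.toSubmodule O).FG
  span_eq_top : Submodule.span K (O : Set A) = ⊤

section BaseChange

variable {O : Type v} [Ring O] {B : Type u} [Ring B]

/-- The relations `b o ⊗ x = b ⊗ o x` defining the tensor product `B ⊗_O E` as a quotient of the
left `B`-module `B ⊗_ℤ E`. -/
def balancedRel (ι : O →+* B) (E : Type w) [AddCommGroup E] [Module O E] :
    Submodule B (B ⊗[ℤ] E) :=
  Submodule.span B {t | ∃ (b : B) (o : O) (x : E), t = (b * ι o) ⊗ₜ[ℤ] x - b ⊗ₜ[ℤ] (o • x)}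

/-- The left `B`-module `B ⊗_O E`, for a ring homomorphism `O → B` and a left `O`-module `E`. -/
abbrev BaseChange (ι : O →+* B) (E : Type w) [AddCommGroup E] [Module O E] : Type (max u w) :=
  (B ⊗[ℤ] E) ⧸ balancedRel ι E

end BaseChange

/-- The real vector space `E_ℝ = ℝ ⊗_ℤ E`. If `O` is an order in `A` and `E` is an `O`-module then
`A_ℝ = ℝ ⊗_ℤ O`, hence `A_ℝ ⊗_O E = ℝ ⊗_ℤ E`. -/
abbrev RealSpace (E : Type v) [AddCommGroup E] : Type v := ℝ ⊗[ℤ] E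

/-- The `ℝ`-linear extension `f_ℝ : E_ℝ → E'_ℝ` of an additive map `f : E → E'`. -/
abbrev realMap {E : Type v} {E' : Type w} [AddCommGroup E] [AddCommGroup E'] (f : E →+ E') :
    RealSpace E →ₗ[ℝ] RealSpace E' :=
  f.toIntLinearMap.baseChange ℝ

section Bundles

variable {K : Type w} [Field K] [NumberField K] {A : Type u} [Ring A] [Algebra K A] [Algebra ℚ A]
variable {O : Type x} [Ring O] [Algebra (𝓞 K) O]

/-- An arithmetic vector bundle `(E, h)` on `Spec O`, where `O` is an `R`-order in `A` embedded by
`ι`, and `σ` is the involution on `A_ℝ`: a left `O`-module `E`, finitely generated and torsion free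
over `R`, such that `A ⊗_O E` is a free `A`-module, together with a `σ`-hermitian metric
`h : E_ℝ × E_ℝ → A_ℝ`. As `A_ℝ` is generated by `ℝ` and `O`, the `A_ℝ`-linearity of `h` in the
first argument means that it is linear over `ℝ` and over `O`, where `o` in `O` acts on
`E_ℝ = ℝ ⊗_ℤ E` by `r ⊗ x ↦ r ⊗ o x`. -/
structure ArithBundle (ι : O →ₐ[𝓞 K] A) (σ : RealAlg A →ₗ[ℝ] RealAlg A) where
  carrier : Type v
  [addCommGroup : AddCommGroup carrier]
  [module : Module O carrier]
  [moduleBase : Module (𝓞 K) carrier]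
  [tower : IsScalarTower (𝓞 K) O carrier]
  finite : Module.Finite (𝓞 K) carrier
  torsionFree : ∀ (r : 𝓞 K) (x : carrier), r • x = 0 → r = 0 ∨ x = 0
  free : Module.Free A (BaseChange ι.toRingHom carrier)
  h : RealSpace carrier →ₗ[ℝ] RealSpace carrier →ₗ[ℝ] RealAlg A
  h_smul : ∀ (o : O) (x y : RealSpace carrier),
    h (realMap (DistribSMul.toAddMonoidHom carrier o) x) y = toReal (ι o) * h x y
  h_conj : ∀ x y, h x y = σ (h y x)
  h_pos : ∀ x, x ≠ 0 → 0 < trReal K A (h x x)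

attribute [instance] ArithBundle.addCommGroup ArithBundle.module ArithBundle.moduleBase
  ArithBundle.tower

namespace ArithBundle

variable {ι : O →ₐ[𝓞 K] A} {σ : RealAlg A →ₗ[ℝ] RealAlg A}

/-- The rank of the free `A`-module `A ⊗_O E`. -/
def rank (E : ArithBundle.{u, v, w, x} ι σ) : ℕ := Module.finrank A (BaseChange ι.toRingHom E.carrier)

/-- Two arithmetic vector bundles are isomorphic if there is an isomorphism `φ : E → E'` of
`O`-modules such that `φ_ℝ` is an isometry. -/
def Isomorphic (E E' : ArithBundle.{u, v, w, x} ι σ) : Prop :=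
  ∃ φ : E.carrier ≃ₗ[O] E'.carrier, ∀ x y : RealSpace E.carrier,
    E'.h (realMap (φ : E.carrier →+ E'.carrier) x) (realMap (φ : E.carrier →+ E'.carrier) y) =
      E.h x y

/-- `0 → E' → E → E'' → 0` (with maps `α` and `β`) is a short exact sequence of arithmetic vector
bundles: the sequence of `O`-modules is exact, `α_ℝ` is an isometry onto its image, and `β_ℝ` maps
the orthogonal complement of that image isometrically onto `E''_ℝ`. -/
structure IsShortExact (E' E E'' : ArithBundle.{u, v, w, x} ι σ)
    (α : E'.carrier →ₗ[O] E.carrier) (β : E.carrier →ₗ[O] E''.carrier) : Prop where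
  injective : Function.Injective α
  exact : Function.Exact α β
  surjective : Function.Surjective β
  isometry_left : ∀ x y : RealSpace E'.carrier,
    E.h (realMap (α : E'.carrier →+ E.carrier) x) (realMap (α : E'.carrier →+ E.carrier) y) =
      E'.h x y
  isometry_right : ∀ x y : RealSpace E.carrier,
    (∀ z, E.h x (realMap (α : E'.carrier →+ E.carrier) z) = 0) →
    (∀ z, E.h y (realMap (α : E'.carrier →+ E.carrier) z) = 0) →
    E''.h (realMap (β : E.carrier →+ E''.carrier) x) (realMap (β : E.carrier →+ E''.carrier) y) =
      E.h x y
  onto_right : ∀ t : RealSpace E''.carrier, ∃ x : RealSpace E.carrier,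
    (∀ z, E.h x (realMap (α : E'.carrier →+ E.carrier) z) = 0) ∧
      realMap (β : E.carrier →+ E''.carrier) x = t

theorem Isomorphic.refl (E : ArithBundle.{u, v, w, x} ι σ) : Isomorphic E E := by
  refine ⟨LinearEquiv.refl O _, fun x y => ?_⟩
  have : realMap ((LinearEquiv.refl O E.carrier : E.carrier ≃ₗ[O] E.carrier) :
      E.carrier →+ E.carrier) = LinearMap.id := by
    ext; rfl
  rw [this]; rfl

theorem Isomorphic.trans {E₁ E₂ E₃ : ArithBundle.{u, v, w, x} ι σ} (h₁ : Isomorphic E₁ E₂)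
    (h₂ : Isomorphic E₂ E₃) : Isomorphic E₁ E₃ := by
  obtain ⟨φ, hφ⟩ := h₁
  obtain ⟨ψ, hψ⟩ := h₂
  refine ⟨φ.trans ψ, fun x y => ?_⟩
  have : ∀ x, realMap ((φ.trans ψ : E₁.carrier ≃ₗ[O] E₃.carrier) : E₁.carrier →+ E₃.carrier) x =
      realMap (ψ : E₂.carrier →+ E₃.carrier) (realMap (φ : E₁.carrier →+ E₂.carrier) x) := by
    intro x
    rw [← LinearMap.comp_apply]
    congr 1
    ext; rfl
  rw [this, this, hψ, hφ]

theorem Isomorphic.symm {E₁ E₂ : ArithBundle.{u, v, w, x} ι σ} (h₁ : Isomorphic E₁ E₂) :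
    Isomorphic E₂ E₁ := by
  obtain ⟨φ, hφ⟩ := h₁
  refine ⟨φ.symm, fun x y => ?_⟩
  have : ∀ x, realMap (φ : E₁.carrier →+ E₂.carrier)
      (realMap (φ.symm : E₂.carrier →+ E₁.carrier) x) = x := by
    intro x
    rw [← LinearMap.comp_apply]
    conv_rhs => rw [← LinearMap.id_apply (R := ℝ) x]
    congr 1
    ext z
    simp
  rw [← hφ, this, this]

variable (ι σ)

/-- Isomorphism of arithmetic vector bundles, as an equivalence relation. -/
instance isoSetoid : Setoid (ArithBundle.{u, v, w, x} ι σ) where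
  r := Isomorphic
  iseqv := ⟨Isomorphic.refl, Isomorphic.symm, Isomorphic.trans⟩

/-- The free abelian group over the isomorphism classes of arithmetic vector bundles. -/
abbrev FreeGroup₀ : Type _ := FreeAbelianGroup (Quotient (isoSetoid.{u, v, w, x} ι σ))

variable {ι σ} in
/-- The generator of the free abelian group given by the isomorphism class of `E`. -/
def gen (E : ArithBundle.{u, v, w, x} ι σ) : FreeGroup₀.{u, v, w, x} ι σ :=
  FreeAbelianGroup.of (Quotient.mk _ E)

/-- The subgroup generated by the elements `{E'} + {E''} - {E}` arising from short exact
sequences `0 → E' → E → E'' → 0` of arithmetic vector bundles. -/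
def relations : AddSubgroup (FreeGroup₀.{u, v, w, x} ι σ) :=
  AddSubgroup.closure {t | ∃ (E' E E'' : ArithBundle.{u, v, w, x} ι σ)
    (α : E'.carrier →ₗ[O] E.carrier) (β : E.carrier →ₗ[O] E''.carrier),
    IsShortExact E' E E'' α β ∧ t = gen E' + gen E'' - gen E}

end ArithBundle

/-- The Grothendieck group `K̂_0(O)` of arithmetic vector bundles on `Spec O`. -/
abbrev K0 (ι : O →ₐ[𝓞 K] A) (σ : RealAlg A →ₗ[ℝ] RealAlg A) : Type _ :=
  ArithBundle.FreeGroup₀.{u, v, w, x} ι σ ⧸ ArithBundle.relations.{u, v, w, x} ι σ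

/-- The class `[E]` of an arithmetic vector bundle in `K̂_0(O)`. -/
def ArithBundle.cls {ι : O →ₐ[𝓞 K] A} {σ : RealAlg A →ₗ[ℝ] RealAlg A}
    (E : ArithBundle.{u, v, w, x} ι σ) : K0.{u, v, w, x} ι σ :=
  QuotientAddGroup.mk (ArithBundle.gen E)

end Bundles

/-! ### Push-forward to `Spec R` and the arithmetic degree over `K` -/

section PushForward

variable {K : Type w} [Field K] [NumberField K] {A : Type u} [Ring A] [Algebra K A] [Algebra ℚ A]
variable {O : Type x} [Ring O] [Algebra (𝓞 K) O] {ι : O →ₐ[𝓞 K] A} {σ : RealAlg A →ₗ[ℝ] RealAlg A}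

/-- The arithmetic vector bundles on the commutative arithmetic curve `Spec R`, for the ring of
integers `R` of `K`, the `R`-order `R` in the `K`-algebra `K` and the canonical involution. -/
abbrev BaseBundle (K : Type w) [Field K] [NumberField K] : Type _ :=
  ArithBundle.{w, v, w, w} (Algebra.ofId (𝓞 K) K) (conjReal K)

/-- The Grothendieck group `K̂_0(R)`. -/
abbrev BaseK0 (K : Type w) [Field K] [NumberField K] : Type _ :=
  K0.{w, v, w, w} (Algebra.ofId (𝓞 K) K) (conjReal K)

/-- The push-forward `i_*(E, h) = (E, tr_{A_ℝ|K_ℝ} ∘ h)` along the inclusion `i : R → O`. -/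
def ArithBundle.pushforward (hσ : IsPositiveInvolution K σ) (E : ArithBundle.{u, v, w, x} ι σ) :
    BaseBundle.{v, w} K where
  carrier := E.carrier
  module := E.moduleBase
  finite := E.finite
  torsionFree := E.torsionFree
  free := inferInstance
  h := E.h.compr₂ (trRealAlg K A)
  h_smul := by
    intro r x y
    have h1 : DistribSMul.toAddMonoidHom E.carrier r =
        DistribSMul.toAddMonoidHom E.carrier (algebraMap (𝓞 K) O r) := by
      ext z
      exact (algebraMap_smul O r z).symm
    have h2 : (toReal (algebraMap (𝓞 K) A r) : RealAlg A) =
        scalarHom K A (toReal (algebraMap (𝓞 K) K r)) := by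
      simp [scalarHom]
    rw [LinearMap.compr₂_apply, LinearMap.compr₂_apply, h1, E.h_smul, ι.commutes, h2,
      trRealAlg_scalar_mul]
    rfl
  h_conj := by
    intro x y
    rw [LinearMap.compr₂_apply, LinearMap.compr₂_apply, E.h_conj, trRealAlg_involution hσ]
  h_pos := by
    intro x hx
    rw [LinearMap.compr₂_apply, trReal_self_trRealAlg]
    exact E.h_pos x hx

/-- The arithmetic degree of an arithmetic vector bundle `(E, h)` on `Spec R`: if `x_1, …, x_r` is a
maximal `R`-linearly independent family in `E`, it is the real number
`log #(E / (R x_1 + ⋯ + R x_r)) - 1/2 log |N_{K_ℝ|ℝ}(det (h(x_i, x_j)))|`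
(which does not depend on the family), i.e. the degree of the determinant line bundle computed with
its section `x_1 ∧ ⋯ ∧ x_r`. -/
def baseDegree (E : BaseBundle.{v, w} K) : ℝ :=
  haveI := E.finite
  let x : Fin (Module.finrank (𝓞 K) E.carrier) → E.carrier :=
    (exists_linearIndependent_of_le_finrank (R := 𝓞 K) (M := E.carrier) le_rfl).choose
  Real.log (Nat.card (E.carrier ⧸ Submodule.span (𝓞 K) (Set.range x))) -
    1 / 2 * Real.log |normReal
      (Matrix.of fun i j => E.h ((1 : ℝ) ⊗ₜ[ℤ] x i) ((1 : ℝ) ⊗ₜ[ℤ] x j)).det|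

end PushForward

/-! ### Prime ideals, divisors and complete ideals of an order -/

section Divisors

variable {K : Type w} [Field K] [NumberField K] {A : Type u} [Ring A] [Algebra K A] [Algebra ℚ A]

/-- The prime ideals of the order `O` : the proper two-sided ideals `p` such that `a O b ⊄ p` for
all `a, b ∉ p`, and `K p = A`, i.e. `p` contains a nonzero element of `R`. (If `A` is a simple algebra the
last condition means `p ≠ 0`; in general these are the maximal two-sided ideals of `O`.) -/
structure PrimeIdeal (O : Subalgebra (𝓞 K) A) where
  ideal : TwoSidedIdeal O
  ne_top : ideal ≠ ⊤
  full : ∃ r : 𝓞 K, r ≠ 0 ∧ algebraMap (𝓞 K) O r ∈ ideal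
  prime : ∀ a b : O, a ∉ ideal → b ∉ ideal → ∃ c : O, a * c * b ∉ ideal

/-- The absolute norm `N(p) = #(O / p)`. -/
def PrimeIdeal.absNorm {O : Subalgebra (𝓞 K) A} (p : PrimeIdeal O) : ℕ :=
  Nat.card p.ideal.ringCon.Quotient

open Classical in
/-- The capacity `κ` of `p` : the simple ring `O / p` is isomorphic to the ring of `κ × κ` matrices
over a skew field. -/
def PrimeIdeal.capacity {O : Subalgebra (𝓞 K) A} (p : PrimeIdeal O) : ℕ :=
  if h : ∃ (n : ℕ) (S : Type u) (_ : DivisionRing S),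
    Nonempty (p.ideal.ringCon.Quotient ≃+* Matrix (Fin n) (Fin n) S) then h.choose else 0

section Ord

variable {O : Type x} [Ring O] {M : Type v} [AddCommGroup M] [Module O M]

/-- The annihilator of the `i`-th factor `M_{i+1} / M_i` of a composition series. -/
def factorAnn (s : CompositionSeries (Submodule O M)) (i : Fin s.length) : Set O :=
  {c | ∀ m ∈ s i.succ, c • m ∈ s i.castSucc}

open Classical in
/-- For a left `O`-module `M` of finite length, `ord_p(M)` is the number of factors of a
composition series `0 = M_0 ⊂ ⋯ ⊂ M_l = M` whose annihilator is `p`. -/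
def ordModule (p : TwoSidedIdeal O) (M : Type v) [AddCommGroup M] [Module O M] : ℕ :=
  if h : ∃ s : CompositionSeries (Submodule O M), s.head = ⊥ ∧ s.last = ⊤ then
    Nat.card {i : Fin h.choose.length // factorAnn h.choose i = (p : Set O)} else 0

theorem finite_ordModule_ne_zero (M : Type v) [AddCommGroup M] [Module O M] :
    {p : TwoSidedIdeal O | ordModule p M ≠ 0}.Finite := by
  classical
  by_cases h : ∃ s : CompositionSeries (Submodule O M), s.head = ⊥ ∧ s.last = ⊤
  · refine Set.Finite.of_finite_image (f := fun p : TwoSidedIdeal O => (p : Set O))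
      ((Set.finite_range (factorAnn h.choose)).subset ?_) SetLike.coe_injective.injOn
    rintro _ ⟨p, hp, rfl⟩
    by_contra hne
    apply hp
    rw [ordModule, dif_pos h]
    have : IsEmpty {i : Fin h.choose.length // factorAnn h.choose i = (p : Set O)} :=
      ⟨fun i => hne ⟨i.1, i.2⟩⟩
    exact Nat.card_of_isEmpty
  · convert Set.finite_empty
    ext p
    simp [ordModule, dif_neg h]

end Ord

/-- A full left `O`-ideal in `A` : a left `O`-submodule of `A` that is finitely generated over `R`
and spans `A` over `K`. -/
structure FullIdeal (O : Subalgebra (𝓞 K) A) where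
  ideal : Submodule O A
  fg : (ideal.restrictScalars (𝓞 K)).FG
  span_eq_top : Submodule.span K (ideal : Set A) = ⊤

/-- A complete `O`-ideal `(a, a_∞)` : a full left `O`-ideal `a` and a unit `a_∞` of `A_ℝ`. -/
structure CompleteIdeal (O : Subalgebra (𝓞 K) A) extends FullIdeal O where
  infty : (RealAlg A)ˣ

namespace FullIdeal

variable {O : Subalgebra (𝓞 K) A}

open Classical in
/-- A nonzero `r` in `R` such that `a r ⊆ O`. -/
def scale (a : FullIdeal O) : 𝓞 K :=
  if h : ∃ r : 𝓞 K, r ≠ 0 ∧ ∀ y ∈ a.ideal, y * algebraMap (𝓞 K) A r ∈ O then h.choose else 0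

/-- The left ideal `a r` (intersected with `O`, in which it is contained for the `r` used). -/
def scaled (a : FullIdeal O) (r : 𝓞 K) : Submodule O O where
  carrier := {c | ∃ y ∈ a.ideal, (c : A) = y * algebraMap (𝓞 K) A r}
  add_mem' := by
    rintro c d ⟨y, hy, hc⟩ ⟨z, hz, hd⟩
    exact ⟨y + z, add_mem hy hz, by rw [add_mul, ← hc, ← hd]; rfl⟩
  zero_mem' := ⟨0, zero_mem _, by simp⟩
  smul_mem' := by
    rintro b c ⟨y, hy, hc⟩
    refine ⟨b • y, a.ideal.smul_mem b hy, ?_⟩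
    rw [smul_mul_assoc, ← hc]
    rfl

/-- `ord_p(a) = ord_p(O / a r) - ord_p(O / O r)` for a nonzero `r` in `R` such that `a r ⊆ O`. -/
def ord (a : FullIdeal O) (p : PrimeIdeal O) : ℤ :=
  (ordModule p.ideal (O ⧸ a.scaled a.scale) : ℤ) -
    (ordModule p.ideal (O ⧸ Submodule.span O {algebraMap (𝓞 K) O a.scale}) : ℤ)

theorem finite_support_ord (a : FullIdeal O) :
    (Function.support fun p : PrimeIdeal O => -a.ord p).Finite := by
  have hinj : Function.Injective (fun p : PrimeIdeal O => p.ideal) := by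
    rintro ⟨p, _, _, _⟩ ⟨q, _, _, _⟩ h
    cases h
    rfl
  refine (((finite_ordModule_ne_zero (O ⧸ a.scaled a.scale)).union
    (finite_ordModule_ne_zero (O ⧸ Submodule.span O {algebraMap (𝓞 K) O a.scale}))).preimage
    hinj.injOn).subset ?_
  intro p hp
  by_contra hcon
  simp only [Set.mem_preimage, Set.mem_union, Set.mem_ofPred_eq, not_or, not_not] at hcon
  apply hp
  simp [ord, hcon.1, hcon.2]

end FullIdeal

/-- The divisor group `Div(O)`, free abelian over the prime ideals of `O`. -/
abbrev Divisor (O : Subalgebra (𝓞 K) A) : Type _ := PrimeIdeal O →₀ ℤ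

/-- The divisor `div(a) = (-ord_p(a))_p` of a full left `O`-ideal. -/
def FullIdeal.div {O : Subalgebra (𝓞 K) A} (a : FullIdeal O) : Divisor O :=
  Finsupp.ofSupportFinite (fun p => -a.ord p) a.finite_support_ord

/-- The set underlying the arithmetic divisor group `Div(O) × (A_ℝ)ˣ`. -/
abbrev ArithDivisor (O : Subalgebra (𝓞 K) A) : Type _ := Divisor O × (RealAlg A)ˣ

/-- The arithmetic divisor `(div(a), a_∞)` of a complete `O`-ideal `(a, a_∞)`. -/
def CompleteIdeal.div {O : Subalgebra (𝓞 K) A} (a : CompleteIdeal O) : ArithDivisor O :=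
  (a.toFullIdeal.div, a.infty)

/-- The degree `∑_p (v_p / κ_p) log N(p) - log |N_{A_ℝ|ℝ}(D_∞)|` of an arithmetic divisor
`(∑_p v_p p, D_∞)`. -/
def ArithDivisor.deg {O : Subalgebra (𝓞 K) A} (D : ArithDivisor O) : ℝ :=
  (D.1.sum fun p v => (v : ℝ) / p.capacity * Real.log p.absNorm) -
    Real.log |normReal (D.2 : RealAlg A)|

/-- The order `O`, as a full left `O`-ideal. -/
def unitIdeal {O : Subalgebra (𝓞 K) A} (hO : IsOrder O) : FullIdeal O where
  ideal :=
    { carrier := O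
      add_mem' := O.add_mem
      zero_mem' := O.zero_mem
      smul_mem' := fun c _ hx => O.mul_mem c.2 hx }
  fg := hO.fg
  span_eq_top := hO.span_eq_top

/-- The complete `O`-ideal `(O, 1)`. -/
def unitCompleteIdeal {O : Subalgebra (𝓞 K) A} (hO : IsOrder O) : CompleteIdeal O where
  toFullIdeal := unitIdeal hO
  infty := 1

end Divisors

/-! ### The line bundle of a complete ideal -/

section LineBundle

variable {K : Type w} [Field K] [NumberField K] {A : Type u} [Ring A] [Algebra K A] [Algebra ℚ A]
variable {O : Subalgebra (𝓞 K) A}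

/-- The identification `a_ℝ = A_ℝ ⊗_O a = A_ℝ` for a full left `O`-ideal `a` (as a map). -/
def FullIdeal.realEmb (a : FullIdeal O) : RealSpace a.ideal →ₗ[ℝ] RealAlg A :=
  LinearMap.liftBaseChange ℝ
    ((((Algebra.TensorProduct.includeRight : A →ₐ[ℚ] RealAlg A) : A →+ RealAlg A).comp
      (a.ideal.subtype : a.ideal →+ A)).toIntLinearMap)

theorem FullIdeal.realEmb_tmul (a : FullIdeal O) (r : ℝ) (z : a.ideal) :
    a.realEmb (r ⊗ₜ z) = r ⊗ₜ[ℚ] (z : A) := by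
  simp [FullIdeal.realEmb, TensorProduct.smul_tmul']

theorem FullIdeal.realEmb_injective (a : FullIdeal O) : Function.Injective a.realEmb := by
  let f : a.ideal →ₗ[ℤ] A := (a.ideal.subtype : a.ideal →+ A).toIntLinearMap
  have hf : Function.Injective f := Subtype.val_injective
  have h1 : Function.Injective (f.lTensor ℝ) := Module.Flat.lTensor_preserves_injective_linearMap f hf
  let e := (IsLocalization.moduleTensorEquiv (nonZeroDivisors ℤ) ℚ ℝ A).symm
  have h2 : ∀ t, a.realEmb t = e (f.lTensor ℝ t) := by
    intro t
    induction t using TensorProduct.induction_on with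
    | zero => simp
    | add s t hs ht => rw [map_add, map_add, map_add, hs, ht]
    | tmul r z => rw [FullIdeal.realEmb_tmul]; rfl
  intro s t hst
  rw [h2, h2] at hst
  exact h1 (e.injective hst)

theorem IsOrder.exists_int_smul_mem (hO : IsOrder O) (b : A) :
    ∃ n : ℤ, n ≠ 0 ∧ n • b ∈ O := by
  have hb : b ∈ Submodule.span K (O : Set A) := hO.span_eq_top ▸ Submodule.mem_top
  induction hb using Submodule.span_induction with
  | mem y hy => exact ⟨1, one_ne_zero, by rwa [one_smul]⟩
  | zero => exact ⟨1, one_ne_zero, by rw [smul_zero]; exact O.zero_mem⟩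
  | add y z _ _ hy hz =>
    obtain ⟨n, hn, hy⟩ := hy
    obtain ⟨m, hm, hz⟩ := hz
    refine ⟨n * m, mul_ne_zero hn hm, ?_⟩
    rw [smul_add]
    refine O.add_mem ?_ ?_
    · rw [mul_comm, mul_smul]; exact O.zsmul_mem hy m
    · rw [mul_smul]; exact O.zsmul_mem hz n
  | smul k y _ hy =>
    obtain ⟨n, hn, hy⟩ := hy
    obtain ⟨⟨c, m⟩, hk⟩ := IsLocalization.surj (Algebra.algebraMapSubmonoid (𝓞 K) (nonZeroDivisors ℤ)) k
    obtain ⟨m', hm', hmm⟩ := m.2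
    refine ⟨m' * n, mul_ne_zero (nonZeroDivisors.ne_zero hm') hn, ?_⟩
    have h1 : (m' : ℤ) • k = algebraMap (𝓞 K) K c := by
      rw [← hk]
      simp [← hmm, mul_comm]
    have h2 : (m' * n) • k • y = c • (n • y) := by
      rw [mul_comm, mul_smul, ← smul_assoc m', h1, algebraMap_smul, smul_comm]
    rw [h2]
    exact O.smul_mem hy c

/-- The multiplication map `A ⊗_O a → A`. -/
def FullIdeal.mulMap (a : FullIdeal O) : BaseChange O.val.toRingHom a.ideal →ₗ[A] A :=
  Submodule.liftQ _ (TensorProduct.AlgebraTensorModule.lift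
    ((LinearMap.toSpanSingleton A (a.ideal →ₗ[ℤ] A)
      (a.ideal.subtype : a.ideal →+ A).toIntLinearMap))) (by
    rw [balancedRel, Submodule.span_le]
    rintro _ ⟨b, c, z, rfl⟩
    simp only [SetLike.mem_coe, LinearMap.mem_ker, map_sub,
      TensorProduct.AlgebraTensorModule.lift_apply, TensorProduct.lift.tmul]
    change (b * (c : A)) * (z : A) - b * ((c • z : a.ideal) : A) = 0
    rw [Submodule.coe_smul, Subalgebra.smul_def, smul_eq_mul, mul_assoc, sub_self])

theorem FullIdeal.mulMap_mk_tmul (a : FullIdeal O) (b : A) (z : a.ideal) :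
    a.mulMap (Submodule.Quotient.mk (b ⊗ₜ[ℤ] z)) = b * (z : A) := rfl

theorem FullIdeal.free_baseChange (hO : IsOrder O) (a : FullIdeal O) :
    Module.Free A (BaseChange O.val.toRingHom a.ideal) := by
  let T := BaseChange O.val.toRingHom a.ideal
  have hunit : ∀ n : ℤ, n ≠ 0 → ∃ q : A, q * (n : A) = 1 := fun n hn =>
    ⟨algebraMap ℚ A (n : ℚ)⁻¹, by
      rw [← map_intCast (algebraMap ℚ A) n, ← map_mul, inv_mul_cancel₀ (Int.cast_ne_zero.mpr hn),
        map_one]⟩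
  have hcancel : ∀ (t : T) (n : ℤ), n ≠ 0 → n • t = 0 → t = 0 := by
    intro t n hn h
    obtain ⟨q, hq⟩ := hunit n hn
    rw [← one_smul A t, ← hq, mul_smul, Int.cast_smul_eq_zsmul, h, smul_zero]
  have hform : ∀ t : T, ∃ n : ℤ, n ≠ 0 ∧ ∃ z : a.ideal,
      n • t = Submodule.Quotient.mk ((1 : A) ⊗ₜ[ℤ] z) := by
    intro t
    obtain ⟨t, rfl⟩ := Submodule.Quotient.mk_surjective _ t
    induction t using TensorProduct.induction_on with
    | zero => exact ⟨1, one_ne_zero, 0, by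
        rw [TensorProduct.tmul_zero, Submodule.Quotient.mk_zero, smul_zero]⟩
    | tmul b z =>
      obtain ⟨n, hn, hb⟩ := hO.exists_int_smul_mem b
      refine ⟨n, hn, (⟨n • b, hb⟩ : O) • z, ?_⟩
      rw [← Submodule.Quotient.mk_smul, TensorProduct.smul_tmul', Submodule.Quotient.eq]
      apply Submodule.subset_span
      refine ⟨1, ⟨n • b, hb⟩, z, ?_⟩
      rw [one_mul]; rfl
    | add s t hs ht =>
      obtain ⟨n, hn, y, hs⟩ := hs
      obtain ⟨m, hm, z, ht⟩ := ht
      refine ⟨n * m, mul_ne_zero hn hm, m • y + n • z, ?_⟩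
      rw [Submodule.Quotient.mk_add, smul_add, mul_smul, mul_smul, smul_comm n m, hs, ht,
        TensorProduct.tmul_add, TensorProduct.tmul_smul, TensorProduct.tmul_smul,
        Submodule.Quotient.mk_add, Submodule.Quotient.mk_smul, Submodule.Quotient.mk_smul]
  have hinj : Function.Injective a.mulMap := by
    rw [injective_iff_map_eq_zero]
    intro t ht
    obtain ⟨n, hn, z, hz⟩ := hform t
    apply hcancel t n hn
    have h0 : a.mulMap (n • t) = (z : A) := by rw [hz, FullIdeal.mulMap_mk_tmul, one_mul]
    rw [map_zsmul, ht, smul_zero] at h0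
    have : z = 0 := Subtype.ext h0.symm
    rw [hz, this, TensorProduct.tmul_zero, Submodule.Quotient.mk_zero]
  have hsurj : Function.Surjective a.mulMap := by
    have h1 : (1 : A) ∈ LinearMap.range a.mulMap := by
      have hb : (1 : A) ∈ Submodule.span K (a.ideal : Set A) := a.span_eq_top ▸ Submodule.mem_top
      generalize (1 : A) = b at hb
      induction hb using Submodule.span_induction with
      | mem y hy =>
        exact ⟨Submodule.Quotient.mk ((1 : A) ⊗ₜ[ℤ] (⟨y, hy⟩ : a.ideal)), by
          rw [FullIdeal.mulMap_mk_tmul, one_mul]⟩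
      | zero => exact zero_mem _
      | add y z _ _ hy hz => exact add_mem hy hz
      | smul k y _ hy =>
        rw [Algebra.smul_def]
        exact (LinearMap.range a.mulMap).smul_mem (algebraMap K A k) hy
    intro b
    obtain ⟨t, ht⟩ := h1
    exact ⟨b • t, by rw [map_smul, ht, smul_eq_mul, mul_one]⟩
  exact Module.Free.of_equiv (LinearEquiv.ofBijective a.mulMap ⟨hinj, hsurj⟩).symm

theorem FullIdeal.torsionFree (a : FullIdeal O) (r : 𝓞 K) (z : a.ideal) (h : r • z = 0) :
    r = 0 ∨ z = 0 := by
  by_cases hr : r = 0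
  · exact Or.inl hr
  · right
    have h1 : (r : K) • (z : A) = 0 := by
      have := congrArg (Subtype.val) h
      rwa [Submodule.coe_smul_of_tower, ← algebraMap_smul K r (z : A)] at this
    have hr' : (r : K) ≠ 0 := fun h0 => hr (RingOfIntegers.ext h0)
    have h2 := congrArg (fun y : A => (r : K)⁻¹ • y) h1
    simp only [smul_smul, inv_mul_cancel₀ hr', one_smul, smul_zero] at h2
    exact Subtype.ext h2

theorem FullIdeal.finite_int (a : FullIdeal O) : Module.Finite ℤ a.ideal :=
  haveI : Module.Finite (𝓞 K) a.ideal := Module.Finite.iff_fg.mpr a.fg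
  Module.Finite.trans (𝓞 K) a.ideal

theorem FullIdeal.free_int (a : FullIdeal O) : Module.Free ℤ a.ideal := by
  have := a.finite_int
  have : Module.IsTorsionFree ℤ a.ideal := by
    refine .of_smul_eq_zero fun n z h => ?_
    have h1 : (n : 𝓞 K) • z = 0 := (Int.cast_smul_eq_zsmul (𝓞 K) n z).trans h
    exact (a.torsionFree _ z h1).imp_left fun h2 => by exact_mod_cast h2
  infer_instance

/-- The arithmetic line bundle `L(a, a_∞) = (a, h)` of a complete `O`-ideal `(a, a_∞)`, where
`h(x, y) = x a_∞ (a_∞)^* y^*` for `x, y` in `a_ℝ = A_ℝ`. -/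
def lineBundle {σ : RealAlg A →ₗ[ℝ] RealAlg A} (hO : IsOrder O) (hσ : IsPositiveInvolution K σ)
    (a : CompleteIdeal O) : ArithBundle.{u, u, w, u} O.val σ where
  carrier := a.ideal
  moduleBase := a.ideal.module'
  tower := ⟨fun r c z => by ext; simp⟩
  finite := Module.Finite.iff_fg.mpr a.fg
  torsionFree := a.torsionFree
  free := a.free_baseChange hO
  h := LinearMap.mk₂ ℝ
    (fun x y => a.realEmb x * (a.infty * σ a.infty) * σ (a.realEmb y))
    (by intro x y z; simp [add_mul]) (by intro c x y; simp)
    (by intro x y z; simp [mul_add]) (by intro c x y; simp)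
  h_smul := by
    intro c x y
    have h1 : a.realEmb (realMap (DistribSMul.toAddMonoidHom a.ideal c) x) =
        toReal (c : A) * a.realEmb x := by
      induction x using TensorProduct.induction_on with
      | zero => simp
      | add s t hs ht => rw [map_add, map_add, map_add, mul_add, hs, ht]
      | tmul r z =>
        change a.realEmb (r ⊗ₜ (c • z)) = _
        rw [FullIdeal.realEmb_tmul, FullIdeal.realEmb_tmul, Algebra.TensorProduct.tmul_mul_tmul,
          one_mul]
        rfl
    simp only [LinearMap.mk₂_apply]
    rw [h1]
    simp only [mul_assoc]
    rfl
  h_conj := by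
    intro x y
    simp only [LinearMap.mk₂_apply]
    rw [hσ.map_mul, hσ.map_mul, hσ.map_mul, hσ.invol, hσ.invol, mul_assoc]
  h_pos := by
    intro x hx
    simp only [LinearMap.mk₂_apply]
    have h1 : a.realEmb x * (a.infty * σ a.infty) * σ (a.realEmb x) =
        (a.realEmb x * a.infty) * σ (a.realEmb x * a.infty) := by
      rw [hσ.map_mul]; simp only [mul_assoc]
    rw [h1]
    apply hσ.pos
    intro h
    rw [Units.mul_left_eq_zero] at h
    exact hx (a.realEmb_injective (by rw [h, map_zero]))

end LineBundle

/-! ### The canonical measure and the Euler-Minkowski characteristic -/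

section EulerMinkowski

variable (K : Type w) [Field K] [NumberField K] {A : Type u} [Ring A] [Algebra K A] [Algebra ℚ A]
  [FiniteDimensional K A]

/-- The canonical volume of a subset of `A_ℝ` : the Haar measure provided by the nondegenerate
symmetric bilinear form `(x, y) ↦ tr_{A_ℝ|ℝ}(x y)`, for which the parallelepiped spanned by a basis
`v` has volume `|det (tr(v_i v_j))|^{1/2}`. It is Lebesgue measure in the coordinates of any basis
`v`, multiplied by this number. -/
def canonicalVolume (X : Set (RealAlg A)) : ENNReal :=
  haveI : Module.Finite ℚ A := Module.Finite.trans K A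
  let v := Module.finBasis ℝ (RealAlg A)
  ENNReal.ofReal (√|(Matrix.of fun i j => trReal K A (v i * v j)).det|) *
    MeasureTheory.volume (v.equivFun '' X)

variable {K}

/-- A fundamental domain of the lattice `a_∞ j(a)` in `A_ℝ` : the half-open parallelepiped spanned by
the image of a `ℤ`-basis of `a`. -/
def CompleteIdeal.fundamentalDomain {O : Subalgebra (𝓞 K) A} (a : CompleteIdeal O) :
    Set (RealAlg A) :=
  haveI := a.finite_int
  haveI := a.free_int
  let b := Module.Free.chooseBasis ℤ a.ideal
  {y | ∃ t : Module.Free.ChooseBasisIndex ℤ a.ideal → ℝ,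
    (∀ i, t i ∈ Set.Ico (0 : ℝ) 1) ∧ y = ∑ i, t i • ((a.infty : RealAlg A) * toReal (b i : A))}

/-- The Euler-Minkowski characteristic `χ(a, a_∞) = -log vol(a_∞ j(a))`. -/
def CompleteIdeal.eulerChar {O : Subalgebra (𝓞 K) A} (a : CompleteIdeal O) : ℝ :=
  -Real.log (canonicalVolume K a.fundamentalDomain).toReal

end EulerMinkowski

end NCArith

end

/-! Everything is read off from one invariant of a bundle, the Gram determinant `covol` of a ℤ-basis
of E for the real form tr ∘ h on E_ℝ.

If x_1, …, x_n is a maximal independent family in E and ω_k an integral basis of K, then the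
products ω_k x_i form a ℤ-basis of a sublattice of finite index. Their Gram determinant is, up to
sign, d_K^n N(det h(x_i, x_j)), and it is also the square of the index times `covol`. Taking
logarithms (`baseDegree_eq`), the degree over K becomes -1/2 log `covol` plus (rank_ℤ E / 2[K:ℚ])
log |d_K|. The family has disappeared. The degree is additive because the rank is, and because
`covol` is multiplicative in orthogonally split sequences (`latDet_exact`). The rank over A is
rank_ℤ E / rank_ℤ O (`rank_mul`), hence additive. Push-forward preserves short exact sequences
because orthogonality for the trace of h already implies orthogonality for h: the image of E' is
O-stable and the trace form is nondegenerate.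

The degree over O is defined by the formula in (ii), so its values on line bundles have to be
computed. The discriminant terms cancel, leaving -1/2 log of the ratio of the `covol` of L(a) to
that of L(O). Right multiplication by a_∞ contributes the square of its norm, and the rest of the
ratio is the square of #(O/ar) / #(O/Or) (`norm_sq_mul_gram`). Such cardinalities are turned into
divisors by `log_card_eq_sum`: a composition factor with annihilator p is a simple module over O/p ≅
M_κ(S), so it has #S^κ elements, while N(p) = #S^(κ²); it contributes log N(p) / κ.

Uniqueness holds because every class is a sum of classes of line bundles (`hom_eq_of_full`). Embed E
as a full lattice in A^n and split off one coordinate at a time, giving the quotient the metric of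
the orthogonal complement. For n = 1 the lattice is a full ideal and the metric is x β y^* with β
symmetric and positive. By the spectral theorem β has a square root which is a polynomial in β, so β
= a_∞ a_∞^* (`IsPositiveInvolution.exists_sqrt`).

For (iii), d_ℚ = 1, and the forms tr(xy) and tr(xy^*) have the same Gram determinant up to sign
because an involution has determinant ±1. -/

noncomputable section

namespace NCArith

/-! ### Gram determinants of lattices -/

section Gram

variable {V : Type*} [AddCommGroup V] [Module ℝ V]
variable {ι : Type*} [Fintype ι] [DecidableEq ι] {ι' : Type*} [Fintype ι'] [DecidableEq ι']

/-- The Gram matrix of a family of vectors with respect to a bilinear form. -/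
def gram (B : V →ₗ[ℝ] V →ₗ[ℝ] ℝ) (v : ι → V) : Matrix ι ι ℝ := Matrix.of fun i j => B (v i) (v j)

theorem det_gram_reindex (B : V →ₗ[ℝ] V →ₗ[ℝ] ℝ) (v : ι → V) (e : ι' ≃ ι) :
    (gram B (v ∘ e)).det = (gram B v).det :=
  Matrix.det_submatrix_equiv_self e (gram B v)

theorem det_gram_of_comb (B : V →ₗ[ℝ] V →ₗ[ℝ] ℝ) (v w : ι → V) (P : Matrix ι ι ℝ)
    (h : ∀ i, w i = ∑ j, P i j • v j) : (gram B w).det = P.det ^ 2 * (gram B v).det := by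
  have : gram B w = P * gram B v * P.transpose := by
    ext i j
    simp only [gram, Matrix.of_apply, h, map_sum, map_smul, LinearMap.sum_apply,
      LinearMap.smul_apply, smul_eq_mul, Matrix.mul_apply, Matrix.transpose_apply, Finset.sum_mul,
      Finset.mul_sum]
    exact Finset.sum_congr rfl fun a _ => Finset.sum_congr rfl fun b _ => by ring
  rw [this, Matrix.det_mul, Matrix.det_mul, Matrix.det_transpose]
  ring

theorem det_gram_linearMap (B : V →ₗ[ℝ] V →ₗ[ℝ] ℝ)
    (b : Module.Basis ι ℝ V) (f : V →ₗ[ℝ] V) :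
    (gram B (fun i => f (b i))).det = LinearMap.det f ^ 2 * (gram B b).det := by
  rw [det_gram_of_comb B b (fun i => f (b i)) (LinearMap.toMatrix b b f).transpose,
    Matrix.det_transpose, LinearMap.det_toMatrix]
  intro i
  simp only [Matrix.transpose_apply, LinearMap.toMatrix_apply]
  exact (b.sum_repr (f (b i))).symm

/-- A kernel vector c of the Gram matrix gives x = Σ c_j v_j with B(v_i, x) = 0 for all i, hence
B(x, x) = 0. Symmetry of B is not needed. -/
theorem det_gram_ne_zero (B : V →ₗ[ℝ] V →ₗ[ℝ] ℝ) (hB : ∀ x, x ≠ 0 → 0 < B x x) (v : ι → V)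
    (hv : LinearIndependent ℝ v) : (gram B v).det ≠ 0 := by
  intro h0
  obtain ⟨c, hc, hc0⟩ := Matrix.exists_mulVec_eq_zero_iff.mpr h0
  set x := ∑ j, c j • v j with hx
  have hx0 : x ≠ 0 := by
    intro hx0
    exact hc (funext (Fintype.linearIndependent_iff.mp hv c hx0))
  have h1 : ∀ i, B (v i) x = 0 := by
    intro i
    have := congrFun hc0 i
    simp only [Matrix.mulVec, dotProduct, gram, Matrix.of_apply, Pi.zero_apply] at this
    rw [hx, map_sum, ← this]
    exact Finset.sum_congr rfl fun j _ => by rw [map_smul, smul_eq_mul, mul_comm]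
  have h2 : ∀ y, (∀ i, B (v i) y = 0) → B x y = 0 := fun y hy => by
    rw [hx, map_sum, LinearMap.sum_apply]
    exact Finset.sum_eq_zero fun i _ => by rw [map_smul, LinearMap.smul_apply, hy, smul_zero]
  exact (hB x hx0).ne' (h2 x h1)

end Gram

/-! ### Lattice determinants: independence of the basis, sublattices, exact sequences. -/

section Lattice

variable {E : Type*} [AddCommGroup E]
variable {ι : Type*} [Fintype ι] [DecidableEq ι] {ι' : Type*} [Fintype ι'] [DecidableEq ι']

theorem real_tmul_comb (b c : ι → E) (P : Matrix ι ι ℤ) (h : ∀ i, c i = ∑ j, P i j • b j) (i : ι) :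
    ((1 : ℝ) ⊗ₜ[ℤ] c i : RealSpace E) =
      ∑ j, (P.map (Int.castRingHom ℝ)) i j • ((1 : ℝ) ⊗ₜ[ℤ] b j) := by
  rw [h, TensorProduct.tmul_sum]
  refine Finset.sum_congr rfl fun j _ => ?_
  rw [TensorProduct.tmul_smul, Matrix.map_apply, eq_intCast, Int.cast_smul_eq_zsmul]

theorem det_gram_lattice_comb (B : RealSpace E →ₗ[ℝ] RealSpace E →ₗ[ℝ] ℝ) (b c : ι → E)
    (P : Matrix ι ι ℤ) (h : ∀ i, c i = ∑ j, P i j • b j) :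
    (gram B fun i => (1 : ℝ) ⊗ₜ[ℤ] c i).det =
      (P.det : ℝ) ^ 2 * (gram B fun i => (1 : ℝ) ⊗ₜ[ℤ] b i).det := by
  rw [det_gram_of_comb B _ _ _ (real_tmul_comb b c P h), ← RingHom.mapMatrix_apply,
    ← RingHom.map_det, eq_intCast]

theorem basis_comb (b : Module.Basis ι ℤ E) (c : ι → E) (i : ι) :
    c i = ∑ j, (b.toMatrix c).transpose i j • b j :=
  (b.sum_repr (c i)).symm

theorem det_gram_basis_eq (B : RealSpace E →ₗ[ℝ] RealSpace E →ₗ[ℝ] ℝ) (b : Module.Basis ι ℤ E)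
    (c : Module.Basis ι' ℤ E) :
    (gram B fun i => (1 : ℝ) ⊗ₜ[ℤ] c i).det = (gram B fun i => (1 : ℝ) ⊗ₜ[ℤ] b i).det := by
  let e := c.indexEquiv b
  let c' := c.reindex e
  have h1 : (gram B fun i => (1 : ℝ) ⊗ₜ[ℤ] c i).det = (gram B fun i => (1 : ℝ) ⊗ₜ[ℤ] c' i).det := by
    rw [← det_gram_reindex B (fun i => (1 : ℝ) ⊗ₜ[ℤ] c' i) e]
    congr 2
    ext i
    simp [c']
  have hu : IsUnit (b.toMatrix c').det := by
    rw [← Module.Basis.det_apply]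
    exact b.isUnit_det c'
  rw [h1, det_gram_lattice_comb B b c' _ (basis_comb b c'), Matrix.det_transpose]
  rcases Int.isUnit_iff.mp hu with h | h <;> rw [h] <;> norm_num

variable [Module.Free ℤ E] [Module.Finite ℤ E]

/-- The determinant of a lattice `E` for a bilinear form on `E_ℝ`: the Gram determinant of a
`ℤ`-basis. -/
def latDet (B : RealSpace E →ₗ[ℝ] RealSpace E →ₗ[ℝ] ℝ) : ℝ := by
  classical
  exact (gram B fun i => (1 : ℝ) ⊗ₜ[ℤ] Module.Free.chooseBasis ℤ E i).det

theorem latDet_eq (B : RealSpace E →ₗ[ℝ] RealSpace E →ₗ[ℝ] ℝ) (b : Module.Basis ι ℤ E) :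
    latDet B = (gram B fun i => (1 : ℝ) ⊗ₜ[ℤ] b i).det := by
  classical
  exact det_gram_basis_eq B b _

theorem latDet_ne_zero (B : RealSpace E →ₗ[ℝ] RealSpace E →ₗ[ℝ] ℝ)
    (hB : ∀ x, x ≠ 0 → 0 < B x x) : latDet B ≠ 0 := by
  classical
  rw [latDet_eq B (Module.Free.chooseBasis ℤ E)]
  apply det_gram_ne_zero B hB
  have h := ((Module.Free.chooseBasis ℤ E).baseChange ℝ).linearIndependent
  simpa only [← Module.Basis.baseChange_apply] using h

theorem latDet_equiv {E' : Type*} [AddCommGroup E'] [Module.Free ℤ E'] [Module.Finite ℤ E']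
    (B : RealSpace E →ₗ[ℝ] RealSpace E →ₗ[ℝ] ℝ) (B' : RealSpace E' →ₗ[ℝ] RealSpace E' →ₗ[ℝ] ℝ)
    (e : E ≃+ E')
    (h : ∀ x y, B' (realMap (e : E →+ E') x) (realMap (e : E →+ E') y) = B x y) :
    latDet B' = latDet B := by
  classical
  rw [latDet_eq B (Module.Free.chooseBasis ℤ E),
    latDet_eq B' ((Module.Free.chooseBasis ℤ E).map e.toIntLinearEquiv)]
  congr 1
  ext i j
  exact h ((1 : ℝ) ⊗ₜ _) ((1 : ℝ) ⊗ₜ _)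

/-- The index of a sublattice is the absolute value of the determinant of the transition matrix, and
a Gram determinant changes by the square of that determinant. -/
theorem det_gram_sublattice (B : RealSpace E →ₗ[ℝ] RealSpace E →ₗ[ℝ] ℝ) (N : AddSubgroup E)
    (c : Module.Basis ι ℤ N) (hcard : Module.finrank ℤ E = Module.finrank ℤ N) :
    (gram B fun i => (1 : ℝ) ⊗ₜ[ℤ] (c i : E)).det = (Nat.card (E ⧸ N) : ℝ) ^ 2 * latDet B := by
  classical
  have hc : Fintype.card (Module.Free.ChooseBasisIndex ℤ E) = Fintype.card ι := by
    rw [← Module.finrank_eq_card_chooseBasisIndex, hcard, Module.finrank_eq_card_basis c]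
  let b := (Module.Free.chooseBasis ℤ E).reindex (Fintype.equivOfCardEq hc)
  rw [det_gram_lattice_comb B b (fun i => (c i : E)) _ (basis_comb b _), ← latDet_eq B b]
  have h := AddSubgroup.index_eq_natAbs_det b N c
  rw [Module.Basis.det_apply] at h
  change Nat.card (E ⧸ N) = _ at h
  rw [h, Matrix.det_transpose, Nat.cast_natAbs, Int.cast_abs, sq_abs]

/-- Gram determinants do not change when the lifts of a basis of E'' are corrected by vectors of
E'_ℝ. Replacing the integral lifts by orthogonal ones makes the Gram matrix block diagonal. -/
theorem latDet_exact {E' E'' : Type*} [AddCommGroup E'] [Module.Free ℤ E'] [Module.Finite ℤ E']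
    [AddCommGroup E''] [Module.Free ℤ E''] [Module.Finite ℤ E'']
    (B' : RealSpace E' →ₗ[ℝ] RealSpace E' →ₗ[ℝ] ℝ)
    (B : RealSpace E →ₗ[ℝ] RealSpace E →ₗ[ℝ] ℝ)
    (B'' : RealSpace E'' →ₗ[ℝ] RealSpace E'' →ₗ[ℝ] ℝ) (hB : ∀ x y, B x y = B y x)
    (α : E' →+ E) (β : E →+ E'') (hα : Function.Injective α) (hβ : Function.Surjective β)
    (hex : Function.Exact α β) (hl : ∀ x y, B (realMap α x) (realMap α y) = B' x y)
    (hr : ∀ x y, (∀ z, B x (realMap α z) = 0) → (∀ z, B y (realMap α z) = 0) →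
      B'' (realMap β x) (realMap β y) = B x y)
    (honto : ∀ t, ∃ x, (∀ z, B x (realMap α z) = 0) ∧ realMap β x = t) :
    latDet B = latDet B' * latDet B'' := by
  classical
  let b' := Module.Free.chooseBasis ℤ E'
  let b'' := Module.Free.chooseBasis ℤ E''
  -- E'' is free over ℤ, so the sequence splits as a sequence of abelian groups; this yields a
  -- ℤ-basis `c` of E extending that of E'.
  obtain ⟨s, hs⟩ := Module.projective_lifting_property β.toIntLinearMap LinearMap.id hβ
  obtain ⟨e, he1, he2⟩ := Function.Exact.splitSurjectiveEquiv
    (f := α.toIntLinearMap) (g := β.toIntLinearMap) hex hα ⟨s, hs⟩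
  let c := (b'.prod b'').map e.symm
  have hc1 : ∀ i, c (Sum.inl i) = α (b' i) := by
    intro i
    have := LinearMap.congr_fun he1 (b' i)
    simpa [c] using this.symm
  have hc2 : ∀ i, β (c (Sum.inr i)) = b'' i := by
    intro i
    have := LinearMap.congr_fun he2 (c (Sum.inr i))
    simpa [c] using this
  -- The orthogonal lifts `p i` differ from the integral lifts by elements `z i` of E'_ℝ, by right
  -- exactness of the tensor product.
  choose p hp hpβ using fun i => honto ((1 : ℝ) ⊗ₜ[ℤ] b'' i)
  have hker : ∀ x, realMap β x = 0 → ∃ z, realMap α z = x := by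
    intro x hx
    exact (lTensor_exact ℝ (f := α.toIntLinearMap) (g := β.toIntLinearMap) hex hβ x).mp hx
  choose z hz using fun i => hker ((1 : ℝ) ⊗ₜ[ℤ] c (Sum.inr i) - p i) (by
    rw [map_sub, hpβ]
    change (1 : ℝ) ⊗ₜ[ℤ] β (c (Sum.inr i)) - _ = 0
    rw [hc2, sub_self])
  let bR := b'.baseChange ℝ
  let v : Module.Free.ChooseBasisIndex ℤ E' ⊕ Module.Free.ChooseBasisIndex ℤ E'' → RealSpace E :=
    Sum.elim (fun i => realMap α (bR i)) p
  -- Transition from the orthogonal family `v` to the integral basis `c`; it is unitriangular by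
  -- blocks.
  let P : Matrix (Module.Free.ChooseBasisIndex ℤ E' ⊕ Module.Free.ChooseBasisIndex ℤ E'')
      (Module.Free.ChooseBasisIndex ℤ E' ⊕ Module.Free.ChooseBasisIndex ℤ E'') ℝ :=
    Matrix.fromBlocks 1 0 (Matrix.of fun i j => bR.repr (z i) j) 1
  have hdet : P.det = 1 := by simp [P]
  rw [latDet_eq B c, det_gram_of_comb B v _ P, hdet, one_pow, one_mul]
  · have hblock : gram B v = Matrix.fromBlocks (gram B' fun i => (1 : ℝ) ⊗ₜ[ℤ] b' i) 0 0
        (gram B'' fun i => (1 : ℝ) ⊗ₜ[ℤ] b'' i) := by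
      ext i j
      rcases i with i | i <;> rcases j with j | j
      · simp only [gram, v, Matrix.of_apply, Sum.elim_inl, Matrix.fromBlocks_apply₁₁, hl, bR,
          Module.Basis.baseChange_apply]
      · simp only [gram, v, Matrix.of_apply, Sum.elim_inl, Sum.elim_inr,
          Matrix.fromBlocks_apply₁₂, Matrix.zero_apply]
        rw [hB, hp]
      · simp only [gram, v, Matrix.of_apply, Sum.elim_inl, Sum.elim_inr,
          Matrix.fromBlocks_apply₂₁, Matrix.zero_apply, hp]
      · simp only [gram, v, Matrix.of_apply, Sum.elim_inr, Matrix.fromBlocks_apply₂₂]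
        rw [← hr _ _ (hp i) (hp j), hpβ, hpβ]
    rw [hblock, Matrix.det_fromBlocks_zero₁₂, latDet_eq B' b', latDet_eq B'' b'']
  · rintro (i | i)
    · rw [Fintype.sum_sum_type]
      simp only [v, P, Matrix.fromBlocks_apply₁₁, Matrix.fromBlocks_apply₁₂, Sum.elim_inl,
        Sum.elim_inr, Matrix.zero_apply, zero_smul, Finset.sum_const_zero, add_zero,
        Matrix.one_apply, ite_smul, one_smul, Finset.sum_ite_eq, Finset.mem_univ, if_true, hc1,
        bR, Module.Basis.baseChange_apply]
      rfl
    · rw [Fintype.sum_sum_type]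
      simp only [v, P, Matrix.fromBlocks_apply₂₁, Matrix.fromBlocks_apply₂₂, Sum.elim_inl,
        Sum.elim_inr, Matrix.one_apply, ite_smul, one_smul, zero_smul, Finset.sum_ite_eq,
        Finset.mem_univ, if_true, Matrix.of_apply, ← map_smul, ← map_sum, bR.sum_repr, hz]
      abel

end Lattice

/-! ### The real trace form of `K_ℝ` -/

section BaseField

variable (K : Type w) [Field K] [NumberField K]

/-- The basis of `K_ℝ` given by an integral basis of `K`. -/
def realBasis : Module.Basis (Module.Free.ChooseBasisIndex ℤ (𝓞 K)) ℝ (RealAlg K) :=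
  (integralBasis K).baseChange ℝ

theorem realBasis_apply (i) : realBasis K i = toReal (integralBasis K i) :=
  Module.Basis.baseChange_apply ..

theorem normReal_eq_norm (x : RealAlg K) : normReal x = Algebra.norm ℝ x := by
  rw [normReal, Algebra.norm_apply]
  congr 1
  ext y
  exact mul_comm _ _

theorem trReal_toReal (c : K) : trReal K K (toReal c) = ((Algebra.trace ℚ K c : ℚ) : ℝ) := by
  rw [trReal, reducedTrace_self]
  simp

open Classical in
theorem det_trace_realBasis :
    (Matrix.of fun i j => trReal K K (realBasis K i * realBasis K j)).det = (discr K : ℝ) := by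
  have h : (Matrix.of fun i j => trReal K K (realBasis K i * realBasis K j)) =
      (algebraMap ℚ ℝ).mapMatrix (Algebra.traceMatrix ℚ (integralBasis K)) := by
    ext i j
    rw [Matrix.of_apply, realBasis_apply, realBasis_apply, Algebra.TensorProduct.tmul_mul_tmul,
      one_mul, trReal_toReal]
    rfl
  rw [h, ← RingHom.map_det, ← Algebra.discr_def, ← coe_discr]
  simp

theorem abs_det_eq_one_of_involution {V : Type*} [AddCommGroup V] [Module ℝ V] (f : V →ₗ[ℝ] V)
    (hf : ∀ x, f (f x) = x) : |LinearMap.det f| = 1 := by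
  have h : LinearMap.det f * LinearMap.det f = 1 := by
    rw [← LinearMap.det_comp, show f ∘ₗ f = LinearMap.id from LinearMap.ext hf, LinearMap.det_id]
  rcases mul_self_eq_one_iff.mp h with h | h <;> rw [h] <;> norm_num

/-- The twist multiplies the Gram matrix by the matrix of an involution, whose determinant is ±1. It
is applied to the canonical involution of K_ℝ and to the positive involution of A_ℝ. -/
theorem abs_det_twist {V ι : Type*} [Fintype ι] [DecidableEq ι] [AddCommGroup V] [Module ℝ V]
    (b : Module.Basis ι ℝ V) (B : V →ₗ[ℝ] V →ₗ[ℝ] ℝ) (f : V →ₗ[ℝ] V) (hf : ∀ x, f (f x) = x) :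
    |(Matrix.of fun i j => B (b i) (f (b j))).det| = |(Matrix.of fun i j => B (b i) (b j)).det| := by
  have h : (Matrix.of fun i j => B (b i) (f (b j))) =
      (Matrix.of fun i j => B (b i) (b j)) * LinearMap.toMatrix b b f := by
    ext i j
    rw [Matrix.mul_apply, Matrix.of_apply]
    conv_lhs => rw [← b.sum_repr (f (b j)), map_sum]
    refine Finset.sum_congr rfl fun k _ => ?_
    rw [map_smul, LinearMap.toMatrix_apply, Matrix.of_apply, smul_eq_mul, mul_comm]
  rw [h, Matrix.det_mul, abs_mul, LinearMap.det_toMatrix, abs_det_eq_one_of_involution f hf,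
    mul_one]

/-- The trace form `(x, y) ↦ tr(x y)`. -/
def trMul (K : Type w) [Field K] [NumberField K] (A : Type u) [Ring A] [Algebra K A] [Algebra ℚ A] :
    RealAlg A →ₗ[ℝ] RealAlg A →ₗ[ℝ] ℝ := (LinearMap.mul ℝ (RealAlg A)).compr₂ (trReal K A)

-- Expanding ω_a H_ij in the basis ω separates the matrix into diagonal blocks carrying the twisted
-- trace form of K_ℝ and blocks representing multiplication by the entries of H. These blocks
-- commute, so the determinant of the second factor is the norm of det H.
open Classical in
theorem abs_det_twisted_blocks {n : ℕ} (H : Matrix (Fin n) (Fin n) (RealAlg K)) :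
    |(Matrix.of fun p q : Fin n × Module.Free.ChooseBasisIndex ℤ (𝓞 K) =>
      trReal K K (realBasis K p.2 * H p.1 q.1 * conjReal K (realBasis K q.2))).det| =
    |(discr K : ℝ)| ^ n * |normReal H.det| := by
  let b := realBasis K
  let U : Matrix _ _ ℝ := Matrix.of fun i j => trMul K K (b i) (conjReal K (b j))
  let lM := (Algebra.leftMulMatrix b).toRingHom
  have hU : |U.det| = |(discr K : ℝ)| := by
    rw [abs_det_twist b (trMul K K) (conjReal K) conj_conj, ← det_trace_realBasis]
    rfl
  -- After transposition the multiplication blocks appear exactly as the left multiplication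
  -- matrices of the entries of Hᵀ, so that `Matrix.det_det` applies.
  have key : (Matrix.of fun p q : Fin n × Module.Free.ChooseBasisIndex ℤ (𝓞 K) =>
      trReal K K (b p.2 * H p.1 q.1 * conjReal K (b q.2))).transpose =
      Matrix.kroneckerMap (fun x y => x * y) (1 : Matrix (Fin n) (Fin n) ℝ) U.transpose *
        Matrix.comp (Fin n) (Fin n) _ _ ℝ (H.transpose.map lM) := by
    ext ⟨j, c⟩ ⟨i, a⟩
    rw [Matrix.mul_apply, Fintype.sum_prod_type, Finset.sum_eq_single j]
    · simp only [Matrix.transpose_apply, Matrix.of_apply, Matrix.kroneckerMap_apply,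
        Matrix.one_apply_eq, one_mul, Matrix.comp_apply, Matrix.map_apply]
      have h1 : b a * H i j = ∑ k, lM (H i j) k a • b k := by
        rw [mul_comm]
        simp only [lM, AlgHom.toRingHom_eq_coe, RingHom.coe_coe, Algebra.leftMulMatrix_eq_repr_mul]
        exact (b.sum_repr _).symm
      rw [h1, Finset.sum_mul, map_sum]
      refine Finset.sum_congr rfl fun k _ => ?_
      rw [smul_mul_assoc, map_smul, smul_eq_mul, mul_comm]
      rfl
    · intro k _ hk
      simp [Matrix.one_apply_ne' hk]
    · simp
  rw [← Matrix.det_transpose, key, Matrix.det_mul, Matrix.det_kronecker, ← Matrix.det_det,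
    Matrix.det_transpose, Matrix.det_transpose, Matrix.det_one, one_pow, one_mul, abs_mul, abs_pow,
    hU, Fintype.card_fin, normReal_eq_norm, Algebra.norm_eq_matrix_det b]
  rfl

end BaseField

/-! ### The arithmetic degree in terms of lattice determinants -/

section Modules

variable {K : Type w} [Field K] [NumberField K] {E : Type*} [AddCommGroup E] [Module (𝓞 K) E]

/-- The absolute norm of the ideal (r) lies in (r). -/
theorem exists_int_multiple (r : 𝓞 K) (hr : r ≠ 0) : ∃ (n : ℤ) (s : 𝓞 K), n ≠ 0 ∧ (n : 𝓞 K) = s * r := by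
  have h := Ideal.absNorm_mem (Ideal.span {r})
  obtain ⟨s, hs⟩ := Ideal.mem_span_singleton'.mp h
  refine ⟨(Ideal.absNorm (Ideal.span {r}) : ℕ), s, ?_, by rw [hs]; simp⟩
  simpa [Ideal.absNorm_eq_zero_iff] using hr

theorem isTorsion_int (h : Module.IsTorsion (𝓞 K) E) : Module.IsTorsion ℤ E := by
  intro x
  obtain ⟨r, hr⟩ := @h x
  obtain ⟨n, s, hn, hs⟩ := exists_int_multiple r.1 (nonZeroDivisors.coe_ne_zero r)
  refine ⟨⟨n, mem_nonZeroDivisors_of_ne_zero hn⟩, ?_⟩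
  change n • x = 0
  rw [← Int.cast_smul_eq_zsmul (𝓞 K), hs, mul_smul]
  change s • (r • x) = 0
  rw [hr, smul_zero]

variable [Module.Finite (𝓞 K) E]

theorem finite_quotient_span {n : ℕ} (hn : n = Module.finrank (𝓞 K) E) (x : Fin n → E)
    (hx : LinearIndependent (𝓞 K) x) : Finite (E ⧸ Submodule.span (𝓞 K) (Set.range x)) := by
  have h1 := Submodule.finrank_quotient_add_finrank (Submodule.span (𝓞 K) (Set.range x))
  rw [Module.finrank_eq_card_basis (Module.Basis.span hx), Fintype.card_fin, ← hn] at h1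
  have h2 : Module.IsTorsion (𝓞 K) (E ⧸ Submodule.span (𝓞 K) (Set.range x)) :=
    Module.finrank_eq_zero_iff_isTorsion.mp (by omega)
  have : Module.Finite ℤ (E ⧸ Submodule.span (𝓞 K) (Set.range x)) := Module.Finite.trans (𝓞 K) _
  exact Module.finite_of_fg_torsion _ (isTorsion_int h2)

theorem finrank_eq_of_finite_quotient {E : Type*} [AddCommGroup E] [Module.Finite ℤ E]
    (N : AddSubgroup E) [Finite (E ⧸ N)] : Module.finrank ℤ E = Module.finrank ℤ N := by
  have h1 := Submodule.finrank_quotient_add_finrank (AddSubgroup.toIntSubmodule N)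
  have hfin : Finite (E ⧸ AddSubgroup.toIntSubmodule N) := ‹Finite (E ⧸ N)›
  have h2 : Module.finrank ℤ (E ⧸ AddSubgroup.toIntSubmodule N) = 0 := by
    apply Module.finrank_eq_zero_iff_isTorsion.mpr
    intro y
    refine ⟨⟨Nat.card (E ⧸ AddSubgroup.toIntSubmodule N), mem_nonZeroDivisors_of_ne_zero
      (by exact_mod_cast Nat.card_pos.ne')⟩, ?_⟩
    change ((Nat.card (E ⧸ AddSubgroup.toIntSubmodule N) : ℕ) : ℤ) • y = 0
    rw [natCast_zsmul, card_nsmul_eq_zero']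
  rw [← h1, h2, zero_add]
  rfl

/-- E need not be free over the ring of integers, but a maximal independent family spans a free
submodule of finite index, and passing to it does not change the ℤ-rank. -/
theorem finrank_int_eq :
    Module.finrank ℤ E = Module.finrank ℤ (𝓞 K) * Module.finrank (𝓞 K) E := by
  obtain ⟨x, hx⟩ := exists_linearIndependent_of_le_finrank (R := 𝓞 K) (M := E) le_rfl
  have : Module.Finite ℤ E := Module.Finite.trans (𝓞 K) E
  have hf := finite_quotient_span rfl x hx
  set N := Submodule.span (𝓞 K) (Set.range x) with hN
  have : Finite (E ⧸ N.toAddSubgroup) := hf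
  rw [finrank_eq_of_finite_quotient N.toAddSubgroup]
  let b := (RingOfIntegers.basis K).smulTower' (Module.Basis.span hx)
  change Module.finrank ℤ N = _
  rw [Module.finrank_eq_card_basis b, Fintype.card_prod, Fintype.card_fin, mul_comm,
    Module.finrank_eq_card_chooseBasisIndex ℤ (𝓞 K)]

end Modules

/-! ### The lattice and the real trace form attached to a bundle. -/

section BundleBasics

variable {K : Type w} [Field K] [NumberField K] {A : Type u} [Ring A] [Algebra K A] [Algebra ℚ A]
variable {O : Type x} [Ring O] [Algebra (𝓞 K) O] {ι : O →ₐ[𝓞 K] A} {σ : RealAlg A →ₗ[ℝ] RealAlg A}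

namespace ArithBundle

instance finite_base (E : ArithBundle.{u, v, w, x} ι σ) : Module.Finite (𝓞 K) E.carrier := E.finite

instance finite_int (E : ArithBundle.{u, v, w, x} ι σ) : Module.Finite ℤ E.carrier :=
  Module.Finite.trans (𝓞 K) E.carrier

instance free_int (E : ArithBundle.{u, v, w, x} ι σ) : Module.Free ℤ E.carrier := by
  have : Module.IsTorsionFree ℤ E.carrier := by
    refine .of_smul_eq_zero fun n z h => ?_
    have h1 : (n : 𝓞 K) • z = 0 := (Int.cast_smul_eq_zsmul (𝓞 K) n z).trans h
    exact (E.torsionFree _ z h1).imp_left fun h2 => by exact_mod_cast h2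
  infer_instance

/-- The real-valued form `tr_{A_ℝ|ℝ} ∘ h` on `E_ℝ`. -/
def trForm (E : ArithBundle.{u, v, w, x} ι σ) :
    RealSpace E.carrier →ₗ[ℝ] RealSpace E.carrier →ₗ[ℝ] ℝ := E.h.compr₂ (trReal K A)

theorem trForm_apply (E : ArithBundle.{u, v, w, x} ι σ) (x y) :
    E.trForm x y = trReal K A (E.h x y) := rfl

/-- The determinant of the lattice `E` in the Euclidean space `E_ℝ`. -/
def covol (E : ArithBundle.{u, v, w, x} ι σ) : ℝ := latDet E.trForm

theorem covol_ne_zero (E : ArithBundle.{u, v, w, x} ι σ) : E.covol ≠ 0 :=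
  latDet_ne_zero _ E.h_pos

theorem Isomorphic.covol_eq {E E' : ArithBundle.{u, v, w, x} ι σ} (h : Isomorphic E E') :
    E'.covol = E.covol := by
  obtain ⟨φ, hφ⟩ := h
  exact latDet_equiv _ _ φ.toAddEquiv fun x y => congrArg (trReal K A) (hφ x y)

theorem smul_base (E : ArithBundle.{u, v, w, x} ι σ) (r : 𝓞 K) (z : E.carrier) :
    r • z = algebraMap (𝓞 K) O r • z := (algebraMap_smul O r z).symm

end ArithBundle

end BundleBasics

section BaseDegree

variable {K : Type w} [Field K] [NumberField K]

theorem conjReal_mul (x y : RealAlg K) : conjReal K (x * y) = conjReal K x * conjReal K y :=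
  map_mul (conjAlgEquiv K) x y

/-- For the order R itself the carrier has two R-module structures, `module` and `moduleBase`, which
agree by the tower condition. The action is written out explicitly to say that `moduleBase`, the one
used in `baseDegree`, is meant. -/
theorem BaseBundle.h_smul_smul (E : BaseBundle.{v, w} K) (a b : 𝓞 K) (x y : E.carrier) :
    E.h ((1 : ℝ) ⊗ₜ[ℤ] (E.moduleBase.smul a x)) ((1 : ℝ) ⊗ₜ[ℤ] (E.moduleBase.smul b y)) =
      toReal (a : K) * E.h ((1 : ℝ) ⊗ₜ[ℤ] x) ((1 : ℝ) ⊗ₜ[ℤ] y) * conjReal K (toReal (b : K)) := by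
  have hl : ∀ (c : 𝓞 K) (z : E.carrier) (t : RealSpace E.carrier),
      E.h ((1 : ℝ) ⊗ₜ[ℤ] (E.moduleBase.smul c z)) t = toReal (c : K) * E.h ((1 : ℝ) ⊗ₜ[ℤ] z) t := by
    intro c z t
    have h1 : E.moduleBase.smul c z = E.module.smul c z := E.smul_base c z
    rw [h1]
    exact E.h_smul c ((1 : ℝ) ⊗ₜ[ℤ] z) t
  rw [hl, E.h_conj, hl, conjReal_mul, ← E.h_conj, mul_assoc, mul_comm (conjReal K _)]

/-- The right side does not mention the family chosen in `baseDegree`, and the argument uses only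
its linear independence and maximal length; hence the degree is independent of the choice. Both
computations of the Gram determinant of the span (index formula and block determinant) are compared.
-/
theorem baseDegree_eq (E : BaseBundle.{v, w} K) :
    baseDegree E = -(1 / 2) * Real.log E.covol +
      (Module.finrank ℤ E.carrier : ℝ) / (2 * Module.finrank ℤ (𝓞 K)) * Real.log |(discr K : ℝ)| := by
  classical
  unfold baseDegree
  have hex := exists_linearIndependent_of_le_finrank (R := 𝓞 K) (M := E.carrier) le_rfl
  set x : Fin (Module.finrank (𝓞 K) E.carrier) → E.carrier := hex.choose with hxdef
  have hx : LinearIndependent (𝓞 K) x := hex.choose_spec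
  have hf := finite_quotient_span rfl x hx
  set N := Submodule.span (𝓞 K) (Set.range x) with hN
  have hf' : Finite (E.carrier ⧸ N.toAddSubgroup) := hf
  -- The ℤ-basis ω_k x_i of the span of the family.
  let b₀ := (RingOfIntegers.basis K).smulTower' (Module.Basis.span hx)
  let b : Module.Basis _ ℤ N.toAddSubgroup := b₀
  have hb : ∀ p, (b p : E.carrier) = E.moduleBase.smul (RingOfIntegers.basis K p.2) (x p.1) := by
    intro p
    change ((b₀ p : N) : E.carrier) = _
    rw [Module.Basis.smulTower'_apply, Module.Basis.span_apply]
    rfl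
  have h1 := det_gram_sublattice E.trForm N.toAddSubgroup b
    (finrank_eq_of_finite_quotient N.toAddSubgroup)
  have h2 : (gram E.trForm fun p => (1 : ℝ) ⊗ₜ[ℤ] (b p : E.carrier)) =
      Matrix.of fun p q => trReal K K (realBasis K p.2 *
        (Matrix.of fun i j => E.h ((1 : ℝ) ⊗ₜ[ℤ] x i) ((1 : ℝ) ⊗ₜ[ℤ] x j)) p.1 q.1 *
          conjReal K (realBasis K q.2)) := by
    ext p q
    simp only [gram, Matrix.of_apply, hb]
    rw [ArithBundle.trForm_apply, BaseBundle.h_smul_smul, realBasis_apply, realBasis_apply,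
      integralBasis_apply, integralBasis_apply]
  rw [h2] at h1
  have h3 := abs_det_twisted_blocks K
    (Matrix.of fun i j => E.h ((1 : ℝ) ⊗ₜ[ℤ] x i) ((1 : ℝ) ⊗ₜ[ℤ] x j))
  rw [h1] at h3
  have hcard : (Nat.card (E.carrier ⧸ N) : ℝ) ≠ 0 := by exact_mod_cast Nat.card_pos.ne'
  have hd : |(discr K : ℝ)| ≠ 0 := by
    rw [ne_eq, abs_eq_zero]; exact_mod_cast discr_ne_zero K
  have h4 := congrArg Real.log h3
  -- Positivity makes `covol` nonzero, and the comparison then forces N(det h(x_i, x_j)) ≠ 0, so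
  -- that the logarithm of the product may be split.
  have hne : |((Nat.card (E.carrier ⧸ N) : ℝ)) ^ 2 * latDet E.trForm| ≠ 0 :=
    abs_ne_zero.mpr (mul_ne_zero (pow_ne_zero _ hcard) E.covol_ne_zero)
  have hN0 := right_ne_zero_of_mul (h3 ▸ hne)
  rw [Real.log_abs, Real.log_mul (pow_ne_zero _ hd) hN0, Real.log_pow] at h4
  change Real.log (((Nat.card (E.carrier ⧸ N) : ℝ)) ^ 2 * E.covol) = _ at h4
  rw [Real.log_mul (pow_ne_zero _ hcard) E.covol_ne_zero, Real.log_pow] at h4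
  have hpos : (Module.finrank ℤ (𝓞 K) : ℝ) ≠ 0 := by
    exact_mod_cast Module.finrank_pos.ne'
  rw [finrank_int_eq (K := K) (E := E.carrier)]
  dsimp only
  push_cast at h4 ⊢
  field_simp
  linarith

end BaseDegree

/-! ### Full embeddings of lattices and the rank -/

section Full

variable {E V : Type*} [AddCommGroup E] [AddCommGroup V]

/-- An injective homomorphism `E → V` such that every element of `V` has a nonzero integral multiple
in the image. -/
structure IsFull (j : E →+ V) : Prop where
  injective : Function.Injective j
  full : ∀ v, ∃ n : ℤ, n ≠ 0 ∧ ∃ x, j x = n • v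

theorem IsFull.pi {ι : Type*} [Fintype ι] {j : E →+ V} (h : IsFull j) :
    IsFull (j.compLeft ι) where
  injective x y hxy := funext fun i => h.injective (congrFun hxy i)
  full v := by
    classical
    choose n hn x hx using fun i => h.full (v i)
    -- The product of the denominators of the coordinates is a common denominator.
    refine ⟨∏ i, n i, Finset.prod_ne_zero_iff.mpr fun i _ => hn i,
      fun i => (∏ k ∈ Finset.univ.erase i, n k) • x i, funext fun i => ?_⟩
    change j _ = _
    rw [map_zsmul, hx, smul_smul, Finset.prod_erase_mul _ _ (Finset.mem_univ i)]
    rfl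

theorem IsFull.rank_eq {E V : Type u} [AddCommGroup E] [AddCommGroup V] {j : E →+ V}
    (h : IsFull j) : Module.rank ℤ E = Module.rank ℤ V := by
  have h1 := Submodule.rank_quotient_add_rank (LinearMap.range j.toIntLinearMap)
  have h2 : Module.rank ℤ (V ⧸ LinearMap.range j.toIntLinearMap) = 0 := by
    rw [Module.rank_eq_zero_iff_isTorsion]
    intro y
    obtain ⟨v, rfl⟩ := Submodule.Quotient.mk_surjective _ y
    obtain ⟨n, hn, x, hx⟩ := h.full v
    refine ⟨⟨n, mem_nonZeroDivisors_of_ne_zero hn⟩, ?_⟩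
    change n • (Submodule.Quotient.mk v : V ⧸ LinearMap.range j.toIntLinearMap) = 0
    rw [← Submodule.Quotient.mk_smul, Submodule.Quotient.mk_eq_zero, ← hx]
    exact ⟨x, rfl⟩
  rw [h2, zero_add] at h1
  rw [← h1]
  exact (LinearEquiv.ofInjective j.toIntLinearMap h.injective).rank_eq

end Full

/-! ### The lattice E inside A ⊗_O E. -/

section FullBaseChange

variable {K : Type w} [Field K] [NumberField K] {A : Type u} [Ring A] [Algebra K A] [Algebra ℚ A]
variable {O : Subalgebra (𝓞 K) A}
variable {E : Type v} [AddCommGroup E] [Module O E]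

theorem isFull_val (hO : IsOrder O) : IsFull (O.val : O →+ A) where
  injective := Subtype.val_injective
  full b := by
    obtain ⟨n, hn, h⟩ := hO.exists_int_smul_mem b
    exact ⟨n, hn, ⟨n • b, h⟩, rfl⟩

variable (O E) in
/-- The map `E → A ⊗_O E`. -/
def toBaseChange : E →+ BaseChange O.val.toRingHom E :=
  (Submodule.mkQ (balancedRel O.val.toRingHom E)).toAddMonoidHom.comp
    (TensorProduct.mk ℤ A E 1).toAddMonoidHom

theorem toBaseChange_apply (z : E) :
    toBaseChange O E z = Submodule.Quotient.mk ((1 : A) ⊗ₜ[ℤ] z) := rfl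

theorem toBaseChange_smul (c : O) (z : E) :
    toBaseChange O E (c • z) = (c : A) • toBaseChange O E z := by
  rw [toBaseChange_apply, toBaseChange_apply, ← Submodule.Quotient.mk_smul,
    TensorProduct.smul_tmul', eq_comm, Submodule.Quotient.eq]
  apply Submodule.subset_span
  refine ⟨1, c, z, ?_⟩
  rw [one_mul, smul_eq_mul, mul_one]
  rfl

/-- If n b lies in O, then n (b ⊗ z) = 1 ⊗ (n b) z; sums are handled by a common denominator. -/
theorem toBaseChange_full (hO : IsOrder O) (t : BaseChange O.val.toRingHom E) :
    ∃ n : ℤ, n ≠ 0 ∧ ∃ z : E, toBaseChange O E z = n • t := by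
  obtain ⟨t, rfl⟩ := Submodule.Quotient.mk_surjective _ t
  induction t using TensorProduct.induction_on with
  | zero => exact ⟨1, one_ne_zero, 0, by rw [map_zero, Submodule.Quotient.mk_zero, smul_zero]⟩
  | tmul b z =>
    obtain ⟨n, hn, hb⟩ := hO.exists_int_smul_mem b
    refine ⟨n, hn, (⟨n • b, hb⟩ : O) • z, ?_⟩
    rw [toBaseChange_smul, toBaseChange_apply, ← Submodule.Quotient.mk_smul,
      ← Submodule.Quotient.mk_smul, TensorProduct.smul_tmul', TensorProduct.smul_tmul']
    simp
  | add s t hs ht =>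
    obtain ⟨n, hn, y, hs⟩ := hs
    obtain ⟨m, hm, z, ht⟩ := ht
    refine ⟨n * m, mul_ne_zero hn hm, m • y + n • z, ?_⟩
    rw [Submodule.Quotient.mk_add, smul_add, mul_smul, mul_smul, smul_comm n m, ← hs, ← ht,
      map_add, map_zsmul, map_zsmul]

theorem exists_mul_int_eq_one {n : ℤ} (hn : n ≠ 0) : ∃ q : A, q * (n : A) = 1 :=
  ⟨algebraMap ℚ A (n : ℚ)⁻¹, by
    rw [← map_intCast (algebraMap ℚ A) n, ← map_mul, inv_mul_cancel₀ (Int.cast_ne_zero.mpr hn),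
      map_one]⟩

theorem zsmul_cancel {V : Type*} [AddCommGroup V] [Module A V] {n : ℤ} (hn : n ≠ 0) {v : V}
    (h : n • v = 0) : v = 0 := by
  obtain ⟨q, hq⟩ := exists_mul_int_eq_one (A := A) hn
  rw [← one_smul A v, ← hq, mul_smul, Int.cast_smul_eq_zsmul, h, smul_zero]

/-- The action of `A` on `E_ℝ`. -/
theorem exists_real_action (hO : IsOrder O) : ∃ f : A →ₗ[ℤ] (RealSpace E →ₗ[ℤ] RealSpace E),
    (∀ (c : O) (r : ℝ) (z : E), f c (r ⊗ₜ z) = r ⊗ₜ (c • z)) ∧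
    ∀ (b : A) (c : O) (r : ℝ) (z : E), f (b * c) (r ⊗ₜ z) = f b (r ⊗ₜ (c • z)) := by
  let g₀ : O →ₗ[ℤ] (E →ₗ[ℤ] E) := LinearMap.mk₂ ℤ (fun c z => c • z) (fun a b z => add_smul a b z)
    (fun n c z => smul_assoc n c z) (fun c y z => smul_add c y z) (fun n c z => smul_comm c n z)
  let g : O →ₗ[ℤ] (RealSpace E →ₗ[ℤ] RealSpace E) := LinearMap.lTensorHom ℝ ∘ₗ g₀
  let i : O →ₗ[ℤ] A := (O.val : O →+ A).toIntLinearMap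
  have hcancel : ∀ (n : ℤ), n ≠ 0 → ∀ v : RealSpace E, n • v = 0 → v = 0 := fun n hn v h => by
    rw [← Int.cast_smul_eq_zsmul ℝ] at h
    exact (smul_eq_zero.mp h).resolve_left (Int.cast_ne_zero.mpr hn)
  have hunit : ∀ n : nonZeroDivisors ℤ,
      IsUnit (algebraMap ℤ (Module.End ℤ (RealSpace E →ₗ[ℤ] RealSpace E)) n) := by
    intro n
    have hn : ((n : ℤ) : ℝ) ≠ 0 := Int.cast_ne_zero.mpr (nonZeroDivisors.coe_ne_zero n)
    rw [Module.End.isUnit_iff]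
    constructor
    · rw [injective_iff_map_eq_zero]
      intro φ hφ
      refine LinearMap.ext fun v => ?_
      apply hcancel n (nonZeroDivisors.coe_ne_zero n)
      exact LinearMap.congr_fun hφ v
    · intro φ
      refine ⟨((LinearMap.lsmul ℝ (RealSpace E) ((n : ℤ) : ℝ)⁻¹).restrictScalars ℤ) ∘ₗ φ, ?_⟩
      refine LinearMap.ext fun v => ?_
      change (n : ℤ) • ((((n : ℤ) : ℝ)⁻¹) • φ v) = φ v
      rw [← Int.cast_smul_eq_zsmul ℝ, smul_smul, mul_inv_cancel₀ hn, one_smul]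
  -- A is the localization of O at the nonzero integers, and these act invertibly on the
  -- endomorphisms of E_ℝ, so the action of O extends to A.
  have hloc : IsLocalizedModule (nonZeroDivisors ℤ) i := by
    refine ⟨fun n => ?_, fun b => ?_, fun {x y} h => ⟨1, by rw [Subtype.val_injective h]⟩⟩
    · have hn := nonZeroDivisors.coe_ne_zero n
      rw [Module.End.isUnit_iff]
      constructor
      · rw [injective_iff_map_eq_zero]
        intro b hb
        exact zsmul_cancel (A := A) hn hb
      · intro b
        obtain ⟨q, hq⟩ := exists_mul_int_eq_one (A := A) hn
        refine ⟨q * b, ?_⟩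
        change (n : ℤ) • (q * b) = b
        rw [zsmul_eq_mul, ← mul_assoc, Int.cast_comm, hq, one_mul]
    · obtain ⟨n, hn, h⟩ := hO.exists_int_smul_mem b
      exact ⟨(⟨n • b, h⟩, ⟨n, mem_nonZeroDivisors_of_ne_zero hn⟩), rfl⟩
  let f := IsLocalizedModule.lift (nonZeroDivisors ℤ) i g hunit
  have hf : ∀ c : O, f c = g c := fun c => IsLocalizedModule.lift_apply (nonZeroDivisors ℤ) i g hunit c
  refine ⟨f, fun c r z => by rw [hf]; rfl, fun b c r z => ?_⟩
  -- Compatibility with products is checked after multiplication by n, where n b lies in O and the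
  -- extended map is the original action.
  obtain ⟨n, hn, h⟩ := hO.exists_int_smul_mem b
  rw [← sub_eq_zero]
  apply hcancel n hn
  have h1 : ∀ (a : A) (t : RealSpace E), n • f a t = f (n • a) t := fun a t => by
    rw [map_zsmul]; rfl
  rw [smul_sub, h1, h1, ← smul_mul_assoc]
  have h2 := hf ((⟨n • b, h⟩ : O) * c)
  have h3 := hf (⟨n • b, h⟩ : O)
  change f (n • b * c) = _ at h2
  change f (n • b) = _ at h3
  rw [h2, h3, sub_eq_zero]
  have hg : ∀ (a : O) (y : E), g a (r ⊗ₜ y) = r ⊗ₜ (a • y) := fun a y => rfl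
  rw [hg, hg, mul_smul]

theorem one_tmul_injective [Module.Free ℤ E] :
    Function.Injective (fun z : E => ((1 : ℝ) ⊗ₜ[ℤ] z : RealSpace E)) := by
  have h1 : Function.Injective ((Algebra.linearMap ℤ ℝ).rTensor E) :=
    Module.Flat.rTensor_preserves_injective_linearMap _ (RingHom.injective_int (algebraMap ℤ ℝ))
  intro y z h
  apply (TensorProduct.lid ℤ E).symm.injective
  apply h1
  simpa using h

/-- For injectivity, A ⊗_O E is probed by the map b ⊗ y ↦ b (1 ⊗ y) into E_ℝ, which respects the
balancing relations and restricts to the inclusion of the lattice E in E_ℝ. -/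
theorem isFull_toBaseChange (hO : IsOrder O) [Module.Free ℤ E] : IsFull (toBaseChange O E) where
  injective := by
    rw [injective_iff_map_eq_zero]
    intro z hz
    obtain ⟨f, hf1, hf2⟩ := exists_real_action (E := E) hO
    let φ : A ⊗[ℤ] E →ₗ[ℤ] RealSpace E := TensorProduct.lift (LinearMap.mk₂ ℤ
      (fun b y => f b ((1 : ℝ) ⊗ₜ y)) (by intro a b y; simp)
      (by intro n b y; rw [map_zsmul]; rfl) (by intro b y y'; simp [TensorProduct.tmul_add])
      (by intro n b y; rw [TensorProduct.tmul_smul, map_zsmul]))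
    have hφ : ∀ b y, φ (b ⊗ₜ y) = f b ((1 : ℝ) ⊗ₜ y) := fun b y => rfl
    -- The relations form an A-span while `φ` is only ℤ-linear; quantifying over all multiples `c •
    -- t` makes the span induction go through.
    have key : ∀ t ∈ balancedRel O.val.toRingHom E, ∀ c : A, φ (c • t) = 0 := by
      intro t ht
      induction ht using Submodule.span_induction with
      | mem t ht =>
        obtain ⟨b, o, y, rfl⟩ := ht
        intro c
        rw [smul_sub, map_sub, TensorProduct.smul_tmul', TensorProduct.smul_tmul', hφ, hφ,
          smul_eq_mul, smul_eq_mul, ← mul_assoc, sub_eq_zero]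
        exact hf2 _ _ _ _
      | zero => intro c; rw [smul_zero, map_zero]
      | add s t _ _ hs ht => intro c; rw [smul_add, map_add, hs, ht, add_zero]
      | smul a t _ ht => intro c; rw [smul_smul]; exact ht _
    rw [toBaseChange_apply, Submodule.Quotient.mk_eq_zero] at hz
    have h1 := key _ hz 1
    rw [one_smul, hφ] at h1
    have h2 := hf1 1 1 z
    rw [one_smul] at h2
    change f 1 _ = _ at h2
    rw [h2] at h1
    exact one_tmul_injective (h1.trans (TensorProduct.tmul_zero E (1 : ℝ)).symm)
  full := toBaseChange_full hO

/-- `A ⊗_O E` is isomorphic to every `A`-module in which `E` is fully embedded. -/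
theorem IsFull.exists_equiv (hO : IsOrder O) {V : Type*} [AddCommGroup V] [Module A V]
    {j : E →+ V} (hj : IsFull j) (hsmul : ∀ (c : O) (z : E), j (c • z) = (c : A) • j z) :
    Nonempty (BaseChange O.val.toRingHom E ≃ₗ[A] V) := by
  let μ₀ : A ⊗[ℤ] E →ₗ[A] V := TensorProduct.AlgebraTensorModule.lift
    (LinearMap.toSpanSingleton A (E →ₗ[ℤ] V) j.toIntLinearMap)
  have hμ₀ : ∀ b z, μ₀ (b ⊗ₜ z) = b • j z := fun b z => rfl
  let μ : BaseChange O.val.toRingHom E →ₗ[A] V := Submodule.liftQ _ μ₀ (by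
    rw [balancedRel, Submodule.span_le]
    rintro _ ⟨b, c, z, rfl⟩
    rw [SetLike.mem_coe, LinearMap.mem_ker, map_sub, hμ₀, hμ₀, hsmul, mul_smul]
    exact sub_self _)
  have hμ : ∀ z, μ (toBaseChange O E z) = j z := fun z => one_smul A (j z)
  refine ⟨LinearEquiv.ofBijective μ ⟨?_, ?_⟩⟩
  · rw [injective_iff_map_eq_zero]
    intro t ht
    obtain ⟨n, hn, z, hz⟩ := toBaseChange_full hO t
    apply zsmul_cancel (A := A) hn
    rw [← hz]
    have h0 : j z = 0 := by rw [← hμ, hz, map_zsmul, ht, smul_zero]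
    rw [hj.injective (h0.trans (map_zero j).symm), map_zero]
  · intro v
    obtain ⟨n, hn, z, hz⟩ := hj.full v
    obtain ⟨q, hq⟩ := exists_mul_int_eq_one (A := A) hn
    refine ⟨q • toBaseChange O E z, ?_⟩
    rw [map_smul, hμ, hz, ← Int.cast_smul_eq_zsmul A, smul_smul, hq, one_smul]

end FullBaseChange

/-! ### Homomorphisms on the Grothendieck group -/

section Homs

variable {K : Type w} [Field K] [NumberField K] {A : Type u} [Ring A] [Algebra K A] [Algebra ℚ A]

section General

variable {O : Type x} [Ring O] [Algebra (𝓞 K) O] {ι : O →ₐ[𝓞 K] A} {σ : RealAlg A →ₗ[ℝ] RealAlg A}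

open ArithBundle in
theorem exists_K0_hom {G : Type*} [AddCommGroup G] (f : ArithBundle.{u, v, w, x} ι σ → G)
    (hiso : ∀ E E', Isomorphic E E' → f E = f E')
    (hadd : ∀ (E' E E'' : ArithBundle.{u, v, w, x} ι σ) (α : E'.carrier →ₗ[O] E.carrier)
      (β : E.carrier →ₗ[O] E''.carrier), IsShortExact E' E E'' α β → f E = f E' + f E'') :
    ∃ F : K0.{u, v, w, x} ι σ →+ G, ∀ E, F E.cls = f E := by
  let F₀ : FreeGroup₀.{u, v, w, x} ι σ →+ G :=
    FreeAbelianGroup.lift (Quotient.lift f hiso)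
  have hF₀ : ∀ E, F₀ (gen E) = f E := fun E => FreeAbelianGroup.lift_apply_of _ _
  have hle : relations.{u, v, w, x} ι σ ≤ F₀.ker := by
    rw [relations, AddSubgroup.closure_le]
    rintro _ ⟨E', E, E'', α, β, h, rfl⟩
    rw [SetLike.mem_coe, AddMonoidHom.mem_ker, map_sub, map_add, hF₀, hF₀, hF₀, hadd _ _ _ α β h,
      sub_self]
  exact ⟨QuotientAddGroup.lift _ F₀ hle, hF₀⟩

open ArithBundle in
theorem cls_eq_of_shortExact {E' E E'' : ArithBundle.{u, v, w, x} ι σ}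
    {α : E'.carrier →ₗ[O] E.carrier} {β : E.carrier →ₗ[O] E''.carrier}
    (h : IsShortExact E' E E'' α β) : E.cls = E'.cls + E''.cls := by
  have h1 : gen E' + gen E'' - gen E ∈ relations.{u, v, w, x} ι σ :=
    AddSubgroup.subset_closure ⟨E', E, E'', α, β, h, rfl⟩
  have h2 := (QuotientAddGroup.eq_zero_iff _).mpr h1
  rw [QuotientAddGroup.mk_sub, QuotientAddGroup.mk_add, sub_eq_zero] at h2
  exact h2.symm

open ArithBundle in
theorem cls_eq_of_isomorphic {E E' : ArithBundle.{u, v, w, x} ι σ} (h : Isomorphic E E') :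
    E.cls = E'.cls :=
  congrArg (fun q => QuotientAddGroup.mk (FreeAbelianGroup.of q)) (Quotient.sound h)

open ArithBundle in
theorem hom_ext_cls {G : Type*} [AddCommGroup G] {F F' : K0.{u, v, w, x} ι σ →+ G}
    (h : ∀ E : ArithBundle.{u, v, w, x} ι σ, F E.cls = F' E.cls) : F = F' := by
  apply QuotientAddGroup.addMonoidHom_ext
  apply FreeAbelianGroup.lift_ext
  intro q
  induction q using Quotient.inductionOn with
  | h E => exact h E

namespace ArithBundle

/-- The form `tr ∘ h` is symmetric. -/
theorem trForm_comm (hσ : IsPositiveInvolution K σ) (E : ArithBundle.{u, v, w, x} ι σ) (y z) :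
    E.trForm y z = E.trForm z y := by
  rw [trForm_apply, trForm_apply, E.h_conj y z, ← trReal_self_trRealAlg,
    trRealAlg_involution hσ, trReal_conj, trReal_self_trRealAlg]

theorem h_smul_right (hσ : IsPositiveInvolution K σ) (E : ArithBundle.{u, v, w, x} ι σ) (c : O)
    (y z) : E.h y (realMap (DistribSMul.toAddMonoidHom E.carrier c) z) =
      E.h y z * σ (toReal (ι c)) := by
  rw [E.h_conj, E.h_smul, hσ.map_mul, ← E.h_conj]

theorem realMap_smul {E E' : Type*} [AddCommGroup E] [AddCommGroup E'] [Module O E] [Module O E']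
    (α : E' →ₗ[O] E) (c : O) (z : RealSpace E') :
    realMap (α : E' →+ E) (realMap (DistribSMul.toAddMonoidHom E' c) z) =
      realMap (DistribSMul.toAddMonoidHom E c) (realMap (α : E' →+ E) z) := by
  rw [← LinearMap.comp_apply, ← LinearMap.comp_apply]
  congr 1
  ext y
  simp

/-- The sequence splits orthogonally for h, whereas the lattice lemma speaks of tr ∘ h. The
hypothesis `horth` bridges the two. -/
theorem IsShortExact.covol_eq {E' E E'' : ArithBundle.{u, v, w, x} ι σ}
    {α : E'.carrier →ₗ[O] E.carrier} {β : E.carrier →ₗ[O] E''.carrier}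
    (hsymm : ∀ y z, E.trForm y z = E.trForm z y)
    (horth : ∀ y, (∀ z, E.trForm y (realMap (α : E'.carrier →+ E.carrier) z) = 0) →
      ∀ z, E.h y (realMap (α : E'.carrier →+ E.carrier) z) = 0)
    (h : IsShortExact E' E E'' α β) : E.covol = E'.covol * E''.covol := by
  refine latDet_exact E'.trForm E.trForm E''.trForm hsymm (α : E'.carrier →+ E.carrier)
    (β : E.carrier →+ E''.carrier) h.injective h.surjective h.exact ?_ ?_ ?_
  · exact fun y z => congrArg (trReal K A) (h.isometry_left y z)
  · exact fun y z hy hz => congrArg (trReal K A) (h.isometry_right y z (horth y hy) (horth z hz))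
  · intro t
    obtain ⟨y, hy, ht⟩ := h.onto_right t
    exact ⟨y, fun z => by rw [trForm_apply, hy, map_zero], ht⟩

theorem IsShortExact.finrank_eq {E' E E'' : ArithBundle.{u, v, w, x} ι σ}
    {α : E'.carrier →ₗ[O] E.carrier} {β : E.carrier →ₗ[O] E''.carrier}
    (h : IsShortExact E' E E'' α β) : Module.finrank ℤ E.carrier =
      Module.finrank ℤ E'.carrier + Module.finrank ℤ E''.carrier := by
  let a := (α : E'.carrier →+ E.carrier).toIntLinearMap
  let b := (β : E.carrier →+ E''.carrier).toIntLinearMap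
  have h1 := Submodule.finrank_quotient_add_finrank (LinearMap.ker b)
  rw [(b.quotKerEquivOfSurjective h.surjective).finrank_eq,
    LinearMap.exact_iff.mp (show Function.Exact a b from h.exact),
    LinearMap.finrank_range_of_inj (f := a) h.injective] at h1
  omega

end ArithBundle

end General

theorem BaseBundle.trForm_comm (E : BaseBundle.{v, w} K) (y z) : E.trForm y z = E.trForm z y := by
  rw [ArithBundle.trForm_apply, ArithBundle.trForm_apply, E.h_conj y z, trReal_conj]

theorem realAlg_induction {O : Subalgebra (𝓞 K) A} (hO : IsOrder O) {p : RealAlg A → Prop}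
    (hadd : ∀ y z, p y → p z → p (y + z)) (h : ∀ (r : ℝ) (c : O), p (r • toReal (c : A)))
    (y : RealAlg A) : p y := by
  induction y using TensorProduct.induction_on with
  | zero => simpa using h 0 0
  | add y z hy hz => exact hadd y z hy hz
  | tmul r a =>
    obtain ⟨n, hn, ha⟩ := hO.exists_int_smul_mem a
    have h1 := h (r / n) ⟨n • a, ha⟩
    have hn' : (n : ℝ) ≠ 0 := Int.cast_ne_zero.mpr hn
    convert h1 using 1
    rw [toReal, TensorProduct.tmul_smul, ← Int.cast_smul_eq_zsmul ℝ, smul_smul,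
      div_mul_cancel₀ _ hn', TensorProduct.smul_tmul', smul_eq_mul, mul_one]

/-- O spans A_ℝ over ℝ, so the hypothesis extends to all of A_ℝ and contradicts positivity at y
itself. -/
theorem eq_zero_of_tr_mul {O : Subalgebra (𝓞 K) A} (hO : IsOrder O)
    {σ : RealAlg A →ₗ[ℝ] RealAlg A} (hσ : IsPositiveInvolution K σ) (y : RealAlg A)
    (h : ∀ c : O, trReal K A (y * σ (toReal (c : A))) = 0) : y = 0 := by
  have h1 : ∀ z, trReal K A (y * σ z) = 0 := by
    intro z
    induction z using realAlg_induction hO with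
    | hadd a b ha hb => rw [map_add, mul_add, map_add, ha, hb, add_zero]
    | h r c => rw [map_smul, mul_smul_comm, map_smul, h, smul_zero]
  by_contra hy
  exact (hσ.pos y hy).ne' (h1 y)

variable {O : Subalgebra (𝓞 K) A} {σ : RealAlg A →ₗ[ℝ] RealAlg A}

theorem IsOrder.finite_int (hO : IsOrder O) : Module.Finite ℤ O :=
  haveI : Module.Finite (𝓞 K) O := Module.Finite.iff_fg.mpr hO.fg
  Module.Finite.trans (𝓞 K) O

theorem IsOrder.free_int (hO : IsOrder O) : Module.Free ℤ O := by
  have := hO.finite_int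
  have : Module.IsTorsionFree ℤ O := .of_smul_eq_zero fun n z h => by
    by_cases hn : n = 0
    · exact Or.inl hn
    · exact Or.inr (Subtype.ext (zsmul_cancel (A := A) hn (congrArg Subtype.val h)))
  infer_instance

namespace ArithBundle

/-- The image of α is O-stable, so a vector orthogonal to it for tr ∘ h satisfies tr(h(y, z) c^*) =
0 for every c in O, and the trace form is nondegenerate. -/
theorem orthogonal_of_tr (hO : IsOrder O) (hσ : IsPositiveInvolution K σ)
    (E : ArithBundle.{u, v, w, u} O.val σ) {E' : Type*} [AddCommGroup E'] [Module O E']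
    (α : E' →ₗ[O] E.carrier) (y : RealSpace E.carrier)
    (h : ∀ z, E.trForm y (realMap (α : E' →+ E.carrier) z) = 0) (z) :
    E.h y (realMap (α : E' →+ E.carrier) z) = 0 := by
  apply eq_zero_of_tr_mul hO hσ
  intro c
  have h1 := h (realMap (DistribSMul.toAddMonoidHom E' c) z)
  rw [realMap_smul, trForm_apply, h_smul_right hσ] at h1
  exact h1

theorem orthogonal_of_trRealAlg (hO : IsOrder O) (hσ : IsPositiveInvolution K σ)
    (E : ArithBundle.{u, v, w, u} O.val σ) {E' : Type*} [AddCommGroup E'] [Module O E']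
    (α : E' →ₗ[O] E.carrier) (y : RealSpace E.carrier)
    (h : ∀ z, trRealAlg K A (E.h y (realMap (α : E' →+ E.carrier) z)) = 0) (z) :
    E.h y (realMap (α : E' →+ E.carrier) z) = 0 :=
  orthogonal_of_tr hO hσ E α y
    (fun t => by rw [trForm_apply, ← trReal_self_trRealAlg, h, map_zero]) z

theorem trForm_pushforward (hσ : IsPositiveInvolution K σ)
    (E : ArithBundle.{u, v, w, u} O.val σ) : (E.pushforward hσ).trForm = E.trForm := by
  ext y z
  exact trReal_self_trRealAlg _

theorem covol_pushforward (hσ : IsPositiveInvolution K σ)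
    (E : ArithBundle.{u, v, w, u} O.val σ) : (E.pushforward hσ).covol = E.covol :=
  congrArg latDet (trForm_pushforward hσ E)

theorem IsShortExact.pushforward (hO : IsOrder O) (hσ : IsPositiveInvolution K σ)
    {E' E E'' : ArithBundle.{u, v, w, u} O.val σ}
    {α : E'.carrier →ₗ[O] E.carrier} {β : E.carrier →ₗ[O] E''.carrier}
    (h : IsShortExact E' E E'' α β) :
    IsShortExact (E'.pushforward hσ) (E.pushforward hσ) (E''.pushforward hσ)
      (α.restrictScalars (𝓞 K)) (β.restrictScalars (𝓞 K)) where
  injective := h.injective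
  exact := h.exact
  surjective := h.surjective
  isometry_left y z := congrArg (trRealAlg K A) (h.isometry_left y z)
  isometry_right y z hy hz := congrArg (trRealAlg K A) (h.isometry_right y z
    (orthogonal_of_trRealAlg hO hσ E α y hy)
    (orthogonal_of_trRealAlg hO hσ E α z hz))
  onto_right t := by
    obtain ⟨y, hy, ht⟩ := h.onto_right t
    exact ⟨y, fun z => (congrArg (trRealAlg K A) (hy z)).trans (map_zero _), ht⟩

theorem Isomorphic.pushforward (hσ : IsPositiveInvolution K σ)
    {E E' : ArithBundle.{u, v, w, u} O.val σ} (h : Isomorphic E E') :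
    Isomorphic (E.pushforward hσ) (E'.pushforward hσ) := by
  obtain ⟨φ, hφ⟩ := h
  exact ⟨φ.restrictScalars (𝓞 K), fun y z => congrArg (trRealAlg K A) (hφ y z)⟩

theorem baseDegree_pushforward (hσ : IsPositiveInvolution K σ)
    (E : ArithBundle.{u, v, w, u} O.val σ) : baseDegree (E.pushforward hσ) =
      -(1 / 2) * Real.log E.covol + (Module.finrank ℤ E.carrier : ℝ) /
        (2 * Module.finrank ℤ (𝓞 K)) * Real.log |(discr K : ℝ)| := by
  rw [baseDegree_eq, covol_pushforward]
  rfl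

section Rank

variable [Nontrivial A] [IsSemisimpleRing A]

theorem exists_full (hO : IsOrder O) (E : ArithBundle.{u, v, w, u} O.val σ) :
    ∃ j : E.carrier →+ (Fin E.rank → A), IsFull j ∧
      ∀ (c : O) (z : E.carrier), j (c • z) = (c : A) • j z := by
  have := E.free
  have : Module.Finite A (BaseChange O.val.toRingHom E.carrier) := by
    have : Module.Finite A (A ⊗[ℤ] E.carrier) := Module.Finite.base_change ℤ A E.carrier
    infer_instance
  let b : Module.Basis (Fin E.rank) A _ := Module.finBasis A (BaseChange O.val.toRingHom E.carrier)
  have hj := isFull_toBaseChange (E := E.carrier) hO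
  refine ⟨(b.equivFun.toLinearMap.toAddMonoidHom).comp (toBaseChange O E.carrier), ⟨?_, ?_⟩, ?_⟩
  · exact b.equivFun.injective.comp hj.injective
  · intro v
    obtain ⟨n, hn, z, hz⟩ := hj.full (b.equivFun.symm v)
    refine ⟨n, hn, z, ?_⟩
    change b.equivFun _ = _
    rw [hz, map_zsmul, LinearEquiv.apply_symm_apply]
  · intro c z
    change b.equivFun _ = _ • b.equivFun _
    rw [toBaseChange_smul, map_smul]

/-- E and O^r are both full lattices in A^r. The A-rank is thereby expressed by the ℤ-rank, which is
visibly additive. -/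
theorem rank_mul (hO : IsOrder O) (E : ArithBundle.{u, u, w, u} O.val σ) :
    E.rank * Module.finrank ℤ O = Module.finrank ℤ E.carrier := by
  obtain ⟨j, hj, -⟩ := E.exists_full hO
  have := hO.finite_int
  have := hO.free_int
  have h1 := hj.rank_eq
  rw [← ((isFull_val hO).pi (ι := Fin E.rank)).rank_eq] at h1
  have h2 : Module.finrank ℤ E.carrier = Module.finrank ℤ (Fin E.rank → O) :=
    congrArg Cardinal.toNat h1
  rw [h2, Module.finrank_pi_fintype]
  simp

theorem _root_.NCArith.IsOrder.finrank_pos (hO : IsOrder O) : 0 < Module.finrank ℤ O := by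
  have := hO.finite_int
  have := hO.free_int
  exact Module.finrank_pos

end Rank

end ArithBundle

end Homs

/-! ### Cardinalities of finite modules -/

section FiniteSimple

/-- By faithfulness q ↦ (q s)_s embeds Q into a finite power of S. Hence Q is semisimple with one
isotypic component, that is, simple Artinian, and Wedderburn's theorem applies. -/
theorem exists_matrix_of_faithful_simple {Q : Type u} [Ring Q] [Finite Q] {S : Type v}
    [AddCommGroup S] [Finite S] [Module Q S] [IsSimpleModule Q S] [FaithfulSMul Q S] :
    ∃ (n : ℕ) (D : Type u) (_ : DivisionRing D), Nonempty (Q ≃+* Matrix (Fin n) (Fin n) D) := by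
  classical
  have := Fintype.ofFinite S
  let f : Q →ₗ[Q] (S → S) := LinearMap.pi fun s => LinearMap.toSpanSingleton Q S s
  have hf : Function.Injective f := fun a b h => FaithfulSMul.eq_of_smul_eq_smul (congrFun h)
  have hiso : IsIsotypicOfType Q (S → S) S := by
    apply IsIsotypicOfType.of_isotypicComponent_eq_top
    rw [eq_top_iff]
    intro y _
    rw [← Finset.univ_sum_single y]
    refine sum_mem fun s _ => ?_
    have hle : LinearMap.range (LinearMap.single Q (fun _ : S => S) s) ≤
        isotypicComponent Q (S → S) S :=
      le_sSup ⟨(LinearEquiv.ofInjective (LinearMap.single Q (fun _ : S => S) s)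
        (Pi.single_injective (M := fun _ : S => S) s)).symm⟩
    exact hle ⟨y s, rfl⟩
  have h1 : IsIsotypic Q Q := (hiso.of_injective f hf).isIsotypic
  have h2 : IsSemisimpleRing Q := IsSemisimpleModule.of_injective f hf
  have h3 : Nontrivial Q := by
    have := IsSimpleModule.nontrivial Q S
    exact Module.nontrivial Q S
  have h4 := isSimpleRing_isArtinianRing_iff.mpr ⟨h2, h1, h3⟩
  obtain ⟨_, _⟩ := h4
  obtain ⟨n, _, D, hD, e⟩ := IsSimpleRing.exists_ringEquiv_matrix_divisionRing Q
  exact ⟨n, D, hD, e⟩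

/-- A simple module is the space of columns D^n: a nonzero vector v fixed by some e_ii yields the
bijection d ↦ Σ e_ki(d_k) v. -/
theorem card_simple_matrix_module {n : ℕ} {D : Type u} [DivisionRing D] {S : Type v}
    [AddCommGroup S] [Module (Matrix (Fin n) (Fin n) D) S]
    [IsSimpleModule (Matrix (Fin n) (Fin n) D) S] : Nat.card S = Nat.card D ^ n := by
  classical
  have := IsSimpleModule.nontrivial (Matrix (Fin n) (Fin n) D) S
  obtain ⟨s, hs⟩ := exists_ne (0 : S)
  obtain ⟨i, hi⟩ : ∃ i : Fin n, Matrix.single i i (1 : D) • s ≠ 0 := by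
    by_contra! h
    apply hs
    rw [← one_smul (Matrix (Fin n) (Fin n) D) s, ← Matrix.sum_single_one, Finset.sum_smul]
    exact Finset.sum_eq_zero fun i _ => h i
  set v := Matrix.single i i (1 : D) • s with hv
  have hvi : Matrix.single i i (1 : D) • v = v := by rw [hv, smul_smul]; simp
  let φ : (Fin n → D) → S := fun d => (∑ k, Matrix.single k i (d k)) • v
  have hφ : ∀ d, φ d = ∑ k, Matrix.single k i (d k) • v := fun d => Finset.sum_smul
  have hinj : Function.Injective φ := by
    intro d d' h
    by_contra hne
    obtain ⟨k, hk⟩ := Function.ne_iff.mp hne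
    have h1 : ∑ k, Matrix.single k i (d k - d' k) • v = 0 := by
      rw [hφ, hφ, ← sub_eq_zero, ← Finset.sum_sub_distrib] at h
      rw [← h]
      refine Finset.sum_congr rfl fun k _ => ?_
      rw [← sub_smul]
      congr 1
      ext a b
      by_cases hab : k = a ∧ i = b <;> simp [hab]
    -- Multiplication by e_ik with the inverse of the k-th coefficient annihilates all other terms
    -- and leaves v = 0.
    have h2 := congrArg (fun t => Matrix.single i k (d k - d' k)⁻¹ • t) h1
    simp only [Finset.smul_sum, smul_zero, smul_smul] at h2
    rw [Finset.sum_eq_single k] at h2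
    · rw [Matrix.single_mul_single_same, inv_mul_cancel₀ (sub_ne_zero.mpr hk), hvi] at h2
      exact hi h2
    · intro l _ hl
      rw [Matrix.single_mul_single_of_ne _ _ _ _ hl.symm, zero_smul]
    · simp
  have hsurj : Function.Surjective φ := by
    intro t
    obtain ⟨m, rfl⟩ := IsSimpleModule.toSpanSingleton_surjective (Matrix (Fin n) (Fin n) D) hi t
    -- Since v = e_ii v, the vector m v depends only on the i-th column of m.
    refine ⟨fun k => m k i, ?_⟩
    change _ = m • v
    rw [← hvi, smul_smul]
    change _ • _ = _
    rw [← hvi, smul_smul, hvi]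
    congr 1
    ext a b
    rw [Matrix.sum_mul, Matrix.sum_apply]
    by_cases hb : b = i
    · subst hb
      simp [Matrix.single_apply]
    · rw [Matrix.mul_single_apply_of_ne _ _ _ _ _ hb]
      exact Finset.sum_eq_zero fun k _ => Matrix.mul_single_apply_of_ne _ _ _ _ _ hb _
  rw [← Nat.card_congr (Equiv.ofBijective φ ⟨hinj, hsurj⟩), Nat.card_pi]
  simp

end FiniteSimple

/-! ### Orders of finite modules at prime ideals -/

section OrdCard

variable {K : Type w} [Field K] [NumberField K] {A : Type u} [Ring A] [Algebra K A] [Algebra ℚ A]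

theorem isSimpleModule_of_smul {R : Type*} {R' : Type*} [Ring R] [Ring R'] {S : Type*}
    [AddCommGroup S] [Module R S] [Module R' S] [IsSimpleModule R S] (f : R → R')
    (hf : ∀ (r : R) (s : S), f r • s = r • s) : IsSimpleModule R' S := by
  rw [isSimpleModule_iff_toSpanSingleton_surjective]
  refine ⟨IsSimpleModule.nontrivial R S, fun s hs t => ?_⟩
  obtain ⟨r, rfl⟩ := IsSimpleModule.toSpanSingleton_surjective R hs t
  exact ⟨f r, hf r s⟩

/-- S is a faithful simple module over O/p, so O/p is a matrix ring over some D of size κ. Then #S =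
#D^κ and N(p) = #D^(κ²). -/
theorem log_card_simple {O : Subalgebra (𝓞 K) A} (p : PrimeIdeal O) {S : Type v} [AddCommGroup S]
    [Module O S] [Finite S] [IsSimpleModule O S] (hp : ∀ c : O, c ∈ p.ideal ↔ ∀ s : S, c • s = 0) :
    Real.log (Nat.card S) = 1 / p.capacity * Real.log p.absNorm := by
  let Q := p.ideal.ringCon.Quotient
  let ρ : O →+* AddMonoid.End S := Module.toAddMonoidEnd O S
  have hρ : ∀ a b : O, p.ideal.ringCon a b ↔ ρ a = ρ b := by
    intro a b
    rw [TwoSidedIdeal.rel_iff, hp]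
    constructor
    · intro h
      ext s
      have := h s
      rwa [sub_smul, sub_eq_zero] at this
    · intro h s
      rw [sub_smul, sub_eq_zero]
      exact DFunLike.congr_fun h s
  let ρ' : Q →+* AddMonoid.End S := RingCon.lift p.ideal.ringCon ρ fun a b h => (hρ a b).mp h
  have hinj : Function.Injective ρ' := by
    intro a b
    induction a using Quotient.inductionOn' with
    | h a =>
      induction b using Quotient.inductionOn' with
      | h b => exact fun h => (RingCon.eq _).mpr ((hρ a b).mpr h)
  have hfinE : Finite (AddMonoid.End S) := DFunLike.finite _
  have hfin : Finite Q := Finite.of_injective ρ' hinj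
  let : Module Q S := Module.compHom S ρ'
  have hQ : IsSimpleModule Q S := isSimpleModule_of_smul (R := O)
    (fun c => (p.ideal.ringCon.mk' c : Q)) fun c s => rfl
  have hfaith : FaithfulSMul Q S := ⟨fun {a b} h => hinj (AddMonoidHom.ext h)⟩
  have hex : ∃ (n : ℕ) (D : Type u) (_ : DivisionRing D),
      Nonempty (Q ≃+* Matrix (Fin n) (Fin n) D) := exists_matrix_of_faithful_simple (S := S)
  -- The existence just shown excludes the default value of `capacity`. Uniqueness of the matrix
  -- size is not needed: the count works for whichever presentation is chosen.
  have hcap : p.capacity = hex.choose := dif_pos hex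
  obtain ⟨D, hD, ⟨e⟩⟩ := hex.choose_spec
  rw [← hcap] at e
  set n := p.capacity
  let : Module (Matrix (Fin n) (Fin n) D) S := Module.compHom S (e.symm : _ →+* Q)
  have hM : IsSimpleModule (Matrix (Fin n) (Fin n) D) S := isSimpleModule_of_smul (R := Q) e
    fun c s => by
      change e.symm (e c) • s = c • s
      rw [e.symm_apply_apply]
  have h1 : Nat.card S = Nat.card D ^ n := card_simple_matrix_module
  have h2 : p.absNorm = Nat.card D ^ (n * n) := by
    rw [PrimeIdeal.absNorm, Nat.card_congr e.toEquiv, Matrix, Nat.card_pi, Finset.prod_const,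
      Nat.card_pi, Finset.prod_const, Finset.card_univ, Fintype.card_fin, pow_mul]
  rw [h1, h2]
  push_cast
  rw [Real.log_pow, Real.log_pow]
  by_cases hn : n = 0
  · simp [hn]
  · have : (n : ℝ) ≠ 0 := Nat.cast_ne_zero.mpr hn
    push_cast
    field_simp

/-- The annihilator is prime because every nonzero vector generates S, and it is full because S is
finite. -/
theorem exists_primeIdeal_of_simple (O : Subalgebra (𝓞 K) A) (S : Type v) [AddCommGroup S]
    [Module O S] [Finite S] [IsSimpleModule O S] :
    ∃ p : PrimeIdeal O, ∀ c : O, c ∈ p.ideal ↔ ∀ s : S, c • s = 0 := by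
  have hnt := IsSimpleModule.nontrivial O S
  obtain ⟨s₀, hs₀⟩ := exists_ne (0 : S)
  let I := TwoSidedIdeal.ker (Module.toAddMonoidEnd O S)
  have hI : ∀ c, c ∈ I ↔ ∀ s : S, c • s = 0 := fun c => by
    rw [TwoSidedIdeal.mem_ker]
    exact DFunLike.ext_iff
  refine ⟨⟨I, ?_, ?_, ?_⟩, hI⟩
  · intro htop
    have h1 : (1 : O) ∈ I := htop ▸ trivial
    exact hs₀ (by simpa using (hI 1).mp h1 s₀)
  · refine ⟨(Nat.card S : ℕ), by exact_mod_cast Nat.card_pos.ne', ?_⟩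
    rw [hI]
    intro s
    rw [map_natCast, Nat.cast_smul_eq_nsmul, card_nsmul_eq_zero']
  · intro a b ha hb
    rw [hI] at ha hb
    push Not at ha hb
    obtain ⟨s, hs⟩ := ha
    obtain ⟨t, ht⟩ := hb
    -- With b t ≠ 0 and a s ≠ 0, simplicity gives c with c b t = s, so a c b does not kill t.
    obtain ⟨c, hc⟩ := IsSimpleModule.toSpanSingleton_surjective O ht s
    refine ⟨c, fun hmem => hs ?_⟩
    have := (hI _).mp hmem t
    rw [mul_smul, mul_smul] at this
    rw [← hc]
    exact this

section Series

variable {O : Type x} [Ring O] {M : Type v} [AddCommGroup M] [Module O M]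

theorem log_card_series [Finite M] (s : CompositionSeries (Submodule O M)) (h0 : s.head = ⊥)
    (h1 : s.last = ⊤) : Real.log (Nat.card M) = ∑ i : Fin s.length,
      Real.log (Nat.card (s i.succ ⧸ Submodule.comap (s i.succ).subtype (s i.castSucc))) := by
  have hfin : ∀ i : Fin s.length,
      Finite (s i.succ ⧸ Submodule.comap (s i.succ).subtype (s i.castSucc)) :=
    fun i => Finite.of_surjective _ (Submodule.Quotient.mk_surjective _)
  have hcard : ∀ i : Fin s.length,
      Real.log (Nat.card (s i.succ ⧸ Submodule.comap (s i.succ).subtype (s i.castSucc))) =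
        Real.log (Nat.card (s i.succ)) - Real.log (Nat.card (s i.castSucc)) := by
    intro i
    have hle : s i.castSucc ≤ s i.succ := (s.step i).le
    have h2 := Submodule.card_eq_card_quotient_mul_card
      (Submodule.comap (s i.succ).subtype (s i.castSucc))
    rw [Nat.card_congr (Submodule.comapSubtypeEquivOfLe hle).toEquiv] at h2
    rw [h2, Nat.cast_mul, Real.log_mul (by exact_mod_cast Nat.card_pos.ne')
      (by exact_mod_cast Nat.card_pos.ne')]
    ring
  simp only [hcard]
  -- The logarithms of the orders of the members of the series, extended by 0 to all of ℕ, so that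
  -- the sum telescopes.
  let f : ℕ → ℝ := fun k => if h : k < s.length + 1 then Real.log (Nat.card (s ⟨k, h⟩)) else 0
  have hf : ∀ i : Fin s.length, Real.log (Nat.card (s i.succ)) - Real.log (Nat.card (s i.castSucc)) =
      f (i + 1) - f i := by
    intro i
    have h3 : (i : ℕ) < s.length + 1 := by omega
    have h4 : (i : ℕ) + 1 < s.length + 1 := by omega
    simp only [f, dif_pos h3, dif_pos h4]
    rfl
  rw [Finset.sum_congr rfl fun i _ => hf i, Fin.sum_univ_eq_sum_range (fun k => f (k + 1) - f k),
    Finset.sum_range_sub]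
  have h5 : f s.length = Real.log (Nat.card M) := by
    simp only [f, dif_pos (Nat.lt_succ_self _)]
    change Real.log (Nat.card s.last) = _
    rw [h1]
    rw [Nat.card_congr (Submodule.topEquiv (R := O) (M := M)).toEquiv]
  have h6 : f 0 = 0 := by
    simp only [f, dif_pos (Nat.succ_pos _)]
    change Real.log (Nat.card s.head) = _
    rw [h0]
    simp
  rw [h5, h6, sub_zero]

end Series

/-- The contribution `log N(p) / κ_p` of a prime ideal to the degree. -/
def PrimeIdeal.weight {O : Subalgebra (𝓞 K) A} (p : PrimeIdeal O) : ℝ :=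
  1 / p.capacity * Real.log p.absNorm

theorem PrimeIdeal.ext_coe {O : Subalgebra (𝓞 K) A} {p q : PrimeIdeal O}
    (h : (p.ideal : Set O) = q.ideal) : p = q := by
  have := SetLike.coe_injective h
  cases p; cases q; cases this; rfl

/-- Each factor of a composition series contributes the weight of its annihilator; grouping the
factors by annihilator gives the multiplicities `ordModule`. The finite set is allowed to be
flexible so that the sums for two modules can be taken over a common one. -/
theorem log_card_eq_sum {O : Subalgebra (𝓞 K) A} (M : Type v) [AddCommGroup M] [Module O M]
    [Finite M] : ∃ T : Finset (PrimeIdeal O), (∀ p, ordModule p.ideal M ≠ 0 → p ∈ T) ∧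
      Real.log (Nat.card M) = ∑ p ∈ T, (ordModule p.ideal M : ℝ) * p.weight := by
  classical
  have hN : IsNoetherian O M := inferInstance
  have hA : IsArtinian O M := inferInstance
  have hex : ∃ s : CompositionSeries (Submodule O M), s.head = ⊥ ∧ s.last = ⊤ :=
    exists_compositionSeries_of_isNoetherian_isArtinian O M
  obtain ⟨h0, h1⟩ := hex.choose_spec
  have hord : ∀ p : TwoSidedIdeal O, ordModule p M =
      Nat.card {i : Fin hex.choose.length // factorAnn hex.choose i = (p : Set O)} :=
    fun p => dif_pos hex
  set s := hex.choose
  have hsimple : ∀ i : Fin s.length,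
      IsSimpleModule O (s i.succ ⧸ Submodule.comap (s i.succ).subtype (s i.castSucc)) :=
    fun i => (covBy_iff_quot_is_simple (s.step i).le).mp (s.step i)
  have hfin : ∀ i : Fin s.length,
      Finite (s i.succ ⧸ Submodule.comap (s i.succ).subtype (s i.castSucc)) :=
    fun i => Finite.of_surjective _ (Submodule.Quotient.mk_surjective _)
  choose P hP using fun i : Fin s.length => exists_primeIdeal_of_simple O
    (s i.succ ⧸ Submodule.comap (s i.succ).subtype (s i.castSucc))
  have hann : ∀ i, factorAnn s i = ((P i).ideal : Set O) := by
    intro i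
    ext c
    rw [SetLike.mem_coe, hP]
    constructor
    · intro h y
      obtain ⟨m, rfl⟩ := Submodule.Quotient.mk_surjective _ y
      rw [← Submodule.Quotient.mk_smul, Submodule.Quotient.mk_eq_zero]
      exact h m m.2
    · intro h m hm
      have := h (Submodule.Quotient.mk ⟨m, hm⟩)
      rw [← Submodule.Quotient.mk_smul, Submodule.Quotient.mk_eq_zero] at this
      exact this
  have hcount : ∀ p : PrimeIdeal O, ordModule p.ideal M =
      (Finset.univ.filter fun i => P i = p).card := by
    intro p
    rw [hord, Nat.card_eq_fintype_card, Fintype.card_subtype]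
    congr 1
    ext i
    simp only [Finset.mem_filter, Finset.mem_univ, true_and, hann]
    exact ⟨fun h => PrimeIdeal.ext_coe h, fun h => by rw [h]⟩
  refine ⟨Finset.univ.image P, fun p hp => ?_, ?_⟩
  · rw [hcount, Finset.card_ne_zero] at hp
    obtain ⟨i, hi⟩ := hp
    exact Finset.mem_image.mpr ⟨i, Finset.mem_univ i, (Finset.mem_filter.mp hi).2⟩
  · rw [log_card_series s h0 h1]
    have h2 : ∀ i, Real.log (Nat.card (s i.succ ⧸
        Submodule.comap (s i.succ).subtype (s i.castSucc))) = (P i).weight := fun i =>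
      log_card_simple (P i) (hP i)
    rw [Finset.sum_congr rfl fun i _ => h2 i, Finset.sum_comp]
    refine Finset.sum_congr rfl fun p _ => ?_
    rw [hcount, nsmul_eq_mul]

end OrdCard

/-! ### The lattice determinant of the line bundle of a complete ideal -/

section LineBundleDegree

variable {K : Type w} [Field K] [NumberField K] {A : Type u} [Ring A] [Algebra K A] [Algebra ℚ A]
variable {O : Subalgebra (𝓞 K) A}

theorem FullIdeal.exists_int_smul_mem (a : FullIdeal O) (b : A) :
    ∃ n : ℤ, n ≠ 0 ∧ n • b ∈ a.ideal := by
  have hb : b ∈ Submodule.span K (a.ideal : Set A) := a.span_eq_top ▸ Submodule.mem_top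
  induction hb using Submodule.span_induction with
  | mem y hy => exact ⟨1, one_ne_zero, by rwa [one_smul]⟩
  | zero => exact ⟨1, one_ne_zero, by rw [smul_zero]; exact zero_mem _⟩
  | add y z _ _ hy hz =>
    obtain ⟨n, hn, hy⟩ := hy
    obtain ⟨m, hm, hz⟩ := hz
    refine ⟨n * m, mul_ne_zero hn hm, ?_⟩
    rw [smul_add]
    refine add_mem ?_ ?_
    · rw [mul_comm, mul_smul]; exact zsmul_mem hy m
    · rw [mul_smul]; exact zsmul_mem hz n
  | smul k y _ hy =>
    obtain ⟨n, hn, hy⟩ := hy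
    -- Denominators in K can be taken to be rational integers.
    obtain ⟨⟨c, m⟩, hk⟩ :=
      IsLocalization.surj (Algebra.algebraMapSubmonoid (𝓞 K) (nonZeroDivisors ℤ)) k
    obtain ⟨m', hm', hmm⟩ := m.2
    refine ⟨m' * n, mul_ne_zero (nonZeroDivisors.ne_zero hm') hn, ?_⟩
    have h1 : (m' : ℤ) • k = algebraMap (𝓞 K) K c := by
      rw [← hk]
      simp [← hmm, mul_comm]
    have h2 : (m' * n) • k • y = algebraMap (𝓞 K) O c • (n • y) := by
      rw [mul_comm, mul_smul, ← smul_assoc m', h1, algebraMap_smul, algebraMap_smul, smul_comm]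
    rw [h2]
    exact a.ideal.smul_mem _ hy

theorem FullIdeal.isFull (a : FullIdeal O) : IsFull (a.ideal.subtype : a.ideal →+ A) where
  injective := Subtype.val_injective
  full b := by
    obtain ⟨n, hn, h⟩ := a.exists_int_smul_mem b
    exact ⟨n, hn, ⟨n • b, h⟩, rfl⟩

theorem IsFull.real_induction {E : Type*} [AddCommGroup E] {j : E →+ A} (hj : IsFull j)
    {p : RealAlg A → Prop} (hadd : ∀ y z, p y → p z → p (y + z))
    (h : ∀ (r : ℝ) (c : E), p (r ⊗ₜ j c)) (y : RealAlg A) : p y := by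
  induction y using TensorProduct.induction_on with
  | zero => simpa using h 0 0
  | add y z hy hz => exact hadd y z hy hz
  | tmul r a =>
    obtain ⟨n, hn, c, hc⟩ := hj.full a
    have hn' : (n : ℝ) ≠ 0 := Int.cast_ne_zero.mpr hn
    have h1 := h (r / n) c
    rwa [hc, TensorProduct.tmul_smul, ← Int.cast_smul_eq_zsmul ℝ, TensorProduct.smul_tmul',
      smul_eq_mul, mul_div_cancel₀ _ hn'] at h1

theorem FullIdeal.realEmb_bijective (a : FullIdeal O) : Function.Bijective a.realEmb := by
  refine ⟨a.realEmb_injective, fun y => ?_⟩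
  induction y using a.isFull.real_induction with
  | hadd y z hy hz =>
    obtain ⟨s, rfl⟩ := hy
    obtain ⟨t, rfl⟩ := hz
    exact ⟨s + t, map_add _ _ _⟩
  | h r c => exact ⟨r ⊗ₜ c, a.realEmb_tmul r c⟩

/-- The identification `a_ℝ = A_ℝ`. -/
def FullIdeal.realEquiv (a : FullIdeal O) : RealSpace a.ideal ≃ₗ[ℝ] RealAlg A :=
  LinearEquiv.ofBijective a.realEmb a.realEmb_bijective

/-- The basis of `A_ℝ` given by a `ℤ`-basis of a full ideal. -/
def FullIdeal.toRealBasis (a : FullIdeal O) {ι : Type*} (b : Module.Basis ι ℤ a.ideal) :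
    Module.Basis ι ℝ (RealAlg A) := (b.baseChange ℝ).map a.realEquiv

theorem FullIdeal.toRealBasis_apply (a : FullIdeal O) {ι : Type*} (b : Module.Basis ι ℤ a.ideal)
    (i : ι) : a.toRealBasis b i = toReal (b i : A) := by
  rw [toRealBasis, Module.Basis.map_apply, Module.Basis.baseChange_apply]
  exact a.realEmb_tmul 1 (b i)

variable (K) in
/-- The twisted trace form `(x, y) ↦ tr(x y^*)` on `A_ℝ`. -/
def twistedForm (σ : RealAlg A →ₗ[ℝ] RealAlg A) : RealAlg A →ₗ[ℝ] RealAlg A →ₗ[ℝ] ℝ :=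
  (trMul K A).compl₂ σ

theorem twistedForm_apply (σ : RealAlg A →ₗ[ℝ] RealAlg A) (x y : RealAlg A) :
    twistedForm K σ x y = trReal K A (x * σ y) := rfl

section

variable {σ : RealAlg A →ₗ[ℝ] RealAlg A}

/-- The metric of L(a) is tr((x a_∞)(y a_∞)^*), the twisted form pulled back by right multiplication
by a_∞, whose determinant is the norm of a_∞. -/
theorem lineBundle_covol_eq (hO : IsOrder O) (hσ : IsPositiveInvolution K σ) (a : CompleteIdeal O)
    {ι : Type*} [Fintype ι] [DecidableEq ι] (b : Module.Basis ι ℤ a.ideal) :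
    (lineBundle hO hσ a).covol = normReal (a.infty : RealAlg A) ^ 2 *
      (gram (twistedForm K σ) fun i => toReal (b i : A)).det := by
  let b' : Module.Basis ι ℤ (lineBundle hO hσ a).carrier := b
  have h1 : (gram (lineBundle hO hσ a).trForm fun i => (1 : ℝ) ⊗ₜ[ℤ] b' i) =
      gram (twistedForm K σ) fun i =>
        LinearMap.mulRight ℝ (a.infty : RealAlg A) (a.toRealBasis b i) := by
    ext i j
    simp only [gram, Matrix.of_apply, twistedForm_apply, LinearMap.mulRight_apply, hσ.map_mul,
      FullIdeal.toRealBasis_apply]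
    change trReal K A (a.realEmb ((1 : ℝ) ⊗ₜ[ℤ] b i) * (a.infty * σ a.infty) *
      σ (a.realEmb ((1 : ℝ) ⊗ₜ[ℤ] b j))) = _
    rw [a.realEmb_tmul, a.realEmb_tmul]
    simp only [mul_assoc]
  have h2 : (lineBundle hO hσ a).covol = _ := latDet_eq _ b'
  rw [h2, h1, det_gram_linearMap, normReal, funext (a.toRealBasis_apply b)]

theorem FullIdeal.exists_scale (hO : IsOrder O) (a : FullIdeal O) :
    ∃ r : 𝓞 K, r ≠ 0 ∧ ∀ y ∈ a.ideal, y * algebraMap (𝓞 K) A r ∈ O := by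
  obtain ⟨S, hS⟩ := a.fg
  choose n hn hnO using hO.exists_int_smul_mem
  refine ⟨((∏ g ∈ S, n g : ℤ) : 𝓞 K), by
    exact_mod_cast Finset.prod_ne_zero_iff.mpr fun g _ => hn g, fun y hy => ?_⟩
  have hy' : y ∈ Submodule.span (𝓞 K) (S : Set A) := hS ▸ hy
  clear hy
  -- The scaling factor is a rational integer, a common denominator of the generators. Being
  -- central, it acts compatibly with the R-span.
  rw [map_intCast, ← Int.cast_comm, ← zsmul_eq_mul]
  induction hy' using Submodule.span_induction with
  | mem g hg =>
    classical
    rw [← Finset.prod_erase_mul _ _ hg, mul_smul]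
    exact O.zsmul_mem (hnO g) _
  | zero => rw [smul_zero]; exact O.zero_mem
  | add y z hy hz ihy ihz =>
    rw [smul_add]
    exact O.add_mem ihy ihz
  | smul k y hy ihy =>
    rw [smul_comm]
    exact O.smul_mem ihy k

theorem FullIdeal.scale_spec (hO : IsOrder O) (a : FullIdeal O) :
    a.scale ≠ 0 ∧ ∀ y ∈ a.ideal, y * algebraMap (𝓞 K) A a.scale ∈ O := by
  have h := a.exists_scale hO
  have h1 : a.scale = h.choose := dif_pos h
  rw [h1]
  exact h.choose_spec

theorem FullIdeal.finite_quotient_scaled (hO : IsOrder O) (a : FullIdeal O) {r : 𝓞 K}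
    (hr : r ≠ 0) : Finite (O ⧸ a.scaled r) := by
  have := hO.finite_int
  have hfin : Module.Finite ℤ (O ⧸ a.scaled r) :=
    Module.Finite.of_surjective (a.scaled r).mkQ.toAddMonoidHom.toIntLinearMap
      fun y => Submodule.Quotient.mk_surjective _ y
  apply Module.finite_of_fg_torsion
  intro y
  obtain ⟨c, rfl⟩ := Submodule.Quotient.mk_surjective _ y
  obtain ⟨n, hn, h1⟩ := a.exists_int_smul_mem 1
  obtain ⟨m, s, hm, hs⟩ := exists_int_multiple r hr
  -- With n in a and m = s r, the element m n c = (c s n) r lies in a r.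
  refine ⟨⟨m * n, mem_nonZeroDivisors_of_ne_zero (mul_ne_zero hm hn)⟩, ?_⟩
  change (m * n) • (Submodule.Quotient.mk c : O ⧸ a.scaled r) = 0
  rw [← Submodule.Quotient.mk_smul, Submodule.Quotient.mk_eq_zero]
  refine ⟨(c * algebraMap (𝓞 K) O s) • (n • (1 : A)), a.ideal.smul_mem _ h1, ?_⟩
  have h2 : (algebraMap (𝓞 K) A s) * algebraMap (𝓞 K) A r = (m : A) := by
    rw [← map_mul, ← hs, map_intCast]
  have h3 : ((c * algebraMap (𝓞 K) O s) • (n • (1 : A))) = n • ((c : A) * algebraMap (𝓞 K) A s) := by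
    rw [smul_comm, Subalgebra.smul_def, smul_eq_mul, mul_one]
    rfl
  rw [h3, smul_mul_assoc, mul_assoc, h2]
  change (m * n) • (c : A) = _
  rw [mul_comm, mul_smul, zsmul_eq_mul (c : A) m, Int.cast_comm]

/-- Right multiplication by `r` as an isomorphism of `a` with `a r`. -/
def FullIdeal.scaledEquiv (a : FullIdeal O) {r : 𝓞 K} (hr : r ≠ 0)
    (h : ∀ y ∈ a.ideal, y * algebraMap (𝓞 K) A r ∈ O) : a.ideal ≃+ (a.scaled r).toAddSubgroup :=
  AddEquiv.ofBijective (M := a.ideal) (N := (a.scaled r).toAddSubgroup)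
    ({ toFun := fun y => ⟨⟨y * algebraMap (𝓞 K) A r, h y y.2⟩, ⟨y, y.2, rfl⟩⟩
       map_zero' := Subtype.ext (Subtype.ext (zero_mul _))
       map_add' := fun y z => Subtype.ext (Subtype.ext (add_mul _ _ _)) } : a.ideal →+ _) (by
    constructor
    · rw [injective_iff_map_eq_zero]
      intro y hy
      have h1 : (y : A) * algebraMap (𝓞 K) A r = 0 :=
        congrArg (fun t : (a.scaled r).toAddSubgroup => ((t : O) : A)) hy
      have h2 : r • y = 0 := Subtype.ext (by
        rw [← Algebra.commutes, ← Algebra.smul_def] at h1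
        exact h1)
      exact (a.torsionFree r y h2).resolve_left hr
    · rintro ⟨c, y, hy, hc⟩
      exact ⟨⟨y, hy⟩, Subtype.ext (Subtype.ext hc.symm)⟩)

/-- The identification of `O_ℝ` with `A_ℝ`. -/
def orderRealMap (O : Subalgebra (𝓞 K) A) : RealSpace O →ₗ[ℝ] RealAlg A :=
  LinearMap.liftBaseChange ℝ
    ((((Algebra.TensorProduct.includeRight : A →ₐ[ℚ] RealAlg A) : A →+ RealAlg A).comp
      (O.val : O →+ A)).toIntLinearMap)

theorem orderRealMap_one_tmul (c : O) : orderRealMap O ((1 : ℝ) ⊗ₜ c) = toReal (c : A) := by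
  simp [orderRealMap]

/-- The Gram determinant of a r is computed twice: as the image of a under right multiplication by
r, and as a sublattice of O of index #(O/ar). -/
theorem FullIdeal.norm_sq_mul_gram (hO : IsOrder O) (a : FullIdeal O) {r : 𝓞 K} (hr : r ≠ 0)
    (h : ∀ y ∈ a.ideal, y * algebraMap (𝓞 K) A r ∈ O)
    {ι : Type*} [Fintype ι] [DecidableEq ι] (b : Module.Basis ι ℤ a.ideal) :
    haveI := hO.finite_int
    haveI := hO.free_int
    normReal (toReal (algebraMap (𝓞 K) A r)) ^ 2 *
      (gram (twistedForm K σ) fun i => toReal (b i : A)).det =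
    (Nat.card (O ⧸ a.scaled r) : ℝ) ^ 2 *
      latDet ((twistedForm K σ).compl₁₂ (orderRealMap O) (orderRealMap O)) := by
  have := hO.finite_int
  have := hO.free_int
  have hfin := a.finite_quotient_scaled hO hr
  have hfin' : Finite (O ⧸ (a.scaled r).toAddSubgroup) := hfin
  have h1 := det_gram_sublattice ((twistedForm K σ).compl₁₂ (orderRealMap O) (orderRealMap O))
    (a.scaled r).toAddSubgroup (b.map (a.scaledEquiv hr h).toIntLinearEquiv)
    (finrank_eq_of_finite_quotient _)
  have h2 : (gram ((twistedForm K σ).compl₁₂ (orderRealMap O) (orderRealMap O)) fun i =>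
      (1 : ℝ) ⊗ₜ[ℤ] ((b.map (a.scaledEquiv hr h).toIntLinearEquiv) i : O)) =
      gram (twistedForm K σ) fun i =>
        LinearMap.mulRight ℝ (toReal (algebraMap (𝓞 K) A r)) (a.toRealBasis b i) := by
    ext i j
    simp only [gram, Matrix.of_apply, LinearMap.compl₁₂_apply, orderRealMap_one_tmul,
      LinearMap.mulRight_apply, FullIdeal.toRealBasis_apply, Algebra.TensorProduct.tmul_mul_tmul,
      one_mul]
    rfl
  rw [h2, det_gram_linearMap, funext (a.toRealBasis_apply b)] at h1
  exact h1

theorem unitIdeal_scaled (hO : IsOrder O) (r : 𝓞 K) :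
    (unitIdeal hO).scaled r = Submodule.span O {algebraMap (𝓞 K) O r} := by
  ext c
  rw [Submodule.mem_span_singleton]
  constructor
  · rintro ⟨y, hy, hc⟩
    exact ⟨⟨y, hy⟩, Subtype.ext hc.symm⟩
  · rintro ⟨y, rfl⟩
    exact ⟨y, y.2, rfl⟩

end

end LineBundleDegree

/-! ### The degree of the divisor of a complete ideal as a ratio of covolumes. -/

section DegreeFormula

variable {K : Type w} [Field K] [NumberField K] {A : Type u} [Ring A] [Algebra K A] [Algebra ℚ A]
variable {O : Subalgebra (𝓞 K) A} {σ : RealAlg A →ₗ[ℝ] RealAlg A}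

/-- The counting formula is applied to O/ar and O/Or, both summed over the union of the two finite
sets of primes; the sign in the divisor puts #(O/Or) in front. -/
theorem CompleteIdeal.deg_div (hO : IsOrder O) (a : CompleteIdeal O) : a.div.deg =
    Real.log (Nat.card (O ⧸ (unitIdeal hO).scaled a.scale)) -
      Real.log (Nat.card (O ⧸ a.scaled a.scale)) - Real.log |normReal (a.infty : RealAlg A)| := by
  classical
  have hr := (a.scale_spec hO).1
  have := a.finite_quotient_scaled hO hr
  have := (unitIdeal hO).finite_quotient_scaled hO hr
  obtain ⟨T₁, hT₁, h₁⟩ := log_card_eq_sum (O := O) (O ⧸ a.scaled a.scale)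
  obtain ⟨T₂, hT₂, h₂⟩ := log_card_eq_sum (O := O) (O ⧸ (unitIdeal hO).scaled a.scale)
  have hext : ∀ (M : Submodule O O) (T T' : Finset (PrimeIdeal O)), T ⊆ T' →
      (∀ p : PrimeIdeal O, ordModule p.ideal (O ⧸ M) ≠ 0 → p ∈ T) →
      ∑ p ∈ T, (ordModule p.ideal (O ⧸ M) : ℝ) * p.weight =
        ∑ p ∈ T', (ordModule p.ideal (O ⧸ M) : ℝ) * p.weight := by
    intro M T T' hTT hT
    refine Finset.sum_subset hTT fun p _ hp => ?_
    rw [not_not.mp (mt (hT p) hp), Nat.cast_zero, zero_mul]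
  rw [h₁, h₂, hext _ _ _ Finset.subset_union_left hT₁,
    hext _ _ _ (Finset.subset_union_right (s₁ := T₁)) hT₂, ← Finset.sum_sub_distrib]
  have hord : ∀ p : PrimeIdeal O, a.div.1 p =
      (ordModule p.ideal (O ⧸ (unitIdeal hO).scaled a.scale) : ℤ) -
        (ordModule p.ideal (O ⧸ a.scaled a.scale) : ℤ) := by
    intro p
    change -a.ord p = _
    rw [FullIdeal.ord, ← unitIdeal_scaled hO]
    ring
  have hsupp : a.div.1.support ⊆ T₁ ∪ T₂ := by
    intro p hp
    rw [Finsupp.mem_support_iff, hord] at hp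
    by_contra hcon
    rw [Finset.mem_union, not_or] at hcon
    rw [not_not.mp (mt (hT₁ p) hcon.1), not_not.mp (mt (hT₂ p) hcon.2)] at hp
    exact hp (sub_self _)
  change (a.div.1.sum fun p v => (v : ℝ) / p.capacity * Real.log p.absNorm) - _ = _
  rw [Finsupp.sum_of_support_subset _ hsupp _ (fun p _ => by simp)]
  congr 1
  refine Finset.sum_congr rfl fun p _ => ?_
  rw [hord, PrimeIdeal.weight]
  push_cast
  ring

/-- Comparing `norm_sq_mul_gram` for a and for O with the same r, the norm of r cancels and the Gram
determinants are in the ratio of the squared indices. The norm of a_∞ is the remaining factor. -/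
theorem log_covol_lineBundle (hO : IsOrder O) (hσ : IsPositiveInvolution K σ)
    (a : CompleteIdeal O) : -(1 / 2) * Real.log (lineBundle hO hσ a).covol +
      1 / 2 * Real.log (lineBundle hO hσ (unitCompleteIdeal hO)).covol = a.div.deg := by
  classical
  have hO1 := hO.finite_int
  have hO2 := hO.free_int
  have ha1 := a.finite_int
  have ha2 := a.free_int
  let u := unitCompleteIdeal hO
  have hu1 := u.finite_int
  have hu2 := u.free_int
  obtain ⟨hr, hra⟩ := a.scale_spec hO
  have hru : ∀ r : 𝓞 K, ∀ y ∈ u.ideal, y * algebraMap (𝓞 K) A r ∈ O :=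
    fun r y hy => O.mul_mem hy (O.algebraMap_mem r)
  let b := Module.Free.chooseBasis ℤ a.ideal
  let c := Module.Free.chooseBasis ℤ u.ideal
  have e1 := a.norm_sq_mul_gram (σ := σ) hO hr hra b
  have e2 := u.norm_sq_mul_gram (σ := σ) hO hr (hru _) c
  have e3 := lineBundle_covol_eq hO hσ a b
  have e4 := lineBundle_covol_eq hO hσ u c
  have f1 := a.finite_quotient_scaled hO hr
  have f2 := u.finite_quotient_scaled hO hr
  have hn1 : normReal ((1 : (RealAlg A)ˣ) : RealAlg A) = 1 := by
    rw [normReal, Units.val_one, LinearMap.mulRight_one, LinearMap.det_id]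
  change _ = normReal ((1 : (RealAlg A)ˣ) : RealAlg A) ^ 2 * _ at e4
  rw [hn1, one_pow, one_mul] at e4
  have z4 := (lineBundle hO hσ u).covol_ne_zero
  have z3 := (lineBundle hO hσ a).covol_ne_zero
  rw [a.deg_div hO]
  change _ + 1 / 2 * Real.log (lineBundle hO hσ u).covol =
    Real.log (Nat.card (O ⧸ u.scaled a.scale)) - _ - _
  rw [e4] at z4 ⊢
  rw [e3] at z3 ⊢
  have c1 : (Nat.card (O ⧸ a.scaled a.scale) : ℝ) ^ 2 ≠ 0 :=
    pow_ne_zero _ (by exact_mod_cast Nat.card_pos.ne')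
  have c2 : (Nat.card (O ⧸ u.scaled a.scale) : ℝ) ^ 2 ≠ 0 :=
    pow_ne_zero _ (by exact_mod_cast Nat.card_pos.ne')
  have zN := left_ne_zero_of_mul z3
  have zG := right_ne_zero_of_mul z3
  set L := latDet ((twistedForm K σ).compl₁₂ (orderRealMap O) (orderRealMap O)) with hL
  set Nr := normReal (toReal (algebraMap (𝓞 K) A a.scale)) ^ 2
  set Ga := (gram (twistedForm K σ) fun i => toReal (b i : A)).det
  set Gu := (gram (twistedForm K σ) fun i => toReal (c i : A)).det
  have e5 : Gu * Nat.card (O ⧸ a.scaled a.scale) ^ 2 = Ga * Nat.card (O ⧸ u.scaled a.scale) ^ 2 := by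
    -- The case r = 1 for the ideal O identifies `L` with the Gram determinant `Gu`; in particular
    -- `L` is nonzero, and by `e1` so is the norm of r that is to be cancelled.
    have e6 := u.norm_sq_mul_gram (σ := σ) hO one_ne_zero (hru _) c
    have htop : u.scaled 1 = ⊤ := by
      rw [eq_top_iff]
      exact fun y _ => ⟨y, y.2, by rw [map_one, mul_one]⟩
    have h1 : normReal (toReal (algebraMap (𝓞 K) A 1)) = 1 := by rw [map_one]; exact hn1
    have hcard : Nat.card (O ⧸ u.scaled 1) = 1 := by
      rw [htop]
      exact Nat.card_unique
    rw [h1, hcard, Nat.cast_one, one_pow, one_mul, one_mul] at e6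
    change Gu = L at e6
    have hL0 : L ≠ 0 := e6 ▸ z4
    have hN0 : Nr ≠ 0 := by
      intro h0
      rw [h0, zero_mul] at e1
      exact mul_ne_zero c1 hL0 e1.symm
    apply mul_left_cancel₀ hN0
    calc Nr * (Gu * Nat.card (O ⧸ a.scaled a.scale) ^ 2)
        = (Nr * Gu) * Nat.card (O ⧸ a.scaled a.scale) ^ 2 := by ring
      _ = (Nat.card (O ⧸ a.scaled a.scale) ^ 2 * L) * Nat.card (O ⧸ u.scaled a.scale) ^ 2 := by
        rw [e2]; ring
      _ = Nr * (Ga * Nat.card (O ⧸ u.scaled a.scale) ^ 2) := by rw [← e1]; ring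
  have h5 := congrArg Real.log e5
  rw [Real.log_mul z4 c1, Real.log_mul zG c2, Real.log_pow, Real.log_pow] at h5
  rw [Real.log_mul zN zG, Real.log_pow, Real.log_abs]
  push_cast at h5 ⊢
  linarith

theorem finrank_fullIdeal (hO : IsOrder O) (a : FullIdeal O) :
    Module.finrank ℤ a.ideal = Module.finrank ℤ O :=
  congrArg Cardinal.toNat (a.isFull.rank_eq.trans (isFull_val hO).rank_eq.symm)

theorem rank_lineBundle [Nontrivial A] [IsSemisimpleRing A] (hO : IsOrder O)
    (hσ : IsPositiveInvolution K σ) (a : CompleteIdeal O) : (lineBundle hO hσ a).rank = 1 := by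
  have h1 := (lineBundle hO hσ a).rank_mul hO
  have h2 : Module.finrank ℤ (lineBundle hO hσ a).carrier = Module.finrank ℤ O :=
    finrank_fullIdeal hO a.toFullIdeal
  rw [h2] at h1
  exact Nat.eq_of_mul_eq_mul_right hO.finrank_pos (h1.trans (one_mul _).symm)

end DegreeFormula

/-! ### The canonical volume and the Euler-Minkowski characteristic. -/

section EulerChar

variable {K : Type w} [Field K] [NumberField K] {A : Type u} [Ring A] [Algebra K A] [Algebra ℚ A]
  [FiniteDimensional K A]
variable {O : Subalgebra (𝓞 K) A} {σ : RealAlg A →ₗ[ℝ] RealAlg A}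

/-- The volume is normalized by one fixed basis. In another basis Lebesgue measure gives the factor
|det W|, and the Gram determinant changes by its square, so the normalization is independent of the
basis. -/
theorem canonicalVolume_parallelepiped {I : Type*} [Fintype I] [DecidableEq I]
    (e : Module.Basis I ℝ (RealAlg A)) :
    (canonicalVolume K {y : RealAlg A | ∃ t : I → ℝ, (∀ i, t i ∈ Set.Ico (0 : ℝ) 1) ∧
      y = ∑ i, t i • e i}).toReal = √|(gram (trMul K A) e).det| := by
  have hfin : Module.Finite ℚ A := Module.Finite.trans K A
  rw [canonicalVolume]
  set v := Module.finBasis ℝ (RealAlg A)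
  let e' := e.reindex (e.indexEquiv v)
  let W := e'.map v.equivFun
  have himage : v.equivFun '' {y : RealAlg A | ∃ t : I → ℝ, (∀ i, t i ∈ Set.Ico (0 : ℝ) 1) ∧
      y = ∑ i, t i • e i} = ZSpan.fundamentalDomain W := by
    ext m
    rw [ZSpan.mem_fundamentalDomain]
    have hrepr : ∀ i, W.repr m i = e.repr (v.equivFun.symm m) ((e.indexEquiv v).symm i) := by
      intro i
      simp [W, e']
    constructor
    · rintro ⟨y, ⟨t, ht, rfl⟩, rfl⟩ i
      rw [hrepr, LinearEquiv.symm_apply_apply, e.repr_sum_self]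
      exact ht _
    · intro h
      refine ⟨v.equivFun.symm m, ⟨fun i => e.repr (v.equivFun.symm m) i, fun i => ?_,
        (e.sum_repr _).symm⟩, v.equivFun.apply_symm_apply m⟩
      have := h (e.indexEquiv v i)
      rwa [hrepr, Equiv.symm_apply_apply] at this
  rw [himage, ZSpan.volume_fundamentalDomain, ENNReal.toReal_mul,
    ENNReal.toReal_ofReal (Real.sqrt_nonneg _), ENNReal.toReal_ofReal (abs_nonneg _)]
  have hdet : (gram (trMul K A) e).det = (Matrix.of W).det ^ 2 *
      (Matrix.of fun i j => trReal K A (v i * v j)).det := by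
    have h1 : (gram (trMul K A) e).det = (gram (trMul K A) e').det := by
      rw [← det_gram_reindex (trMul K A) e' (e.indexEquiv v)]
      congr 2
      ext i
      simp [e']
    rw [h1]
    refine det_gram_of_comb (trMul K A) v e' (Matrix.of W) fun i => ?_
    simp only [Matrix.of_apply, W, Module.Basis.map_apply, Module.Basis.equivFun_apply]
    exact (v.sum_repr (e' i)).symm
  rw [hdet, abs_mul, abs_pow, Real.sqrt_mul (by positivity), Real.sqrt_sq (abs_nonneg _), mul_comm]

/-- The volume is formed with tr(xy) and the covolume with tr(xy^*); by `abs_det_twist` the Gram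
determinants agree in absolute value. -/
theorem eulerChar_unit (hO : IsOrder O) (hσ : IsPositiveInvolution K σ) :
    (unitCompleteIdeal hO).eulerChar =
      -(1 / 2) * Real.log (lineBundle hO hσ (unitCompleteIdeal hO)).covol := by
  classical
  let u := unitCompleteIdeal hO
  have hu1 := u.finite_int
  have hu2 := u.free_int
  let b := Module.Free.chooseBasis ℤ u.ideal
  have h1 : u.fundamentalDomain = {y : RealAlg A |
      ∃ t : Module.Free.ChooseBasisIndex ℤ u.ideal → ℝ, (∀ i, t i ∈ Set.Ico (0 : ℝ) 1) ∧
      y = ∑ i, t i • u.toRealBasis b i} := by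
    have h2 : ∀ i, ((u.infty : RealAlg A) * toReal (b i : A)) = u.toRealBasis b i := fun i => by
      rw [FullIdeal.toRealBasis_apply]
      exact one_mul _
    simp only [← h2]
    rfl
  have h3 : |(gram (trMul K A) (u.toRealBasis b)).det| =
      |(gram (twistedForm K σ) (u.toRealBasis b)).det| :=
    (abs_det_twist (u.toRealBasis b) (trMul K A) σ hσ.invol).symm
  have hn1 : normReal ((1 : (RealAlg A)ˣ) : RealAlg A) = 1 := by
    rw [normReal, Units.val_one, LinearMap.mulRight_one, LinearMap.det_id]
  have e4 := lineBundle_covol_eq hO hσ u b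
  change _ = normReal ((1 : (RealAlg A)ˣ) : RealAlg A) ^ 2 * _ at e4
  rw [hn1, one_pow, one_mul, ← funext (u.toRealBasis_apply b)] at e4
  change u.eulerChar = -(1 / 2) * Real.log (lineBundle hO hσ u).covol
  rw [CompleteIdeal.eulerChar, h1, canonicalVolume_parallelepiped, h3, e4,
    Real.log_sqrt (abs_nonneg _), Real.log_abs]
  ring

theorem discr_eq_one_of_bijective (h : Function.Bijective (algebraMap ℚ K)) : discr K = 1 := by
  rw [← discr_eq_discr_of_ringEquiv ℚ (RingEquiv.ofBijective (algebraMap ℚ K) h)]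
  exact Rat.numberField_discr

end EulerChar

/-! ### Square roots of positive elements -/

section PosSqrt

variable {K : Type w} [Field K] [NumberField K] {A : Type u} [Ring A] [Algebra K A] [Algebra ℚ A]
  [FiniteDimensional K A] {σ : RealAlg A →ₗ[ℝ] RealAlg A}

theorem IsPositiveInvolution.map_one (hσ : IsPositiveInvolution K σ) : σ 1 = 1 := by
  have := hσ.map_mul 1 (σ 1)
  rwa [one_mul, hσ.invol, one_mul, eq_comm] at this

theorem IsPositiveInvolution.map_aeval (hσ : IsPositiveInvolution K σ) {β : RealAlg A}
    (hβ : σ β = β) (p : Polynomial ℝ) : σ (Polynomial.aeval β p) = Polynomial.aeval β p := by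
  have hpow : ∀ n : ℕ, σ (β ^ n) = β ^ n := by
    intro n
    induction n with
    | zero => rw [pow_zero, hσ.map_one]
    | succ n ih => rw [pow_succ, hσ.map_mul, ih, hβ, ← pow_succ', pow_succ]
  rw [Polynomial.aeval_eq_sum_range, map_sum]
  exact Finset.sum_congr rfl fun i _ => by rw [map_smul, hpow]

theorem aeval_mulRight (β : RealAlg A) (p : Polynomial ℝ) (x : RealAlg A) :
    Polynomial.aeval (LinearMap.mulRight ℝ β) p x = x * Polynomial.aeval β p := by
  rw [Polynomial.aeval_eq_sum_range, Polynomial.aeval_eq_sum_range, LinearMap.sum_apply,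
    Finset.mul_sum]
  refine Finset.sum_congr rfl fun i _ => ?_
  rw [LinearMap.smul_apply, LinearMap.pow_mulRight, LinearMap.mulRight_apply, mul_smul_comm]

/-- T is self-adjoint with positive eigenvalues for the inner product B. A square root that is a
polynomial in T is what is needed: for T a right multiplication it is again a right multiplication,
by an element fixed by σ. -/
theorem exists_polynomial_sq {V : Type*} [AddCommGroup V] [Module ℝ V] [FiniteDimensional ℝ V]
    (B : V →ₗ[ℝ] V →ₗ[ℝ] ℝ) (hsymm : ∀ x y, B x y = B y x) (hpos : ∀ x, x ≠ 0 → 0 < B x x)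
    (T : V →ₗ[ℝ] V) (hT : ∀ x y, B (T x) y = B x (T y)) (hTpos : ∀ x, x ≠ 0 → 0 < B (T x) x) :
    ∃ p : Polynomial ℝ, ∀ x, Polynomial.aeval T p (Polynomial.aeval T p x) = T x := by
  let core : InnerProductSpace.Core ℝ V :=
    { inner := fun x y => B x y
      conj_inner_symm := fun x y => hsymm y x
      re_inner_nonneg := fun x => by
        by_cases hx : x = 0
        · simp [hx]
        · exact (hpos x hx).le
      add_left := fun x y z => by simp
      smul_left := fun x y r => by simp
      definite := fun x hx => by
        by_contra h0
        exact (hpos x h0).ne' hx }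
  let : NormedAddCommGroup V := core.toNormedAddCommGroup
  let : InnerProductSpace ℝ V := InnerProductSpace.ofCore core.toCore
  have hsym : T.IsSymmetric := fun x y => hT x y
  let b := hsym.eigenvectorBasis rfl
  let ev := hsym.eigenvalues rfl
  have hb : ∀ i, T (b i) = ev i • b i := fun i => hsym.apply_eigenvectorBasis rfl i
  have hb0 : ∀ i, b i ≠ 0 := fun i => by simpa using b.toBasis.ne_zero i
  have hev : ∀ i, 0 < ev i := by
    intro i
    have h1 := hTpos (b i) (hb0 i)
    rw [hb, map_smul, LinearMap.smul_apply, smul_eq_mul] at h1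
    exact (mul_pos_iff_of_pos_right (hpos _ (hb0 i))).mp h1
  classical
  -- Interpolates the square root on the finite set of eigenvalues.
  let p := Lagrange.interpolate (Finset.univ.image ev) id Real.sqrt
  have hp : ∀ i, p.eval (ev i) = √(ev i) := fun i =>
    Lagrange.eval_interpolate_at_node (v := id) Real.sqrt Function.injective_id.injOn
      (Finset.mem_image_of_mem ev (Finset.mem_univ i))
  have hpb : ∀ i, Polynomial.aeval T p (b i) = √(ev i) • b i := by
    intro i
    rw [← hp]
    exact Module.End.aeval_apply_of_hasEigenvector
      ⟨Module.End.mem_eigenspace_iff.mpr (hb i), hb0 i⟩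
  refine ⟨p, fun x => ?_⟩
  have hcomp : (Polynomial.aeval T p) ∘ₗ (Polynomial.aeval T p) = T := by
    apply b.toBasis.ext
    intro i
    rw [OrthonormalBasis.coe_toBasis, LinearMap.comp_apply, hpb, map_smul, hpb, smul_smul,
      Real.mul_self_sqrt (hev i).le, hb]
  exact LinearMap.congr_fun hcomp x

/-- Right multiplication by β is self-adjoint and positive for tr(xy^*). Its polynomial square root
is right multiplication by some α = p(β) with σ α = α and α² = β, so α α^* = β; positivity makes β,
hence α, invertible. -/
theorem IsPositiveInvolution.exists_sqrt (hσ : IsPositiveInvolution K σ) {β : RealAlg A}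
    (hβ : σ β = β) (hpos : ∀ x, x ≠ 0 → 0 < trReal K A (x * β * σ x)) :
    ∃ u : (RealAlg A)ˣ, (u : RealAlg A) * σ u = β := by
  have hfinQ : Module.Finite ℚ A := Module.Finite.trans K A
  obtain ⟨p, hp⟩ := exists_polynomial_sq (twistedForm K σ) hσ.symm hσ.pos
    (LinearMap.mulRight ℝ β) (fun x y => by
      rw [twistedForm_apply, twistedForm_apply, LinearMap.mulRight_apply, LinearMap.mulRight_apply,
        hσ.map_mul, hβ, mul_assoc]) (fun x hx => hpos x hx)
  set α := Polynomial.aeval β p with hα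
  have hsq : α * α = β := by
    have h1 := hp 1
    rwa [aeval_mulRight, aeval_mulRight, LinearMap.mulRight_apply, one_mul, one_mul] at h1
  have hinj : Function.Injective (LinearMap.mulRight ℝ β) := by
    rw [injective_iff_map_eq_zero]
    intro x hx
    by_contra h0
    have h1 := hpos x h0
    rw [LinearMap.mulRight_apply] at hx
    rw [hx, zero_mul, map_zero] at h1
    exact lt_irrefl _ h1
  obtain ⟨γ, hγ⟩ := LinearMap.injective_iff_surjective.mp hinj 1
  rw [LinearMap.mulRight_apply] at hγ
  have hγ' : β * γ = 1 := by
    apply hinj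
    rw [LinearMap.mulRight_apply, LinearMap.mulRight_apply, mul_assoc, hγ, mul_one, one_mul]
  have hβu : IsUnit (α * α) := hsq ▸ ⟨⟨β, γ, hγ', hγ⟩, rfl⟩
  obtain ⟨u, hu⟩ := ((Commute.refl α).isUnit_mul_iff.mp hβu).1
  exact ⟨u, by rw [hu, hα, hσ.map_aeval hβ, ← hα, hsq]⟩

end PosSqrt

/-! ### Generation by line bundles -/

section Generation

variable {K : Type w} [Field K] [NumberField K] {A : Type u} [Ring A] [Algebra K A] [Algebra ℚ A]
variable {O : Subalgebra (𝓞 K) A} {σ : RealAlg A →ₗ[ℝ] RealAlg A}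

open ArithBundle

/-- E is identified with its image, a full ideal. A_ℝ-linearity on the left and hermitian symmetry
determine the metric by its value β at 1, namely as x β y^*; the archimedean component is a square
root of β. -/
theorem exists_isomorphic_lineBundle [FiniteDimensional K A] (hO : IsOrder O)
    (hσ : IsPositiveInvolution K σ)
    (E : ArithBundle.{u, u, w, u} O.val σ) {j : E.carrier →+ A} (hj : IsFull j)
    (hsmul : ∀ (c : O) (z : E.carrier), j (c • z) = (c : A) * j z) :
    ∃ a : CompleteIdeal O, Isomorphic E (lineBundle hO hσ a) := by
  let j' : E.carrier →ₗ[O] A := { j with map_smul' := hsmul }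
  let a : FullIdeal O :=
    { ideal := LinearMap.range j'
      fg := by
        have h1 : (LinearMap.range j').restrictScalars (𝓞 K) =
            LinearMap.range (j'.restrictScalars (𝓞 K)) := rfl
        rw [h1]
        exact Module.Finite.iff_fg.mp inferInstance
      span_eq_top := by
        rw [eq_top_iff]
        intro b _
        obtain ⟨n, hn, z, hz⟩ := hj.full b
        have h1 : b = (n : K)⁻¹ • (n • b) := by
          rw [← Int.cast_smul_eq_zsmul K, smul_smul, inv_mul_cancel₀ (Int.cast_ne_zero.mpr hn),
            one_smul]
        rw [h1, ← hz]
        exact Submodule.smul_mem _ _ (Submodule.subset_span ⟨z, rfl⟩) }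
  let φ : E.carrier ≃ₗ[O] a.ideal := LinearEquiv.ofInjective j' hj.injective
  let ψ : RealSpace E.carrier ≃ₗ[ℝ] RealSpace a.ideal :=
    φ.toAddEquiv.toIntLinearEquiv.baseChange ℤ ℝ _ _
  let J : RealSpace E.carrier ≃ₗ[ℝ] RealAlg A := ψ.trans a.realEquiv
  have hψ : ∀ x, ψ x = realMap (φ : E.carrier →+ a.ideal) x := fun x => rfl
  have hJt : ∀ r z, J (r ⊗ₜ z) = r ⊗ₜ[ℚ] (j z) := fun r z => a.realEmb_tmul r (φ z)
  have hJs : ∀ (c : O) x, J (realMap (DistribSMul.toAddMonoidHom E.carrier c) x) =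
      toReal (c : A) * J x := by
    intro c x
    induction x using TensorProduct.induction_on with
    | zero => simp
    | add s t hs ht => rw [map_add, map_add, map_add, mul_add, hs, ht]
    | tmul r z =>
      change J (r ⊗ₜ (c • z)) = _
      rw [hJt, hJt, Algebra.TensorProduct.tmul_mul_tmul, one_mul, hsmul]
  -- The vector of E_ℝ corresponding to 1 in A_ℝ; it need not lie in the lattice.
  set e := J.symm 1 with he
  set β := E.h e e with hβ
  have hleft : ∀ x y, E.h x y = J x * E.h e y := by
    have h1 : ∀ X y, E.h (J.symm X) y = X * E.h e y := by
      intro X y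
      induction X using realAlg_induction hO with
      | hadd X Y hX hY => rw [map_add, map_add, LinearMap.add_apply, hX, hY, add_mul]
      | h r c =>
        have h2 : J.symm (r • toReal (c : A)) =
            r • realMap (DistribSMul.toAddMonoidHom E.carrier c) e := by
          rw [LinearEquiv.symm_apply_eq, map_smul, hJs, he, LinearEquiv.apply_symm_apply, mul_one]
        rw [h2, map_smul, LinearMap.smul_apply, E.h_smul, smul_mul_assoc]
        rfl
    intro x y
    rw [← h1, LinearEquiv.symm_apply_apply]
  have hβσ : σ β = β := (E.h_conj e e).symm
  have hform : ∀ x y, E.h x y = J x * β * σ (J y) := by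
    intro x y
    rw [hleft, E.h_conj e y, hleft y e, hσ.map_mul, ← hβ, hβσ, mul_assoc]
  obtain ⟨v, hv⟩ := hσ.exists_sqrt hβσ (fun x hx => by
    have h1 := E.h_pos (J.symm x) (fun h => hx (by simpa using h))
    rwa [hform, LinearEquiv.apply_symm_apply] at h1)
  refine ⟨⟨a, v⟩, φ, fun x y => ?_⟩
  rw [hform x y, ← hv]
  rfl

section Quotient

/-- The sub-bundle of `E` given by a submodule, with the restricted metric. -/
def subBundle (E : ArithBundle.{u, u, w, u} O.val σ) (N : Submodule O E.carrier)
    (hfree : Module.Free A (BaseChange O.val.toRingHom N)) : ArithBundle.{u, u, w, u} O.val σ where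
  carrier := N
  moduleBase := N.module'
  tower := ⟨fun r c z => by ext; simp⟩
  finite := Module.Finite.of_injective (N.subtype.restrictScalars (𝓞 K)) Subtype.val_injective
  torsionFree r z h := (E.torsionFree r z (congrArg Subtype.val h)).imp_right Subtype.ext
  free := hfree
  h := E.h.compl₁₂ (realMap (N.subtype : N →+ E.carrier)) (realMap (N.subtype : N →+ E.carrier))
  h_smul c x y := by
    rw [LinearMap.compl₁₂_apply, LinearMap.compl₁₂_apply, realMap_smul, E.h_smul]
  h_conj x y := E.h_conj _ _
  h_pos x hx := by
    refine E.h_pos _ fun h => hx ?_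
    have hinj : Function.Injective (realMap (N.subtype : N →+ E.carrier)) :=
      Module.Flat.lTensor_preserves_injective_linearMap (M := ℝ)
        (N.subtype : N →+ E.carrier).toIntLinearMap Subtype.val_injective
    exact hinj (h.trans (map_zero _).symm)

variable {Q : Type u} [AddCommGroup Q] [Module O Q] [Module (𝓞 K) Q] [IsScalarTower (𝓞 K) O Q]

/-- The quotient bundle of `E` along a surjection `β : E → Q`, with the metric transported by an
orthogonal section of `β_ℝ`. -/
def quotBundle (E : ArithBundle.{u, u, w, u} O.val σ) (β : E.carrier →ₗ[O] Q)
    (hβ : Function.Surjective β) (htf : ∀ (r : 𝓞 K) (x : Q), r • x = 0 → r = 0 ∨ x = 0)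
    (hfree : Module.Free A (BaseChange O.val.toRingHom Q))
    (s : RealSpace Q →ₗ[ℝ] RealSpace E.carrier)
    (hs : ∀ t, realMap (β : E.carrier →+ Q) (s t) = t)
    (hsmul : ∀ (c : O) t, s (realMap (DistribSMul.toAddMonoidHom Q c) t) =
      realMap (DistribSMul.toAddMonoidHom E.carrier c) (s t)) :
    ArithBundle.{u, u, w, u} O.val σ where
  carrier := Q
  finite := Module.Finite.of_surjective (β.restrictScalars (𝓞 K)) hβ
  torsionFree := htf
  free := hfree
  h := E.h.compl₁₂ s s
  h_smul c x y := by
    rw [LinearMap.compl₁₂_apply, LinearMap.compl₁₂_apply, hsmul, E.h_smul]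
  h_conj x y := E.h_conj _ _
  h_pos x hx := by
    refine E.h_pos _ fun h => hx ?_
    rw [← hs x, h, map_zero]

/-- β_ℝ restricts to a bijection from the h-orthogonal complement of the kernel onto Q_ℝ, and s is
its inverse. It is O-linear because that complement is O-stable. The last clause supplies the
isometry on the orthogonal complement. -/
theorem exists_orthogonal_section (hO : IsOrder O) (hσ : IsPositiveInvolution K σ)
    (E : ArithBundle.{u, u, w, u} O.val σ) (β : E.carrier →ₗ[O] Q) (hβ : Function.Surjective β) :
    ∃ s : RealSpace Q →ₗ[ℝ] RealSpace E.carrier,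
      (∀ t, realMap (β : E.carrier →+ Q) (s t) = t) ∧
      (∀ (c : O) t, s (realMap (DistribSMul.toAddMonoidHom Q c) t) =
        realMap (DistribSMul.toAddMonoidHom E.carrier c) (s t)) ∧
      (∀ t z, E.h (s t) (realMap ((LinearMap.ker β).subtype : LinearMap.ker β →+ E.carrier) z) = 0) ∧
      ∀ y, (∀ z, E.h y (realMap ((LinearMap.ker β).subtype : LinearMap.ker β →+ E.carrier) z) = 0) →
        s (realMap (β : E.carrier →+ Q) y) = y := by
  let α := realMap ((LinearMap.ker β).subtype : LinearMap.ker β →+ E.carrier)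
  let β' := realMap (β : E.carrier →+ Q)
  let P : Submodule ℝ (RealSpace E.carrier) :=
    { carrier := {y | ∀ z, E.h y (α z) = 0}
      add_mem' := fun hy hy' z => by rw [map_add, LinearMap.add_apply, hy, hy', add_zero]
      zero_mem' := fun z => by rw [map_zero, LinearMap.zero_apply]
      smul_mem' := fun r y hy z => by rw [map_smul, LinearMap.smul_apply, hy, smul_zero] }
  have hex : Function.Exact α β' := by
    refine lTensor_exact ℝ
      (f := ((LinearMap.ker β).subtype : LinearMap.ker β →+ E.carrier).toIntLinearMap)
      (g := (β : E.carrier →+ Q).toIntLinearMap) (fun y => ?_) hβ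
    exact ⟨fun hy => ⟨⟨y, hy⟩, rfl⟩, by rintro ⟨z, rfl⟩; exact z.2⟩
  have hβ' : Function.Surjective β' :=
    LinearMap.lTensor_surjective ℝ (g := (β : E.carrier →+ Q).toIntLinearMap) hβ
  have hinj : ∀ y ∈ P, β' y = 0 → y = 0 := by
    intro y hy h0
    obtain ⟨z, hz⟩ := (hex y).mp h0
    by_contra hne
    have h1 := E.h_pos y hne
    have h2 := hy z
    rw [hz] at h2
    rw [h2, map_zero] at h1
    exact lt_irrefl _ h1
  -- Existence of the complement is linear algebra for the definite real form tr ∘ h; its orthogonal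
  -- complement then lies in the one for h.
  have hcompl : IsCompl (LinearMap.range α) (LinearMap.BilinForm.orthogonal E.trForm
      (LinearMap.range α)) := by
    rw [LinearMap.BilinForm.isCompl_orthogonal_iff_disjoint
      (fun y z h => (E.trForm_comm hσ z y).trans h)]
    rw [Submodule.disjoint_def]
    intro y hy hy'
    by_contra hne
    exact (E.h_pos y hne).ne' (hy' y hy)
  have hle : LinearMap.BilinForm.orthogonal E.trForm (LinearMap.range α) ≤ P := by
    intro y hy
    refine orthogonal_of_tr hO hσ E (LinearMap.ker β).subtype y fun z => ?_
    rw [E.trForm_comm hσ]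
    exact hy _ ⟨z, rfl⟩
  have hbij : Function.Bijective (β'.domRestrict P) := by
    constructor
    · rw [injective_iff_map_eq_zero]
      intro y hy
      exact Subtype.ext (hinj y y.2 hy)
    · intro t
      obtain ⟨y, rfl⟩ := hβ' t
      have hy : y ∈ LinearMap.range α ⊔ LinearMap.BilinForm.orthogonal E.trForm
          (LinearMap.range α) := hcompl.sup_eq_top ▸ Submodule.mem_top
      obtain ⟨_, ⟨z, rfl⟩, p, hp, rfl⟩ := Submodule.mem_sup.mp hy
      refine ⟨⟨p, hle hp⟩, ?_⟩
      change β' p = β' (α z + p)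
      rw [map_add, hex.apply_apply_eq_zero, zero_add]
  let ε := LinearEquiv.ofBijective (β'.domRestrict P) hbij
  have hsβ : ∀ y (hy : y ∈ P), (ε.symm (β' y) : RealSpace E.carrier) = y := fun y hy =>
    congrArg Subtype.val (ε.symm_apply_apply ⟨y, hy⟩)
  have hβs : ∀ t, β' (ε.symm t) = t := fun t => ε.apply_symm_apply t
  refine ⟨P.subtype ∘ₗ (ε.symm : RealSpace Q →ₗ[ℝ] P), hβs, fun c t => ?_,
    fun t => (ε.symm t).2, hsβ⟩
  have h1 : realMap (DistribSMul.toAddMonoidHom E.carrier c) (ε.symm t : RealSpace E.carrier) ∈ P := by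
    intro z
    rw [E.h_smul, (ε.symm t).2 z, mul_zero]
  have h2 := hsβ _ h1
  have h3 : β' (realMap (DistribSMul.toAddMonoidHom E.carrier c)
      (ε.symm t : RealSpace E.carrier)) = realMap (DistribSMul.toAddMonoidHom Q c) t := by
    conv_rhs => rw [← hβs t]
    exact realMap_smul β c _
  rw [h3] at h2
  exact h2

theorem exists_shortExact (hO : IsOrder O) (hσ : IsPositiveInvolution K σ)
    (E : ArithBundle.{u, u, w, u} O.val σ) (β : E.carrier →ₗ[O] Q) (hβ : Function.Surjective β)
    (htf : ∀ (r : 𝓞 K) (x : Q), r • x = 0 → r = 0 ∨ x = 0)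
    (hfree : Module.Free A (BaseChange O.val.toRingHom Q))
    (hfree' : Module.Free A (BaseChange O.val.toRingHom (LinearMap.ker β))) :
    ∃ (E' E'' : ArithBundle.{u, u, w, u} O.val σ) (_e' : E'.carrier ≃ₗ[O] LinearMap.ker β)
      (_e'' : E''.carrier ≃ₗ[O] Q) (a : E'.carrier →ₗ[O] E.carrier)
      (b : E.carrier →ₗ[O] E''.carrier), IsShortExact E' E E'' a b := by
  obtain ⟨s, hs, hsmul, horth, huniq⟩ := exists_orthogonal_section hO hσ E β hβ
  refine ⟨subBundle E (LinearMap.ker β) hfree', quotBundle E β hβ htf hfree s hs hsmul,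
    LinearEquiv.refl O _, LinearEquiv.refl O _, (LinearMap.ker β).subtype, β, ?_⟩
  constructor
  · exact Subtype.val_injective
  · intro y
    exact ⟨fun hy => ⟨⟨y, hy⟩, rfl⟩, by rintro ⟨z, rfl⟩; exact z.2⟩
  · exact hβ
  · exact fun x y => rfl
  · intro x y hx hy
    exact congrArg₂ (fun p q => E.h p q) (huniq x hx) (huniq y hy)
  · exact fun t => ⟨s t, horth t, hs t⟩

end Quotient

/-- Dévissage: projecting a full lattice of A^(n+1) to the last n coordinates leaves a kernel full
in A, which is a line bundle, and an image full in A^n, to which induction applies. -/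
theorem hom_eq_of_full [FiniteDimensional K A] (hO : IsOrder O)
    (hσ : IsPositiveInvolution K σ) {G : Type*} [AddCommGroup G]
    {d d' : K0.{u, u, w, u} O.val σ →+ G}
    (hd : ∀ a : CompleteIdeal O, d (lineBundle hO hσ a).cls = d' (lineBundle hO hσ a).cls) :
    ∀ (n : ℕ) (E : ArithBundle.{u, u, w, u} O.val σ) (j : E.carrier →+ (Fin n → A)), IsFull j →
      (∀ (c : O) (z : E.carrier), j (c • z) = (c : A) • j z) → d E.cls = d' E.cls := by
  intro n
  induction n with
  | zero =>
    intro E j hj _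
    have hsub : Subsingleton E.carrier := hj.injective.subsingleton
    -- For E = 0 this sequence is exact, so [E] = [E] + [E] and the class vanishes.
    have hex : IsShortExact E E E 0 0 := by
      have : Subsingleton (RealSpace E.carrier) := ⟨fun x y => by
        have h0 : ∀ x : RealSpace E.carrier, x = 0 := fun x => by
          induction x using TensorProduct.induction_on with
          | zero => rfl
          | add s t hs ht => rw [hs, ht, add_zero]
          | tmul r z => rw [Subsingleton.elim z 0, TensorProduct.tmul_zero]
        rw [h0 x, h0 y]⟩
      refine ⟨Function.injective_of_subsingleton _, fun y => ?_, fun y => ⟨0, Subsingleton.elim _ _⟩,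
        fun x y => ?_, fun x y _ _ => ?_, fun t => ⟨0, fun z => by simp, Subsingleton.elim _ _⟩⟩
      · exact ⟨fun _ => ⟨0, Subsingleton.elim _ _⟩, fun _ => Subsingleton.elim _ _⟩
      · congr 1 <;> [congr 1; skip] <;> exact Subsingleton.elim _ _
      · congr 1 <;> [congr 1; skip] <;> exact Subsingleton.elim _ _
    have h1 : E.cls = 0 := by
      have := cls_eq_of_shortExact hex
      exact left_eq_add.mp this
    rw [h1, map_zero, map_zero]
  | succ n ih =>
    intro E j hj hsmul
    let β₀ : E.carrier →ₗ[O] (Fin n → A) :=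
      { toFun := fun z => Fin.tail (j z)
        map_add' := fun y z => by rw [map_add]; rfl
        map_smul' := fun c z => by rw [hsmul]; rfl }
    let j'' : LinearMap.range β₀ →+ (Fin n → A) := (LinearMap.range β₀).subtype.toAddMonoidHom
    have hj'' : IsFull j'' := ⟨Subtype.val_injective, fun v => by
      obtain ⟨m, hm, z, hz⟩ := hj.full (Fin.cons 0 v)
      refine ⟨m, hm, ⟨β₀ z, z, rfl⟩, ?_⟩
      change Fin.tail (j z) = _
      rw [hz]
      rfl⟩
    have hs'' : ∀ (c : O) (z : LinearMap.range β₀), j'' (c • z) = (c : A) • j'' z :=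
      fun c z => rfl
    let β : E.carrier →ₗ[O] LinearMap.range β₀ := β₀.rangeRestrict
    let j' : LinearMap.ker β →+ A :=
      { toFun := fun z => j z 0
        map_add' := fun y z => by rw [Submodule.coe_add, map_add]; rfl
        map_zero' := by rw [Submodule.coe_zero, map_zero]; rfl }
    have hker : ∀ z : E.carrier, z ∈ LinearMap.ker β ↔ ∀ i : Fin n, j z i.succ = 0 := fun z => by
      rw [LinearMap.mem_ker, Subtype.ext_iff]
      exact funext_iff
    have hj' : IsFull j' := by
      constructor
      · rw [injective_iff_map_eq_zero]
        intro z hz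
        refine Subtype.ext (hj.injective ?_)
        rw [Submodule.coe_zero, map_zero]
        funext i
        refine Fin.cases hz (fun i => ?_) i
        exact (hker z).mp z.2 i
      · intro v
        obtain ⟨m, hm, z, hz⟩ := hj.full (Fin.cons v 0)
        refine ⟨m, hm, ⟨z, (hker z).mpr fun i => ?_⟩, ?_⟩
        · rw [hz]
          simp
        · change j z 0 = _
          rw [hz]
          rfl
    have hs' : ∀ (c : O) (z : LinearMap.ker β), j' (c • z) = (c : A) • j' z := fun c z => by
      change j (c • (z : E.carrier)) 0 = _
      rw [hsmul]
      rfl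
    -- A module with a full O-linear embedding in A^n has base change A^n; this provides the
    -- freeness required of both new bundles.
    have hfree'' : Module.Free A (BaseChange O.val.toRingHom (LinearMap.range β₀)) := by
      obtain ⟨e⟩ := hj''.exists_equiv hO hs''
      exact Module.Free.of_equiv e.symm
    have hfree' : Module.Free A (BaseChange O.val.toRingHom (LinearMap.ker β)) := by
      obtain ⟨e⟩ := hj'.exists_equiv hO hs'
      exact Module.Free.of_equiv e.symm
    have htf : ∀ (r : 𝓞 K) (y : LinearMap.range β₀), r • y = 0 → r = 0 ∨ y = 0 := by
      intro r y hy
      by_cases hr : r = 0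
      · exact Or.inl hr
      · obtain ⟨m, s, hm, hs⟩ := exists_int_multiple r hr
        refine Or.inr (Subtype.ext (zsmul_cancel (A := A) hm ?_))
        have h1 : m • (y : Fin n → A) = s • (r • (y : Fin n → A)) := by
          rw [← mul_smul, ← hs, Int.cast_smul_eq_zsmul]
        have h2 : r • (y : Fin n → A) = 0 := congrArg Subtype.val hy
        rw [h1, h2, smul_zero]
    obtain ⟨E', E'', e', e'', a, b, hex⟩ := exists_shortExact hO hσ E β
      β₀.surjective_rangeRestrict htf hfree'' hfree'
    rw [cls_eq_of_shortExact hex, map_add, map_add]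
    congr 1
    · obtain ⟨I, hI⟩ := exists_isomorphic_lineBundle hO hσ E'
        (j := j'.comp e'.toLinearMap.toAddMonoidHom)
        ⟨hj'.injective.comp e'.injective, fun v => by
          obtain ⟨m, hm, z, hz⟩ := hj'.full v
          refine ⟨m, hm, e'.symm z, ?_⟩
          change j' (e' (e'.symm z)) = _
          rw [e'.apply_symm_apply, hz]⟩
        (fun c z => by
          change j' (e' (c • z)) = _
          rw [map_smul, hs']
          rfl)
      rw [cls_eq_of_isomorphic hI, hd]
    · refine ih E'' (j''.comp e''.toLinearMap.toAddMonoidHom)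
        ⟨hj''.injective.comp e''.injective, fun v => ?_⟩ (fun c z => ?_)
      · obtain ⟨m, hm, z, hz⟩ := hj''.full v
        refine ⟨m, hm, e''.symm z, ?_⟩
        change j'' (e'' (e''.symm z)) = _
        rw [e''.apply_symm_apply, hz]
      · change j'' (e'' (c • z)) = _
        rw [map_smul, hs'']
        rfl

end Generation

/-! ### The rank, push-forward and degree homomorphisms on Grothendieck groups. -/

section GlobalHoms

variable {K : Type w} [Field K] [NumberField K]

/-- A version of `orthogonal_of_tr` that asks of σ only invariance of the trace and σ² = 1. It
serves for R, where nondegeneracy of the trace form of K replaces positivity of the involution. -/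
theorem ArithBundle.orthogonal_of_nondegenerate {A : Type u} [Ring A] [Algebra K A] [Algebra ℚ A]
    {O : Type x} [Ring O] [Algebra (𝓞 K) O] {ι : O →ₐ[𝓞 K] A} {σ : RealAlg A →ₗ[ℝ] RealAlg A}
    (htr : ∀ y, trReal K A (σ y) = trReal K A y) (hinv : ∀ y, σ (σ y) = y)
    (hnd : ∀ y, (∀ c : O, trReal K A (toReal (ι c) * y) = 0) → y = 0)
    {E' E : ArithBundle.{u, v, w, x} ι σ} (α : E'.carrier →ₗ[O] E.carrier) (y : RealSpace E.carrier)
    (h : ∀ z, E.trForm y (realMap (α : E'.carrier →+ E.carrier) z) = 0) (z) :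
    E.h y (realMap (α : E'.carrier →+ E.carrier) z) = 0 := by
  have h1 : σ (E.h y (realMap (α : E'.carrier →+ E.carrier) z)) = 0 := by
    refine hnd _ fun c => ?_
    have h2 := h (realMap (DistribSMul.toAddMonoidHom E'.carrier c) z)
    rwa [ArithBundle.realMap_smul, ArithBundle.trForm_apply, E.h_conj, E.h_smul, htr,
      E.h_conj] at h2
  rw [← hinv (E.h y _), h1, map_zero]

theorem eq_zero_of_tr_integer_mul (y : RealAlg K)
    (h : ∀ c : 𝓞 K, trReal K K (toReal (c : K) * y) = 0) : y = 0 := by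
  refine trReal_nondeg y fun k => ?_
  obtain ⟨⟨c, m⟩, hk⟩ := IsLocalization.surj
    (Algebra.algebraMapSubmonoid (𝓞 K) (nonZeroDivisors ℤ)) k
  obtain ⟨n, hn, hm⟩ := m.2
  have hc : (c : K) = n • k := by
    rw [zsmul_eq_mul, mul_comm]
    simpa [← hm] using hk.symm
  have h1 : toReal (c : K) = (n : ℝ) • toReal k := by
    rw [hc, toReal, TensorProduct.tmul_smul, Int.cast_smul_eq_zsmul]
  have h2 := h c
  rw [h1, smul_mul_assoc, map_smul, smul_eq_zero] at h2
  exact h2.resolve_left (Int.cast_ne_zero.mpr (nonZeroDivisors.ne_zero hn))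

theorem ArithBundle.Isomorphic.finrank_eq {A : Type u} [Ring A] [Algebra K A] [Algebra ℚ A]
    {O : Type x} [Ring O] [Algebra (𝓞 K) O] {ι : O →ₐ[𝓞 K] A} {σ : RealAlg A →ₗ[ℝ] RealAlg A}
    {E E' : ArithBundle.{u, v, w, x} ι σ} (h : Isomorphic E E') :
    Module.finrank ℤ E.carrier = Module.finrank ℤ E'.carrier := by
  obtain ⟨φ, -⟩ := h
  exact φ.toAddEquiv.toIntLinearEquiv.finrank_eq

/-- In the form `baseDegree_eq` additivity is clear: log `covol` and the ℤ-rank are both additive in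
short exact sequences. -/
theorem BaseBundle.exists_degree_hom :
    ∃ F : BaseK0.{v, w} K →+ ℝ, ∀ E : BaseBundle.{v, w} K, F E.cls = baseDegree E := by
  refine exists_K0_hom _ (fun E E' h => ?_) fun E' E E'' α β h => ?_
  · rw [baseDegree_eq, baseDegree_eq, h.finrank_eq, h.covol_eq]
  · have hnd : ∀ y, (∀ c : 𝓞 K, trReal K K (toReal (Algebra.ofId (𝓞 K) K c) * y) = 0) → y = 0 :=
      eq_zero_of_tr_integer_mul
    have horth := ArithBundle.orthogonal_of_nondegenerate (E' := E') (E := E)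
      (trReal_conj (K := K)) (conj_conj (K := K)) hnd α
    rw [baseDegree_eq, baseDegree_eq, baseDegree_eq, h.finrank_eq,
      ArithBundle.IsShortExact.covol_eq (BaseBundle.trForm_comm E) horth h,
      Real.log_mul E'.covol_ne_zero E''.covol_ne_zero]
    push_cast
    ring

variable {A : Type u} [Ring A] [Algebra K A] [Algebra ℚ A]
variable {O : Subalgebra (𝓞 K) A} {σ : RealAlg A →ₗ[ℝ] RealAlg A}

theorem exists_rank_hom [Nontrivial A] [IsSemisimpleRing A] (hO : IsOrder O) :
    ∃ F : K0.{u, u, w, u} O.val σ →+ ℤ,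
      ∀ E : ArithBundle.{u, u, w, u} O.val σ, F E.cls = (E.rank : ℤ) := by
  refine exists_K0_hom _ (fun E E' h => ?_) fun E' E E'' α β h => ?_
  · have h1 := h.finrank_eq
    rw [← E.rank_mul hO, ← E'.rank_mul hO] at h1
    rw [Nat.eq_of_mul_eq_mul_right hO.finrank_pos h1]
  · have h1 := h.finrank_eq
    rw [← E.rank_mul hO, ← E'.rank_mul hO, ← E''.rank_mul hO, ← add_mul] at h1
    exact_mod_cast Nat.eq_of_mul_eq_mul_right hO.finrank_pos h1

theorem exists_pushforward_hom (hO : IsOrder O) (hσ : IsPositiveInvolution K σ) :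
    ∃ F : K0.{u, v, w, u} O.val σ →+ BaseK0.{v, w} K,
      ∀ E : ArithBundle.{u, v, w, u} O.val σ, F E.cls = (E.pushforward hσ).cls :=
  exists_K0_hom _ (fun _ _ h => cls_eq_of_isomorphic (h.pushforward hσ))
    fun _ _ _ _ _ h => cls_eq_of_shortExact (h.pushforward hO hσ)

end GlobalHoms

end NCArith

end

theorem mainTheorem5 {K : Type w} [Field K] [NumberField K]
    {A : Type u} [Ring A] [Nontrivial A] [Algebra K A] [Algebra ℚ A]
    [FiniteDimensional K A] [IsSemisimpleRing A]
    (O : Subalgebra (𝓞 K) A) (hO : NCArith.IsOrder O)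
    (σ : NCArith.RealAlg A →ₗ[ℝ] NCArith.RealAlg A) (hσ : NCArith.IsPositiveInvolution K σ) :
    ∃ (rk : NCArith.K0.{u, u, w, u} O.val σ →+ ℤ)
      (iStar : NCArith.K0.{u, u, w, u} O.val σ →+ NCArith.BaseK0.{u, w} K)
      (degK : NCArith.BaseK0.{u, w} K →+ ℝ),
      (∀ E : NCArith.ArithBundle.{u, u, w, u} O.val σ, rk E.cls = (E.rank : ℤ)) ∧
      (∀ E : NCArith.ArithBundle.{u, u, w, u} O.val σ, iStar E.cls = (E.pushforward hσ).cls) ∧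
      (∀ E : NCArith.BaseBundle.{u, w} K, degK E.cls = NCArith.baseDegree E) ∧
      (∃ degO : NCArith.K0.{u, u, w, u} O.val σ →+ ℝ,
        (∀ a : NCArith.CompleteIdeal O, degO (NCArith.lineBundle hO hσ a).cls = a.div.deg) ∧
        (∀ d : NCArith.K0.{u, u, w, u} O.val σ →+ ℝ,
          (∀ a : NCArith.CompleteIdeal O, d (NCArith.lineBundle hO hσ a).cls = a.div.deg) →
            d = degO) ∧
        (∀ c : NCArith.K0.{u, u, w, u} O.val σ,
          degO c = degK (iStar c) -
            rk c * degK (iStar (NCArith.lineBundle hO hσ (NCArith.unitCompleteIdeal hO)).cls))) ∧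
      (Function.Bijective (algebraMap ℚ K) →
        degK (iStar (NCArith.lineBundle hO hσ (NCArith.unitCompleteIdeal hO)).cls) =
          (NCArith.unitCompleteIdeal hO).eulerChar) := by
  open NCArith in
  obtain ⟨rk, hrk⟩ := exists_rank_hom (σ := σ) hO
  obtain ⟨iStar, hi⟩ := exists_pushforward_hom.{u, u, w} hO hσ
  obtain ⟨degK, hdeg⟩ := BaseBundle.exists_degree_hom.{u, w} (K := K)
  let u := lineBundle hO hσ (unitCompleteIdeal hO)
  -- L(a) and L(O) both have A-rank 1 and the same ℤ-rank, so the discriminant terms cancel and only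
  -- the ratio of covolumes remains.
  have hline : ∀ a : CompleteIdeal O, degK (iStar (lineBundle hO hσ a).cls) -
      rk (lineBundle hO hσ a).cls * degK (iStar u.cls) = a.div.deg := by
    intro a
    have h1 : Module.finrank ℤ (lineBundle hO hσ a).carrier = Module.finrank ℤ O :=
      finrank_fullIdeal hO a.toFullIdeal
    have h2 : Module.finrank ℤ u.carrier = Module.finrank ℤ O :=
      finrank_fullIdeal hO (unitIdeal hO)
    rw [hrk, rank_lineBundle, hi, hi, hdeg, hdeg, ArithBundle.baseDegree_pushforward,
      ArithBundle.baseDegree_pushforward,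
      h1, h2, ← log_covol_lineBundle hO hσ a]
    push_cast
    ring
  -- The degree is defined by the closed formula of (ii), which therefore holds definitionally; its
  -- values on line bundles are `hline`.
  let degO : K0.{u, u, w, u} O.val σ →+ ℝ :=
    degK.comp iStar - (AddMonoidHom.mulRight (degK (iStar u.cls))).comp
      ((Int.castAddHom ℝ).comp rk)
  refine ⟨rk, iStar, degK, hrk, hi, hdeg, ⟨degO, hline, fun d hd => ?_, fun c => rfl⟩, fun hK => ?_⟩
  · refine hom_ext_cls fun E => ?_
    obtain ⟨j, hj, hsmul⟩ := E.exists_full hO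
    exact hom_eq_of_full hO hσ (fun a => (hd a).trans (hline a).symm) _ E j hj hsmul
  · rw [hi, hdeg, ArithBundle.baseDegree_pushforward, eulerChar_unit hO hσ, discr_eq_one_of_bijective hK]
    simp
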